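/- **Setting.** Let $q\ge 1$ and $n_1,\dots,n_q\ge 1$ be integers and let $A$ be a Noetherian unique factorization domain with fraction field $K$. Let $A[\mathbf x]$ be the polynomial ring in the variables $x_{j,i}$ ($1\le j\le q$, $0\le i\le n_j$), with the $\mathbb N^q$-grading in which constants have degree $0$ and $x_{j,i}$ has degree the $j$-th basis vector. "For $\nu$ large enough" means: for all $\nu\ge\nu_0$ componentwise, for some $\nu_0\in\mathbb N^q$. A *componentwise free* $A[\mathbf x]$-module is a finitely generated $\mathbb N^q$-graded $A[\mathbf x]$-module all of whose components $M_\nu$ are free $A$-modules of finite rank. For an integral domain $B$ with fraction field $F$ and an $\mathbb N^q$-graded $B[\mathbf x]$-module $L$, the Hilbert polynomial $H_L$ is the polynomial in $q$ variables over $\mathbb Q$ with $H_L(\nu)=\dim_F(L_\nu\otimes_B F)$ for $\nu$ large enough. The relevant dimension of $L$ is the total degree of $H_L$ if $H_L\ne0$, and $-1$ if $H_L=0$. If $H_L$ is constant, this constant is the relevant degree $\operatorname{rdeg}_B(L)\in\mathbb N$. A multihomogeneous $g\in B[\mathbf x]$ is *filter-regular* for $L$ if $\{m\in L_\nu: gm=0\}=0$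 for $\nu$ large enough. A sequence $(g_0,\dots,g_{s-1})$ of multihomogeneous elements is a *filter-regular sequence* for $L$ if $g_i$ is filter-regular for $L/(g_0,\dots,g_{i-1})L$ for every $i$. For a multihomogeneous ideal $J$, the *filter-depth* $\operatorname{fgr}(J,L)\in\mathbb N\cup\{\infty\}$ is the supremum of the lengths of the filter-regular sequences for $L$ with entries in $J$. Let $M$ be a componentwise free $A[\mathbf x]$-module of relevant dimension $r\ge0$, and let $\mathbf f=(f_0,\dots,f_r)$ be a filter-regular sequence for $M$, where $f_i$ is multihomogeneous of degree $d_i$. Let $\mathbf K_\bullet^\nu(\mathbf f,M)$ be the degree-$\nu$ component of the Koszul complex of $\mathbf f$ with coefficients in $M$ (the summand of a $p$-element set $S\subseteq\{0,\dots,r\}$ is $M_{\nu-\sum_{i\in S}d_i}$). A complex $0\to C_s\to\dots\to C_0\to0$ of free $A$-modules of finite rank, with differentials $\partial_i:C_i\to C_{i-1}$, is *generically exact* if it becomes exact after tensoring with $K$. Its *Cayley determinant* is then the class in $K^\times/A^\times$ of $\prod_{i=1}^s\det(\varphi_i)^{(-1)^{i+1}}$, computed from bases $u_i=u_i'\sqcup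 u_i''$ of the $C_i$ with $u_0''=u_s'=\emptyset$, for which the blocks $\varphi_i$ of $\partial_i$ with columns $u_i''$ and rows $u_{i-1}'$ are square with nonzero determinant. The *M-resultant* $\operatorname{Res}_A(\mathbf f,M)\in A/A^\times$ is the common value of the Cayley determinants of $\mathbf K_\bullet^\nu(\mathbf f,M)$ for $\nu$ large enough. For a prime ideal $\mathfrak p$ of $A$ and $a\in A$, let $\operatorname{ord}_{\mathfrak p}(a)=\sup\{m\in\mathbb N: a\in\mathfrak p^mA_{\mathfrak p}\}\in\mathbb N\cup\{\infty\}$. It depends only on the class of $a$ in $A/A^\times$. **Theorem.** In this setting, let $\mathfrak p$ be a prime ideal of $A$ with residue field $\kappa=A_{\mathfrak p}/\mathfrak pA_{\mathfrak p}$. Let $\overline M=M\otimes_A\kappa$, let $J\subseteq\kappa[\mathbf x]$ be the ideal generated by the images of $f_0,\dots,f_r$, and let $N=\overline M/J\overline M$. Suppose that $\operatorname{fgr}(J,\overline M)=r$. Then the M-resultant $\operatorname{Res}_A(\mathbf f,M)$ is well defined: there is exactly one class in $A/A^\times$ such that, for $\nu$ large enough, $\mathbf K_\bullet^\nu(\mathbf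 f,M)$ is generically exact and its Cayley determinant is that class. Moreover the Hilbert polynomial of $N$ is constant, so that $\operatorname{rdeg}_\kappa(N)$ is defined, and $$\operatorname{ord}_{\mathfrak p}\bigl(\operatorname{Res}_A(\mathbf f,M)\bigr)\ \ge\ \operatorname{rdeg}_\kappa(N).$$ -/

import Mathlib

open scoped TensorProduct

attribute [local instance] MvPolynomial.algebraMvPolynomial

noncomputable section

/-! ### Multigraded polynomial rings and multigraded modules -/

/-- The index set of the variables `x_{p,i}`, `p = 1, …, q`, `i = 0, …, n_p`. -/
abbrev MultiVar {q : ℕ} (n : Fin q → ℕ) : Type := Σ p : Fin q, Fin (n p + 1)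

/-- The polynomial ring `A[x]` in the variables `x_{p,i}`. -/
abbrev MultiPoly {q : ℕ} (n : Fin q → ℕ) (A : Type*) [CommSemiring A] : Type _ :=
  MvPolynomial (MultiVar n) A

/-- The variable `x_{p,i}` has multidegree `e_p`, the `p`-th basis vector of `ℕ^q`. -/
def multiWeight {q : ℕ} (n : Fin q → ℕ) : MultiVar n → (Fin q → ℕ) :=
  fun v => Pi.single v.1 1

/-- `f` lies in the component of multidegree `d` of `A[x]`. -/
def IsMultihomogeneous {q : ℕ} {n : Fin q → ℕ} {A : Type*} [CommRing A]
    (f : MultiPoly n A) (d : Fin q → ℕ) : Prop :=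
  MvPolynomial.IsWeightedHomogeneous (multiWeight n) f d

section Graded

variable {q : ℕ} (n : Fin q → ℕ) {A : Type*} [CommRing A]
  {M : Type*} [AddCommGroup M] [Module A M] [Module (MultiPoly n A) M]

/-- The family `ν ↦ M_ν` is a multigraded `A[x]`-module structure on `M`. The components of a
multigraded `A[x]`-module are `A`-submodules, because the constants have multidegree zero. -/
structure IsMultigraded (gr : (Fin q → ℕ) → Submodule A M) : Prop where
  isInternal : DirectSum.IsInternal gr
  smul_mem : ∀ (a b : Fin q → ℕ) (f : MultiPoly n A) (m : M),
    IsMultihomogeneous f a → m ∈ gr b → f • m ∈ gr (a + b)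

/-- Componentwise free `A[x]`-modules: finitely generated multigraded modules whose components
are free `A`-modules of finite rank. -/
structure IsComponentwiseFree (gr : (Fin q → ℕ) → Submodule A M) : Prop where
  multigraded : IsMultigraded n gr
  finite : Module.Finite (MultiPoly n A) M
  component_free : ∀ ν, Module.Free A (gr ν)
  component_finite : ∀ ν, Module.Finite A (gr ν)

variable [IsScalarTower A (MultiPoly n A) M]

/-- The grading of `M / J M` (`J` a multihomogeneous ideal) whose components are the images of
the components of `M`. -/
def quotientGrading (gr : (Fin q → ℕ) → Submodule A M) (J : Ideal (MultiPoly n A)) :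
    (Fin q → ℕ) → Submodule A (M ⧸ (J • ⊤ : Submodule (MultiPoly n A) M)) :=
  fun ν => (gr ν).map ((J • ⊤ : Submodule (MultiPoly n A) M).mkQ.restrictScalars A)

end Graded

/-! ### Filter-regular sequences and filter-depth -/

section FilterRegular

variable {q : ℕ} (n : Fin q → ℕ) {A : Type*} [CommRing A]
  {M : Type*} [AddCommGroup M] [Module A M] [Module (MultiPoly n A) M]

/-- The colon submodule `(0 :_M f)` is eventually zero. (Used for multihomogeneous `f`.) -/
def IsFilterRegular (gr : (Fin q → ℕ) → Submodule A M) (f : MultiPoly n A) : Prop :=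
  ∃ ν₀ : Fin q → ℕ, ∀ ν, ν₀ ≤ ν → ∀ m ∈ gr ν, f • m = 0 → m = 0

variable [IsScalarTower A (MultiPoly n A) M]

/-- `(f_0, …, f_{s-1})` is a filter-regular sequence for `M`: the `f_i` are multihomogeneous and
`f_i` is filter-regular for `M / (f_0, …, f_{i-1}) M`. -/
def IsFilterRegularSeq (gr : (Fin q → ℕ) → Submodule A M) {s : ℕ}
    (f : Fin s → MultiPoly n A) : Prop :=
  ∀ i, (∃ d, IsMultihomogeneous (f i) d) ∧
    IsFilterRegular n (quotientGrading n gr (Ideal.span (f '' {j | j < i}))) (f i)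

/-- The filter-depth `fgr(J, M) ∈ ℕ ∪ {∞}`: the supremum of the lengths of the filter-regular
sequences for `M` with entries in `J`. -/
def filterDepth (gr : (Fin q → ℕ) → Submodule A M) (J : Ideal (MultiPoly n A)) : ℕ∞ :=
  ⨆ (s : ℕ) (_ : ∃ f : Fin s → MultiPoly n A, IsFilterRegularSeq n gr f ∧ ∀ i, f i ∈ J), (s : ℕ∞)

end FilterRegular

/-! ### Hilbert polynomial, relevant dimension, relevant degree -/

section Hilbert

variable {q : ℕ} {A : Type*} [CommRing A] [IsDomain A] {M : Type*} [AddCommGroup M] [Module A M]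

/-- `P` is the Hilbert polynomial `H_M`: it takes the value `dim_K (M_ν ⊗_A K)`, where
`K = Frac A`, at every large enough `ν`. There is at most one such `P`. -/
def IsHilbertPolynomial (gr : (Fin q → ℕ) → Submodule A M) (P : MvPolynomial (Fin q) ℚ) : Prop :=
  ∃ ν₀ : Fin q → ℕ, ∀ ν, ν₀ ≤ ν →
    MvPolynomial.eval (fun j => (ν j : ℚ)) P =
      (Module.finrank (FractionRing A) (FractionRing A ⊗[A] gr ν) : ℚ)

/-- The relevant dimension of `M` is the natural number `r`, i.e. the Hilbert polynomial of `M`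
is nonzero, of total degree `r`. -/
def HasRelevantDim (gr : (Fin q → ℕ) → Submodule A M) (r : ℕ) : Prop :=
  ∃ P, IsHilbertPolynomial gr P ∧ P ≠ 0 ∧ P.totalDegree = r

/-- The relevant dimension of `M` is `0` or `-1` (its Hilbert polynomial is a constant) and the
relevant degree of `M` is the natural number `e` (this constant is `e`). -/
def HasRelevantDegree (gr : (Fin q → ℕ) → Submodule A M) (e : ℕ) : Prop :=
  IsHilbertPolynomial gr (MvPolynomial.C (e : ℚ))

end Hilbert

/-! ### Change of coefficients -/

section BaseChange

/-- `M ⊗_A k` with its `k[x]`-module structure, realised as `k[x] ⊗_{A[x]} M`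
(recall `k[x] = A[x] ⊗_A k`). -/
abbrev CoeffChange {q : ℕ} (n : Fin q → ℕ) (A : Type*) [CommRing A] (k : Type*) [CommRing k]
    [Algebra A k] (M : Type*) [AddCommGroup M] [Module (MultiPoly n A) M] : Type _ :=
  MultiPoly n k ⊗[MultiPoly n A] M

variable {q : ℕ} (n : Fin q → ℕ) {A : Type*} [CommRing A] (k : Type*) [CommRing k] [Algebra A k]
  {M : Type*} [AddCommGroup M] [Module A M] [Module (MultiPoly n A) M]

/-- The multigrading of `M ⊗_A k`: its component of multidegree `ν` is (the image of)
`M_ν ⊗_A k`. -/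
def coeffChangeGrading (gr : (Fin q → ℕ) → Submodule A M) :
    (Fin q → ℕ) → Submodule k (CoeffChange n A k M) :=
  fun ν => Submodule.span k
    ((fun m : M => (1 : MultiPoly n k) ⊗ₜ[MultiPoly n A] m) '' (gr ν : Set M))

end BaseChange

/-! ### Cayley determinants -/

section Cayley

variable {A : Type*} [CommRing A] {C : ℕ → Type*} [∀ i, AddCommGroup (C i)] [∀ i, Module A (C i)]

/-- The complex `⋯ → C_1 → C_0 → 0` becomes exact after tensoring with the fraction field. -/
def IsGenericallyExact (d : ∀ i, C (i + 1) →ₗ[A] C i) : Prop :=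
  Function.Surjective ((d 0).baseChange (FractionRing A)) ∧
  ∀ i, Function.Exact ((d (i + 1)).baseChange (FractionRing A))
    ((d i).baseChange (FractionRing A))

/-- Bases `u_i` of the modules of a complex `0 → C_s → ⋯ → C_0 → 0` (extended by zero), with
partitions `u_i = u_i' ∪ u_i''`, where `u_0'' = u_s' = ∅` and `u_{i-1}'` and `u_i''` have the same
number `size i` of elements. The basis `u_i` is indexed by a disjoint union, the left half being
`u_i'` and the right half being `u_i''`. -/
structure PartitionedBases (C : ℕ → Type*) [∀ i, AddCommGroup (C i)] [∀ i, Module A (C i)]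
    (s : ℕ) where
  size : ℕ → ℕ
  basis : ∀ i, Module.Basis (Fin (size (i + 1)) ⊕ Fin (size i)) A (C i)
  size_zero : size 0 = 0
  size_top : ∀ i, s < i → size i = 0

/-- The square block `φ_{i+1}` (columns `u_{i+1}''`, rows `u_i'`) of the matrix of
`d_{i+1} : C_{i+1} → C_i`. -/
def PartitionedBases.block {s : ℕ} (u : PartitionedBases (A := A) C s)
    (d : ∀ i, C (i + 1) →ₗ[A] C i) (i : ℕ) :
    Matrix (Fin (u.size (i + 1))) (Fin (u.size (i + 1))) A :=
  (LinearMap.toMatrix (u.basis (i + 1)) (u.basis i) (d i)).toBlocks₁₂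

/-- `D` is the Cayley determinant `∏_{i=1}^s det(φ_i)^{(-1)^{i+1}}` of the complex, computed with
some system of bases and partitions for which all the `det(φ_i)` are nonzero. -/
def IsCayleyDet [IsDomain A] (d : ∀ i, C (i + 1) →ₗ[A] C i) (s : ℕ) (D : FractionRing A) : Prop :=
  ∃ u : PartitionedBases (A := A) C s, (∀ i < s, (u.block d i).det ≠ 0) ∧
    D = ∏ i ∈ Finset.range s,
      (algebraMap A (FractionRing A) (u.block d i).det) ^ ((-1 : ℤ) ^ i)

end Cayley

/-! ### Multigraded Koszul complexes -/

section Koszul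

variable {q : ℕ} {n : Fin q → ℕ} {A : Type*} [CommRing A]
  {M : Type*} [AddCommGroup M] [Module A M] [Module (MultiPoly n A) M]

open Classical in
/-- The summand `e_S ⊗ M_{ν - d_S}` (where `d_S = ∑_{i ∈ S} d_i`) of the component of
multidegree `ν` of the Koszul complex; it vanishes unless `d_S ≤ ν`. -/
def koszulPiece (gr : (Fin q → ℕ) → Submodule A M) {s : ℕ} (d : Fin s → (Fin q → ℕ))
    (ν : Fin q → ℕ) (S : Finset (Fin s)) : Submodule A M :=
  if ∑ i ∈ S, d i ≤ ν then gr (ν - ∑ i ∈ S, d i) else ⊥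

/-- The component `K_p^ν(f, M)` of multidegree `ν` of `(⋀^p L) ⊗ M`, where `L` is free on
`e_0, …, e_{s-1}` and `e_i` has multidegree `d_i`. An element is the family of its coordinates
with respect to the `e_S`, where `S` runs through the `p`-element subsets. -/
abbrev KoszulSlice (gr : (Fin q → ℕ) → Submodule A M) {s : ℕ} (d : Fin s → (Fin q → ℕ))
    (ν : Fin q → ℕ) (p : ℕ) : Type _ :=
  ∀ S : {S : Finset (Fin s) // S.card = p}, koszulPiece gr d ν S.1

theorem koszulPiece_smul_mem {gr : (Fin q → ℕ) → Submodule A M} (hgr : IsMultigraded n gr) {s : ℕ}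
    {d : Fin s → (Fin q → ℕ)} {f : Fin s → MultiPoly n A}
    (hf : ∀ i, IsMultihomogeneous (f i) (d i)) (ν : Fin q → ℕ) (T : Finset (Fin s)) (i : Fin s)
    (hi : i ∉ T) (m : M) (hm : m ∈ koszulPiece gr d ν (insert i T)) :
    f i • m ∈ koszulPiece gr d ν T := by
  unfold koszulPiece at *
  rw [Finset.sum_insert hi] at hm
  split_ifs at hm with h
  · have h' : ∑ j ∈ T, d j ≤ ν := le_trans (le_add_of_nonneg_left zero_le) h
    rw [if_pos h']
    have key := hgr.smul_mem _ _ _ _ (hf i) hm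
    have e : d i + (ν - (d i + ∑ j ∈ T, d j)) = ν - ∑ j ∈ T, d j := by
      funext c
      have := h c
      simp only [Pi.add_apply, Pi.sub_apply] at *
      omega
    rwa [e] at key
  · have : m = 0 := by simpa using hm
    subst this
    simp

variable [IsScalarTower A (MultiPoly n A) M]

/-- The map `m ↦ f_i m` from the summand of `e_{T ∪ {i}}` to that of `e_T`. -/
def koszulMul {gr : (Fin q → ℕ) → Submodule A M} (hgr : IsMultigraded n gr) {s : ℕ}
    {d : Fin s → (Fin q → ℕ)} {f : Fin s → MultiPoly n A}
    (hf : ∀ i, IsMultihomogeneous (f i) (d i)) (ν : Fin q → ℕ) (T : Finset (Fin s)) (i : Fin s)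
    (hi : i ∉ T) : koszulPiece gr d ν (insert i T) →ₗ[A] koszulPiece gr d ν T :=
  ((LinearMap.lsmul (MultiPoly n A) M (f i)).restrictScalars A).restrict
    (fun m hm => koszulPiece_smul_mem hgr hf ν T i hi m hm)

/-- The differential `∂_{p+1}^ν : K_{p+1}^ν(f, M) → K_p^ν(f, M)`, which sends
`e_{i_1} ∧ ⋯ ∧ e_{i_{p+1}} ⊗ m` (`i_1 < ⋯ < i_{p+1}`) to
`∑_t (-1)^{t+1} e_{i_1} ∧ ⋯ ∧ (omit e_{i_t}) ∧ ⋯ ∧ e_{i_{p+1}} ⊗ f_{i_t} m`. In coordinates, the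
coefficient of `e_T` is the sum over `i ∉ T` of `± f_i` times the coefficient of `e_{T ∪ {i}}`, the
sign being given by the number of elements of `T` below `i`. -/
def koszulDiff {gr : (Fin q → ℕ) → Submodule A M} (hgr : IsMultigraded n gr) {s : ℕ}
    {d : Fin s → (Fin q → ℕ)} {f : Fin s → MultiPoly n A}
    (hf : ∀ i, IsMultihomogeneous (f i) (d i)) (ν : Fin q → ℕ) (p : ℕ) :
    KoszulSlice gr d ν (p + 1) →ₗ[A] KoszulSlice gr d ν p :=
  LinearMap.pi fun T => ∑ i : {i : Fin s // i ∉ T.1},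
    (-1 : ℤ) ^ (T.1.filter (fun j => j < i.1)).card •
      (koszulMul hgr hf ν T.1 i.1 i.2 ∘ₗ
        LinearMap.proj (R := A)
          (φ := fun S : {S : Finset (Fin s) // S.card = p + 1} => koszulPiece gr d ν S.1)
          ⟨insert i.1 T.1, by rw [Finset.card_insert_of_notMem i.2, T.2]⟩)

/-- `R ∈ A / A^×` is the M-resultant `Res_A(f, M)`: for every large enough `ν`, the
component of multidegree `ν` of the Koszul complex of `f` with coefficients in `M` is generically
exact and its Cayley determinant lies in the class `R`. -/
def IsMResultant [IsDomain A] {gr : (Fin q → ℕ) → Submodule A M} (hgr : IsMultigraded n gr) {s : ℕ}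
    {d : Fin s → (Fin q → ℕ)} {f : Fin s → MultiPoly n A}
    (hf : ∀ i, IsMultihomogeneous (f i) (d i)) (R : Associates A) : Prop :=
  ∃ ν₀ : Fin q → ℕ, ∀ ν, ν₀ ≤ ν →
    IsGenericallyExact (koszulDiff hgr hf ν) ∧
    ∃ a : A, IsCayleyDet (koszulDiff hgr hf ν) s (algebraMap A (FractionRing A) a) ∧
      Associates.mk a = R

end Koszul

/-! ### The order function of a prime ideal -/

section Order

variable {A : Type*} [CommRing A] (p : Ideal A) [p.IsPrime]

/-- The order `ord_p(a)`: the largest `m` (`∞` if there is none) such that the image of `a` in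
`A_p` lies in the `m`-th power of the maximal ideal of `A_p`. -/
def primeOrder (a : A) : ℕ∞ :=
  ⨆ (m : ℕ) (_ : algebraMap A (Localization.AtPrime p) a ∈
    (IsLocalRing.maximalIdeal (Localization.AtPrime p)) ^ m), (m : ℕ∞)

theorem primeOrder_eq_of_associated {a b : A} (h : Associated a b) :
    primeOrder p a = primeOrder p b := by
  obtain ⟨u, rfl⟩ := h
  unfold primeOrder
  simp only [map_mul]
  have hu : IsUnit (algebraMap A (Localization.AtPrime p) (u : A)) := u.isUnit.map _
  simp only [Ideal.mul_unit_mem_iff_mem _ hu]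

/-- The order on classes in `A / A^×`. -/
def primeOrderClass (R : Associates A) : ℕ∞ :=
  Quotient.lift (primeOrder p) (fun _ _ h => primeOrder_eq_of_associated p h) R

end Order

end

/-! For `ν` large the slice of the Koszul complex of `f` in degree `ν` is a finite free resolution
of the torsion module `(M/(f)M)_ν`. Its Cayley determinant is compared with lengths at the primes
generated by a prime element, which gives existence and uniqueness of the resultant. At `𝔭` it is
computed in well-chosen bases, which gives the inequality.

Acyclicity. Every element of the ideal `(f)` acts on the Koszul complex by a map homotopic to zero
(`koszulD_koszulH`). Hence a filter-regular sequence of length `t` in `(f)` makes the complex of `s`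
elements exact in homological degrees above `s - t`, for large `ν` (`exact_koszulDiff`). Over `A`
one has `t = s = r + 1` and all higher homology vanishes. Over `κ` the hypothesis on the
filter-depth gives `t = r`, hence exactness in degrees at least two.

Existence and uniqueness. For bases `u_i = u_i' ∪ u_i''`, the order of the block `φ_i` at a prime
element is the sum of two consecutive defects, the lengths of `C_i/(im + ⟨u_i''⟩)`. The alternating
sum telescopes, so that the Cayley determinant has order equal to the length of `H_0`
(`PartitionedBases.ord_evenDet`). These orders are nonnegative, hence the determinant lies in the
factorial ring `A`, and it is determined up to a unit by the lengths of `(M/(f)M)_ν` over the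
localizations at prime elements. It remains to see that these lengths do not depend on `ν` large. By
Hilbert–Serre they are eventually polynomial. Dividing by a filter-regular element lowers by one the
degree bound for the generic rank, and also the one for the length of the torsion
(`isDeg_torsion_addMul`). Starting from a rank of degree `r` and no torsion, `r + 1` steps leave
rank zero and constant torsion length. One nonzero element of `A` kills all the torsion, so only
finitely many primes matter and the threshold is uniform (`exists_forall_prime_gradedLength_eq`).

The inequality. Exactness over `κ` in degrees at least two forces the higher differentials to have
the same rank over `κ` as over the fraction field. Bases can then be chosen for which all blocks
except the first are invertible at `𝔭` (`exists_partitionedBases`). Up to a unit of `A_𝔭` the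
resultant is the determinant of the first block, a square matrix whose reduction has its image
inside that of the last differential. The corank is therefore at least `dim_κ N_ν = rdeg N`, and a
determinant whose reduction has corank at least `e` lies in the `e`-th power of the maximal ideal
(`det_mem_maximalIdeal_pow`). The dimension `dim_κ N_ν` is eventually constant, since `N` is a
quotient of `M ⊗ κ` by `r` filter-regular elements, whose Hilbert function is already eventually
constant. -/

/-! ### Eventually polynomial functions on `ℕ^q` -/

/-- `h` is eventually a polynomial of degree less than `D`: all its `D`-fold differences in the
directions of the basis vectors vanish eventually. -/
def IsDeg {q : ℕ} : ℕ → ((Fin q → ℕ) → ℚ) → Prop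
  | 0, h => ∃ ν₀, ∀ ν, ν₀ ≤ ν → h ν = 0
  | D + 1, h => ∀ j, IsDeg D fun ν => h (ν + Pi.single j 1) - h ν

theorem pi_nat_induction {q : ℕ} {P : (Fin q → ℕ) → Prop} (h0 : P 0)
    (hs : ∀ μ j, P μ → P (μ + Pi.single j 1)) (μ : Fin q → ℕ) : P μ := by
  induction hn : ∑ j, μ j generalizing μ with
  | zero =>
    have : μ = 0 := by
      funext j
      exact (Finset.sum_eq_zero_iff.mp hn) j (Finset.mem_univ j)
    rwa [this]
  | succ k ih =>
    obtain ⟨j, hj⟩ : ∃ j, μ j ≠ 0 := by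
      by_contra! hcon
      simp [hcon] at hn
    have e : μ = Function.update μ j (μ j - 1) + Pi.single j 1 := by
      funext i
      by_cases hi : i = j
      · subst hi; simp; omega
      · simp [hi]
    rw [e]
    apply hs
    apply ih
    rw [e] at hn
    simp only [Pi.add_apply, Finset.sum_add_distrib, Finset.sum_pi_single', Finset.mem_univ,
      if_true] at hn
    omega

namespace IsDeg

variable {q : ℕ} {D : ℕ} {g h : (Fin q → ℕ) → ℚ}

theorem congr (hh : IsDeg D h) (e : ∃ ν₀, ∀ ν, ν₀ ≤ ν → g ν = h ν) : IsDeg D g := by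
  induction D generalizing g h with
  | zero =>
    obtain ⟨a, ha⟩ := hh
    obtain ⟨b, hb⟩ := e
    exact ⟨a ⊔ b, fun ν hν => (hb ν (le_trans le_sup_right hν)).trans
      (ha ν (le_trans le_sup_left hν))⟩
  | succ D ih =>
    intro j
    obtain ⟨b, hb⟩ := e
    refine ih (hh j) ⟨b, fun ν hν => ?_⟩
    rw [hb ν hν, hb _ (le_trans hν (le_add_of_nonneg_right zero_le))]

theorem add (hg : IsDeg D g) (hh : IsDeg D h) : IsDeg D fun ν => g ν + h ν := by
  induction D generalizing g h with
  | zero =>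
    obtain ⟨a, ha⟩ := hg
    obtain ⟨b, hb⟩ := hh
    exact ⟨a ⊔ b, fun ν hν => by
      simp [ha ν (le_trans le_sup_left hν), hb ν (le_trans le_sup_right hν)]⟩
  | succ D ih =>
    intro j
    refine (ih (hg j) (hh j)).congr ⟨0, fun ν _ => by ring⟩

theorem const_mul (c : ℚ) (hh : IsDeg D h) : IsDeg D fun ν => c * h ν := by
  induction D generalizing h with
  | zero =>
    obtain ⟨b, hb⟩ := hh
    exact ⟨b, fun ν hν => by simp [hb ν hν]⟩
  | succ D ih =>
    intro j
    refine (ih (hh j)).congr ⟨0, fun ν _ => by ring⟩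

theorem sub (hg : IsDeg D g) (hh : IsDeg D h) : IsDeg D fun ν => g ν - h ν :=
  (hg.add (hh.const_mul (-1))).congr ⟨0, fun ν _ => by ring⟩

theorem shift (hh : IsDeg D h) (c : Fin q → ℕ) : IsDeg D fun ν => h (ν + c) := by
  induction D generalizing h with
  | zero =>
    obtain ⟨b, hb⟩ := hh
    exact ⟨b, fun ν hν => hb _ (le_trans hν (le_add_of_nonneg_right zero_le))⟩
  | succ D ih =>
    intro j
    refine (ih (hh j)).congr ⟨0, fun ν _ => by rw [add_right_comm]⟩

theorem succ (hh : IsDeg D h) : IsDeg (D + 1) h := by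
  induction D generalizing h with
  | zero =>
    intro j
    exact IsDeg.sub (D := 0) (IsDeg.shift (D := 0) hh _) hh
  | succ D ih =>
    intro j
    exact ih (hh j)

theorem mono {E : ℕ} (hh : IsDeg D h) (hDE : D ≤ E) : IsDeg E h := by
  induction hDE with
  | refl => exact hh
  | step _ ih => exact ih.succ

theorem zero_fun : IsDeg D (fun _ : Fin q → ℕ => (0 : ℚ)) :=
  mono (D := 0) ⟨0, fun _ _ => rfl⟩ (Nat.zero_le D)

theorem const (c : ℚ) : IsDeg (D + 1) (fun _ : Fin q → ℕ => c) := by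
  intro j
  simpa using zero_fun

theorem sum {ι : Type*} (s : Finset ι) {h : ι → (Fin q → ℕ) → ℚ} (hh : ∀ i ∈ s, IsDeg D (h i)) :
    IsDeg D fun ν => ∑ i ∈ s, h i ν := by
  classical
  induction s using Finset.induction_on with
  | empty => simpa using zero_fun
  | insert a s ha ih =>
    simp only [Finset.sum_insert ha]
    exact (hh a (by simp)).add (ih fun i hi => hh i (by simp [hi]))

/-- Differences in arbitrary directions lower the degree. -/
theorem diff (hh : IsDeg (D + 1) h) (c : Fin q → ℕ) : IsDeg D fun ν => h (ν + c) - h ν := by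
  induction c using pi_nat_induction with
  | h0 => simpa using zero_fun
  | hs μ j ih =>
    refine (((hh j).shift μ).add ih).congr ⟨0, fun ν _ => ?_⟩
    rw [← add_assoc]
    ring

/-- Discrete Leibniz rule: the difference of `ν_j h` in direction `i` is `ν_j` times the difference
of `h`, plus a multiple of a shift of `h`. -/
theorem coord_mul (j : Fin q) (hh : IsDeg D h) : IsDeg (D + 1) fun ν => (ν j : ℚ) * h ν := by
  induction D generalizing h with
  | zero =>
    refine (zero_fun (D := 1)).congr ?_
    obtain ⟨b, hb⟩ := hh
    exact ⟨b, fun ν hν => by simp [hb ν hν]⟩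
  | succ D ih =>
    intro i
    have h1 := ih (hh i)
    have h2 := (hh.shift (Pi.single i 1)).const_mul ((Pi.single i 1 : Fin q → ℕ) j : ℚ)
    refine (h1.add h2).congr ⟨0, fun ν _ => ?_⟩
    simp only [Pi.add_apply, Nat.cast_add]
    ring

theorem monomial (s : Fin q → ℕ) : IsDeg (∑ j, s j + 1) fun ν => ∏ j, (ν j : ℚ) ^ s j := by
  induction s using pi_nat_induction with
  | h0 => simpa using const (D := 0) 1
  | hs μ j ih =>
    have e : ∑ i, (μ + Pi.single j 1 : Fin q → ℕ) i + 1 = (∑ j, μ j + 1) + 1 := by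
      simp [Finset.sum_add_distrib]
    rw [e]
    refine (ih.coord_mul j).congr ⟨0, fun ν _ => ?_⟩
    simp only [Pi.add_apply, pow_add, Finset.prod_mul_distrib]
    rw [mul_comm]
    congr 1
    rw [Finset.prod_eq_single j] <;> simp +contextual

theorem eval (P : MvPolynomial (Fin q) ℚ) :
    IsDeg (P.totalDegree + 1) fun ν => MvPolynomial.eval (fun j => (ν j : ℚ)) P := by
  simp only [MvPolynomial.eval_eq']
  refine sum _ fun s hs => (((monomial s).mono ?_).const_mul _)
  have := MvPolynomial.le_totalDegree hs
  rw [Finsupp.sum_fintype _ _ (by simp)] at this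
  omega

theorem eventually_const (hh : IsDeg 1 h) : ∃ ν₀, ∀ ν, ν₀ ≤ ν → h ν = h ν₀ := by
  choose b hb using hh
  refine ⟨Finset.univ.sup b, fun ν hν => ?_⟩
  obtain ⟨μ, rfl⟩ := exists_add_of_le hν
  clear hν
  induction μ using pi_nat_induction with
  | h0 => simp
  | hs μ j ih =>
    have := hb j (Finset.univ.sup b + μ)
      (le_trans (Finset.le_sup (Finset.mem_univ j)) (le_add_of_nonneg_right zero_le))
    rw [← add_assoc, ← ih]
    linarith

/-- Growth of functions of bounded degree. -/
theorem growth (hh : IsDeg (D + 1) h) :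
    ∃ C : ℚ, 0 ≤ C ∧ ∃ ν₀, ∀ ν, ν₀ ≤ ν → |h ν| ≤ C * (1 + ∑ j, (ν j : ℚ)) ^ D := by
  induction D generalizing h with
  | zero =>
    obtain ⟨ν₀, h0⟩ := hh.eventually_const
    exact ⟨|h ν₀|, abs_nonneg _, ν₀, fun ν hν => by simp [h0 ν hν]⟩
  | succ D ih =>
    choose C hC b hb using fun j => ih (hh j)
    set ν₀ := Finset.univ.sup b
    set K := ∑ j, C j
    have hK : 0 ≤ K := Finset.sum_nonneg fun j _ => hC j
    -- Go from `ν₀` to `ν₀ + μ` by `∑ μ_j` unit steps; each of them costs at most the bound for the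
    -- first differences.
    have key : ∀ μ : Fin q → ℕ, |h (ν₀ + μ)| ≤
        |h ν₀| + (∑ j, (μ j : ℚ)) * (K * (1 + ∑ j, ((ν₀ + μ) j : ℚ)) ^ D) := by
      intro μ
      induction μ using pi_nat_induction with
      | h0 => simp
      | hs μ j ihμ =>
        have h1 := hb j (ν₀ + μ)
          (le_trans (Finset.le_sup (Finset.mem_univ j)) (le_add_of_nonneg_right zero_le))
        rw [← add_assoc]
        have hS : ∑ i, (((ν₀ + μ + Pi.single j 1 : Fin q → ℕ) i : ℕ) : ℚ) = ∑ i, ((ν₀ + μ) i : ℚ) + 1 := by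
          simp only [Pi.add_apply, Nat.cast_add, Finset.sum_add_distrib]
          congr 1
          rw [Finset.sum_eq_single j] <;> simp +contextual
        have hS' : ∑ i, (((μ + Pi.single j 1 : Fin q → ℕ) i : ℕ) : ℚ) = ∑ i, (μ i : ℚ) + 1 := by
          simp only [Pi.add_apply, Nat.cast_add, Finset.sum_add_distrib]
          congr 1
          rw [Finset.sum_eq_single j] <;> simp +contextual
        rw [hS, hS']
        set S := ∑ i, ((ν₀ + μ) i : ℚ) with hSdef
        have hS0 : 0 ≤ S := Finset.sum_nonneg fun i _ => Nat.cast_nonneg _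
        have hT0 : 0 ≤ ∑ i, (μ i : ℚ) := Finset.sum_nonneg fun i _ => Nat.cast_nonneg _
        have hp : (1 + S) ^ D ≤ (1 + (S + 1)) ^ D := by gcongr; linarith
        have hCK : C j ≤ K := Finset.single_le_sum (fun i _ => hC i) (Finset.mem_univ j)
        have t : |h (ν₀ + μ + Pi.single j 1)| ≤ |h (ν₀ + μ + Pi.single j 1) - h (ν₀ + μ)| +
            |h (ν₀ + μ)| := by
          have := abs_add_le (h (ν₀ + μ + Pi.single j 1) - h (ν₀ + μ)) (h (ν₀ + μ))
          simpa using this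
        have u1 : C j * (1 + S) ^ D ≤ K * (1 + (S + 1)) ^ D := by gcongr
        have u2 : (∑ i, (μ i : ℚ)) * (K * (1 + S) ^ D) ≤
            (∑ i, (μ i : ℚ)) * (K * (1 + (S + 1)) ^ D) := by gcongr
        linarith
    refine ⟨|h ν₀| + K, by positivity, ν₀, fun ν hν => ?_⟩
    obtain ⟨μ, rfl⟩ := exists_add_of_le hν
    refine (key μ).trans ?_
    set S := ∑ i, ((ν₀ + μ) i : ℚ) with hSdef
    have hS0 : 0 ≤ S := Finset.sum_nonneg fun i _ => Nat.cast_nonneg _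
    have hT : ∑ i, (μ i : ℚ) ≤ 1 + S := by
      rw [hSdef]
      simp only [Pi.add_apply, Nat.cast_add, Finset.sum_add_distrib]
      have : 0 ≤ ∑ i, (ν₀ i : ℚ) := Finset.sum_nonneg fun i _ => Nat.cast_nonneg _
      linarith
    have hP : 1 ≤ (1 + S) ^ (D + 1) := one_le_pow₀ (by linarith)
    have u1 : (∑ i, (μ i : ℚ)) * (K * (1 + S) ^ D) ≤ (1 + S) * (K * (1 + S) ^ D) := by gcongr
    have u2 : |h ν₀| ≤ |h ν₀| * (1 + S) ^ (D + 1) := le_mul_of_one_le_right (abs_nonneg _) hP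
    have u3 : (1 + S) * (K * (1 + S) ^ D) = K * (1 + S) ^ (D + 1) := by ring
    linarith

end IsDeg

/-- The iterated difference of `h` with steps `t e_j`, `j` running through the list. -/
def iterDiff {q : ℕ} (t : ℕ) : List (Fin q) → ((Fin q → ℕ) → ℚ) → (Fin q → ℕ) → ℚ
  | [], h => h
  | j :: l, h => iterDiff t l fun ν => h (ν + Pi.single j t) - h ν

section IterDiff

variable {q : ℕ} {D : ℕ} {g h : (Fin q → ℕ) → ℚ}

theorem iterDiff_sum (t : ℕ) (l : List (Fin q)) {ι : Type*} (s : Finset ι)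
    (c : ι → (Fin q → ℕ)) (h : (Fin q → ℕ) → ℚ) (ν : Fin q → ℕ) :
    iterDiff t l (fun ν => ∑ i ∈ s, h (ν + c i)) ν = ∑ i ∈ s, iterDiff t l h (ν + c i) := by
  induction l generalizing h with
  | nil => rfl
  | cons j l ih =>
    simp only [iterDiff]
    rw [← ih]
    congr 1
    funext μ
    rw [← Finset.sum_sub_distrib]
    exact Finset.sum_congr rfl fun i _ => by rw [add_right_comm]

/-- A difference with step `t e_j` is a sum of `t` shifted unit differences, and unit differences of
top order are eventually a constant `a`. The point is that neither `a` nor the threshold depends on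
`t`, so that `t` can tend to infinity at a fixed `ν`. -/
theorem iterDiff_eq_pow_mul (l : List (Fin q)) (hh : IsDeg (l.length + 1) h) :
    ∃ ν₀, ∃ a, ∀ ν, ν₀ ≤ ν → ∀ t : ℕ, iterDiff t l h ν = (t : ℚ) ^ l.length * a := by
  induction l generalizing h with
  | nil =>
    obtain ⟨ν₀, h0⟩ := IsDeg.eventually_const hh
    exact ⟨ν₀, h ν₀, fun ν hν t => by simp [iterDiff, h0 ν hν]⟩
  | cons j l ih =>
    obtain ⟨ν₀, a, h0⟩ := ih (hh j)
    refine ⟨ν₀, a, fun ν hν t => ?_⟩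
    have e : (fun ν => h (ν + Pi.single j t) - h ν) = fun ν => ∑ i ∈ Finset.range t,
        (fun ν => h (ν + Pi.single j 1) - h ν) (ν + Pi.single j i) := by
      funext μ
      induction t with
      | zero => simp
      | succ t iht =>
        rw [Finset.sum_range_succ, ← iht]
        dsimp only
        rw [add_assoc μ, ← Pi.single_add]
        ring
    rw [iterDiff, e]
    refine (iterDiff_sum t l _ (fun i => Pi.single j i)
      (fun ν => h (ν + Pi.single j 1) - h ν) ν).trans ?_
    rw [Finset.sum_congr rfl fun i _ => h0 _ (le_trans hν (le_add_of_nonneg_right zero_le)) t]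
    simp only [Finset.sum_const, Finset.card_range, nsmul_eq_mul, List.length_cons, pow_succ]
    ring

/-- The slack `m` makes the induction run: each difference doubles the constant and adds `t` to `m`.
-/
theorem abs_iterDiff_le {C : ℚ} {ν₀ : Fin q → ℕ} (t : ℕ) (l : List (Fin q)) (m : ℚ)
    (hC : 0 ≤ C) (hm : 0 ≤ m)
    (hb : ∀ ν, ν₀ ≤ ν → |h ν| ≤ C * (1 + m + ∑ j, (ν j : ℚ)) ^ D) (ν : Fin q → ℕ) (hν : ν₀ ≤ ν) :
    |iterDiff t l h ν| ≤
      2 ^ l.length * C * (1 + (m + l.length * t) + ∑ j, (ν j : ℚ)) ^ D := by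
  induction l generalizing h C m with
  | nil => simpa [iterDiff] using hb ν hν
  | cons j l ih =>
    rw [iterDiff]
    refine (ih (C := 2 * C) (m + t) (by positivity) (by positivity) fun μ hμ => ?_).trans
      (le_of_eq ?_)
    · have h1 := hb μ hμ
      have h2 := hb (μ + Pi.single j t) (le_trans hμ (le_add_of_nonneg_right zero_le))
      have hS : ∑ i, (((μ + Pi.single j t : Fin q → ℕ) i : ℕ) : ℚ) = ∑ i, (μ i : ℚ) + t := by
        simp only [Pi.add_apply, Nat.cast_add, Finset.sum_add_distrib]
        congr 1
        rw [Finset.sum_eq_single j] <;> simp +contextual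
      rw [hS] at h2
      have hS0 : 0 ≤ ∑ i, (μ i : ℚ) := Finset.sum_nonneg fun i _ => Nat.cast_nonneg _
      have ht : (0 : ℚ) ≤ t := Nat.cast_nonneg _
      have h3 : C * (1 + m + ∑ i, (μ i : ℚ)) ^ D ≤ C * (1 + (m + t) + ∑ i, (μ i : ℚ)) ^ D := by
        gcongr; linarith
      have h4 : 1 + m + (∑ i, (μ i : ℚ) + t) = 1 + (m + t) + ∑ i, (μ i : ℚ) := by ring
      rw [h4] at h2
      have h5 := abs_add_le (h (μ + Pi.single j t)) (-h μ)
      rw [abs_neg, ← sub_eq_add_neg] at h5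
      linarith
    · simp only [List.length_cons]
      push_cast
      ring

theorem isDeg_of_iterDiff (k : ℕ)
    (hh : ∀ l : List (Fin q), l.length = k → ∃ ν₀, ∀ ν, ν₀ ≤ ν → iterDiff 1 l h ν = 0) :
    IsDeg k h := by
  induction k generalizing h with
  | zero => exact hh [] rfl
  | succ k ih => exact fun j => ih fun l hl => hh (j :: l) (by simp [hl])

/-- An eventually polynomial function with values between zero and those of a polynomial function
of degree less than `D` has degree less than `D`. -/
theorem IsDeg.of_le {k : ℕ} (hh : IsDeg k h) (hg : IsDeg D g)
    (h0 : ∃ ν₀, ∀ ν, ν₀ ≤ ν → 0 ≤ h ν) (hle : ∃ ν₀, ∀ ν, ν₀ ≤ ν → h ν ≤ g ν) : IsDeg D h := by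
  obtain ⟨b₀, h0⟩ := h0
  obtain ⟨b₁, hle⟩ := hle
  cases D with
  | zero =>
    obtain ⟨b₂, hg⟩ := hg
    refine ⟨b₀ ⊔ (b₁ ⊔ b₂), fun ν hν => le_antisymm ?_ (h0 ν (le_trans le_sup_left hν))⟩
    have := hle ν (le_trans (le_trans le_sup_left le_sup_right) hν)
    rwa [hg ν (le_trans (le_trans le_sup_right le_sup_right) hν)] at this
  | succ D =>
    obtain ⟨C, hC, b₂, hg⟩ := hg.growth
    have hb : ∀ ν, b₀ ⊔ (b₁ ⊔ b₂) ≤ ν → |h ν| ≤ C * (1 + 0 + ∑ j, (ν j : ℚ)) ^ D := by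
      intro ν hν
      rw [add_zero, abs_of_nonneg (h0 ν (le_trans le_sup_left hν))]
      exact (hle ν (le_trans (le_trans le_sup_left le_sup_right) hν)).trans
        ((le_abs_self _).trans (hg ν (le_trans (le_trans le_sup_right le_sup_right) hν)))
    rcases le_total k (D + 1) with hk | hk
    · exact hh.mono hk
    -- A degree bound `k + 1` with `k ≥ D + 1` improves to `k`. The differences of order `k` with
    -- steps `t e_j` equal `t ^ k * a`, but the growth of `g` bounds them by a constant times `t ^
    -- D`; letting `t` grow forces `a = 0`.
    · induction k, hk using Nat.le_induction with
      | base => exact hh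
      | succ k hk ih =>
        apply ih
        refine isDeg_of_iterDiff k fun l hl => ?_
        subst hl
        obtain ⟨ν₁, a, ha⟩ := iterDiff_eq_pow_mul l hh
        refine ⟨ν₁, fun ν hν => ?_⟩
        rw [ha ν hν 1]
        suffices a = 0 by simp [this]
        set μ := b₀ ⊔ (b₁ ⊔ b₂) ⊔ ν₁
        set S := ∑ j, (μ j : ℚ)
        have hS0 : 0 ≤ S := Finset.sum_nonneg fun i _ => Nat.cast_nonneg _
        by_contra hne
        set E := 2 ^ l.length * C * (1 + l.length + S) ^ D with hE
        have hpos : 0 < |a| := abs_pos.mpr hne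
        obtain ⟨t, ht⟩ := exists_nat_gt (E / |a|)
        rw [div_lt_iff₀ hpos] at ht
        have hE0 : 0 ≤ E := by positivity
        have ht1 : (1 : ℚ) ≤ t := by
          have : (0 : ℚ) < t := by
            by_contra hcon
            nlinarith
          exact_mod_cast this
        have hb1 := abs_iterDiff_le t l 0 hC le_rfl hb μ le_sup_left
        rw [ha μ le_sup_right t, abs_mul, abs_of_nonneg (by positivity)] at hb1
        have hb2 : (1 + (0 + (l.length : ℚ) * t) + S) ^ D ≤ ((1 + l.length + S) * t) ^ D := by
          gcongr
          nlinarith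
        have hb3 : (t : ℚ) ^ l.length * |a| ≤ E * t ^ D := by
          refine hb1.trans ?_
          rw [hE, mul_assoc _ _ ((t : ℚ) ^ D), ← mul_pow]
          gcongr
        have hb4 : (t : ℚ) ^ (D + 1) ≤ t ^ l.length := pow_le_pow_right₀ ht1 hk
        have hb5 : (t : ℚ) ^ D * (t * |a|) ≤ t ^ D * E := by
          calc (t : ℚ) ^ D * (t * |a|) = t ^ (D + 1) * |a| := by ring
            _ ≤ t ^ l.length * |a| := by gcongr
            _ ≤ _ := by rw [mul_comm _ E]; exact hb3
        have := le_of_mul_le_mul_left hb5 (by positivity)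
        linarith

end IterDiff


/-! ### Lengths after a flat base change -/

section FlatLength

variable (A : Type*) [CommRing A] (O : Type*) [CommRing O] [Algebra A O]

/-- The length over `O` of `O ⊗_A Z`. -/
noncomputable def flatLength (Z : Type*) [AddCommGroup Z] [Module A Z] : ℕ∞ :=
  Module.length O (O ⊗[A] Z)

variable {A} {X Y Z : Type*} [AddCommGroup X] [Module A X] [AddCommGroup Y] [Module A Y]
  [AddCommGroup Z] [Module A Z]

theorem flatLength_congr (e : X ≃ₗ[A] Y) : flatLength A O X = flatLength A O Y :=
  (e.baseChange A O X Y).length_eq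

variable (A) in
theorem flatLength_eq_zero [Subsingleton X] : flatLength A O X = 0 := by
  unfold flatLength
  exact Module.length_eq_zero

theorem flatLength_le_of_surjective (g : X →ₗ[A] Y) (hg : Function.Surjective g) :
    flatLength A O Y ≤ flatLength A O X :=
  Module.length_le_of_surjective (g.baseChange O)
    (by rw [LinearMap.baseChange_eq_ltensor]; exact LinearMap.lTensor_surjective O hg)

variable [Module.Flat A O]

theorem flatLength_le_of_injective (g : X →ₗ[A] Y) (hg : Function.Injective g) :
    flatLength A O X ≤ flatLength A O Y :=
  Module.length_le_of_injective (g.baseChange O)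
    (by rw [LinearMap.baseChange_eq_ltensor]
        exact Module.Flat.lTensor_preserves_injective_linearMap g hg)

theorem flatLength_eq_add_of_exact (f : X →ₗ[A] Y) (g : Y →ₗ[A] Z) (hf : Function.Injective f)
    (hg : Function.Surjective g) (hfg : Function.Exact f g) :
    flatLength A O Y = flatLength A O X + flatLength A O Z := by
  refine Module.length_eq_add_of_exact (f.baseChange O) (g.baseChange O) ?_ ?_ ?_
  · rw [LinearMap.baseChange_eq_ltensor]
    exact Module.Flat.lTensor_preserves_injective_linearMap f hf
  · rw [LinearMap.baseChange_eq_ltensor]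
    exact LinearMap.lTensor_surjective O hg
  · rw [LinearMap.baseChange_eq_ltensor, LinearMap.baseChange_eq_ltensor]
    exact lTensor_exact O hfg hg

end FlatLength

section RelLength

variable {A : Type*} [CommRing A] (O : Type*) [CommRing O] [Algebra A O]
  {W : Type*} [AddCommGroup W] [Module A W]

/-- The length over `O` of `O ⊗_A P / (P ∩ Q)`. -/
noncomputable def relLength (P Q : Submodule A W) : ℕ∞ :=
  flatLength A O (P.map Q.mkQ)

variable {P Q : Submodule A W}

/-- First isomorphism theorem, in the form that serves below to identify relative lengths: it
suffices to exhibit a surjection from `P` with kernel `P ∩ Q`. -/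
theorem relLength_eq_of_surjective {Z : Type*} [AddCommGroup Z] [Module A Z] (g : P →ₗ[A] Z)
    (hg : Function.Surjective g) (hk : ∀ x, g x = 0 ↔ (x : W) ∈ Q) :
    relLength O P Q = flatLength A O Z := by
  have e : LinearMap.ker (Q.mkQ.submoduleMap P) = LinearMap.ker g := by
    ext x
    rw [LinearMap.mem_ker, LinearMap.mem_ker, hk, ← Subtype.coe_inj]
    simp
  exact flatLength_congr O (((Q.mkQ.submoduleMap P).quotKerEquivOfSurjective
    (LinearMap.submoduleMap_surjective _ _)).symm ≪≫ₗ Submodule.quotEquivOfEq _ _ e ≪≫ₗ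
    g.quotKerEquivOfSurjective hg)

theorem relLength_congr {Q' : Submodule A W} (h : ∀ x ∈ P, x ∈ Q ↔ x ∈ Q') :
    relLength O P Q = relLength O P Q' := by
  refine relLength_eq_of_surjective O (Q'.mkQ.submoduleMap P)
    (LinearMap.submoduleMap_surjective _ _) fun x => ?_
  rw [← Subtype.coe_inj, h x x.2]
  simp

theorem relLength_eq_zero (h : P ≤ Q) : relLength O P Q = 0 := by
  have : Subsingleton (P.map Q.mkQ) := by
    rw [Submodule.subsingleton_iff_eq_bot, eq_bot_iff, Submodule.map_le_iff_le_comap]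
    intro x hx
    simpa using h hx
  exact flatLength_eq_zero A O

theorem relLength_bot : relLength O P ⊥ = flatLength A O P :=
  relLength_eq_of_surjective O LinearMap.id Function.surjective_id (by simp)

theorem relLength_map {W' : Type*} [AddCommGroup W'] [Module A W'] (φ : W →ₗ[A] W')
    (P : Submodule A W) (Q : Submodule A W') :
    relLength O (P.map φ) Q = relLength O P (Q.comap φ) := by
  symm
  refine relLength_eq_of_surjective O (Q.mkQ.submoduleMap (P.map φ) ∘ₗ φ.submoduleMap P)
    ?_ fun x => ?_
  · rw [LinearMap.coe_comp]
    exact (LinearMap.submoduleMap_surjective _ _).comp (LinearMap.submoduleMap_surjective _ _)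
  · rw [← Subtype.coe_inj]
    simp

theorem relLength_anti_right {Q' : Submodule A W} (h : Q ≤ Q') :
    relLength O P Q' ≤ relLength O P Q := by
  have e : relLength O P Q' = flatLength A O ((P.map Q.mkQ).map (Submodule.factor h)) := by
    refine relLength_eq_of_surjective O ((Submodule.factor h).submoduleMap _ ∘ₗ
      Q.mkQ.submoduleMap P) ?_ fun x => ?_
    · rw [LinearMap.coe_comp]
      exact (LinearMap.submoduleMap_surjective _ _).comp (LinearMap.submoduleMap_surjective _ _)
    · rw [← Subtype.coe_inj]
      simp
  rw [e]
  exact flatLength_le_of_surjective O ((Submodule.factor h).submoduleMap _)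
    (LinearMap.submoduleMap_surjective _ _)

variable [Module.Flat A O]

theorem relLength_mono_left {P' : Submodule A W} (h : P ≤ P') :
    relLength O P Q ≤ relLength O P' Q :=
  flatLength_le_of_injective O (Submodule.inclusion (Submodule.map_mono h))
    (Submodule.inclusion_injective _)

/-- Additivity in `0 → R/(R ∩ Q) → P/(P ∩ Q) → P/(P ∩ (Q + R)) → 0`, which stays exact over the flat
algebra `O`. -/
theorem relLength_add {R : Submodule A W} (h : R ≤ P) :
    relLength O P Q = relLength O R Q + relLength O P (Q ⊔ R) := by
  have e : relLength O P (Q ⊔ R) =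
      flatLength A O ((P.map Q.mkQ).map (Submodule.factor (le_sup_left : Q ≤ Q ⊔ R))) := by
    refine relLength_eq_of_surjective O ((Submodule.factor (le_sup_left : Q ≤ Q ⊔ R)).submoduleMap
      _ ∘ₗ Q.mkQ.submoduleMap P) ?_ fun x => ?_
    · rw [LinearMap.coe_comp]
      exact (LinearMap.submoduleMap_surjective _ _).comp (LinearMap.submoduleMap_surjective _ _)
    · rw [← Subtype.coe_inj]
      simp
  rw [e]
  refine flatLength_eq_add_of_exact O (Submodule.inclusion (Submodule.map_mono h))
    ((Submodule.factor (le_sup_left : Q ≤ Q ⊔ R)).submoduleMap _)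
    (Submodule.inclusion_injective _) (LinearMap.submoduleMap_surjective _ _) ?_
  rintro ⟨y, hy⟩
  obtain ⟨x, hx, hxy⟩ := (Submodule.mem_map).mp hy
  have h1 : (Submodule.factor (le_sup_left : Q ≤ Q ⊔ R)) y = 0 ↔ x ∈ Q ⊔ R := by
    rw [← hxy]
    simp
  rw [← Subtype.coe_inj]
  refine h1.trans ⟨fun hx' => ?_, ?_⟩
  · obtain ⟨a, ha, b, hb, hab⟩ := Submodule.mem_sup.mp hx'
    refine ⟨⟨Q.mkQ b, Submodule.mem_map_of_mem hb⟩, Subtype.ext ?_⟩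
    change Q.mkQ b = y
    rw [← hxy, Submodule.mkQ_apply, Submodule.mkQ_apply, Submodule.Quotient.eq, ← hab]
    simpa using ha
  · rintro ⟨⟨z, hz⟩, e⟩
    obtain ⟨b, hb, hbz⟩ := (Submodule.mem_map).mp hz
    have e : z = y := congrArg Subtype.val e
    rw [← hbz, ← hxy, Submodule.mkQ_apply, Submodule.mkQ_apply, Submodule.Quotient.eq] at e
    have e' : x = -(b - x) + b := by abel
    rw [e']
    exact Submodule.add_mem_sup (neg_mem e) hb

theorem relLength_sup_left {Q' : Submodule A W} (h : Q' ≤ Q) :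
    relLength O (P ⊔ Q') Q = relLength O P Q := by
  rw [relLength_add O (le_sup_left : P ≤ P ⊔ Q'), relLength_eq_zero O (P := P ⊔ Q'), add_zero]
  exact sup_le le_sup_right (h.trans le_sup_left)

end RelLength


/-! ### Homogeneous components and the Hilbert–Serre theorem -/

namespace IsMultigraded

variable {q : ℕ} {n : Fin q → ℕ} {A : Type*} [CommRing A]
  {M : Type*} [AddCommGroup M] [Module A M] [Module (MultiPoly n A) M]
  {gr : (Fin q → ℕ) → Submodule A M}

/-- The projection to the component of multidegree `ν`. -/
noncomputable def proj (hgr : IsMultigraded n gr) (ν : Fin q → ℕ) : M →ₗ[A] M :=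
  (gr ν).subtype ∘ₗ DirectSum.component A _ (fun μ => gr μ) ν ∘ₗ
    (LinearEquiv.ofBijective (DirectSum.coeLinearMap gr) hgr.isInternal).symm.toLinearMap

variable (hgr : IsMultigraded n gr)

theorem proj_mem (ν : Fin q → ℕ) (m : M) : hgr.proj ν m ∈ gr ν :=
  Subtype.coe_prop _

theorem proj_apply_of_mem {μ : Fin q → ℕ} {m : M} (hm : m ∈ gr μ) (ν : Fin q → ℕ) :
    hgr.proj ν m = if ν = μ then m else 0 := by
  have e : (LinearEquiv.ofBijective (DirectSum.coeLinearMap gr) hgr.isInternal).symm m =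
      DirectSum.lof A _ (fun μ => gr μ) μ ⟨m, hm⟩ := by
    rw [LinearEquiv.symm_apply_eq]
    exact (DirectSum.coeLinearMap_lof (A := gr) μ ⟨m, hm⟩).symm
  unfold proj
  rw [LinearMap.comp_apply, LinearMap.comp_apply, LinearEquiv.coe_coe, e]
  split_ifs with h
  · subst h
    rw [DirectSum.component.lof_self]
    rfl
  · rw [DirectSum.component.of]
    simp [Ne.symm h]

theorem proj_of_mem {ν : Fin q → ℕ} {m : M} (hm : m ∈ gr ν) : hgr.proj ν m = m := by
  rw [hgr.proj_apply_of_mem hm, if_pos rfl]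

theorem proj_of_mem_ne {μ ν : Fin q → ℕ} {m : M} (hm : m ∈ gr μ) (h : ν ≠ μ) :
    hgr.proj ν m = 0 := by
  rw [hgr.proj_apply_of_mem hm, if_neg h]

theorem induction_on (hgr : IsMultigraded n gr) {P : M → Prop} (m : M)
    (hmem : ∀ ν, ∀ x ∈ gr ν, P x) (hzero : P 0)
    (hadd : ∀ x y, P x → P y → P (x + y)) : P m := by
  have hm : m ∈ ⨆ ν, gr ν := by
    rw [hgr.isInternal.submodule_iSup_eq_top]
    trivial
  exact Submodule.iSup_induction gr (motive := P) hm hmem hzero hadd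

theorem exists_sum_proj (m : M) :
    ∃ s : Finset (Fin q → ℕ), m = ∑ ν ∈ s, hgr.proj ν m ∧ ∀ ν ∉ s, hgr.proj ν m = 0 := by
  classical
  -- The claim is strengthened to all larger finite sets, so that sums can be treated on the union
  -- of two supports.
  suffices ∃ s : Finset (Fin q → ℕ), ∀ t, s ⊆ t →
      (m = ∑ ν ∈ t, hgr.proj ν m ∧ ∀ ν ∉ t, hgr.proj ν m = 0) by
    obtain ⟨s, hs⟩ := this
    exact ⟨s, hs s subset_rfl⟩
  induction m using hgr.induction_on with
  | hmem μ x hx =>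
    refine ⟨{μ}, fun t ht => ?_⟩
    simp only [hgr.proj_apply_of_mem hx]
    have hμ : μ ∈ t := ht (by simp)
    refine ⟨by simp [hμ], fun ν hν => ?_⟩
    rw [if_neg]
    rintro rfl
    exact hν hμ
  | hzero => exact ⟨∅, fun t _ => by simp⟩
  | hadd x y hx hy =>
    obtain ⟨s, hs⟩ := hx
    obtain ⟨t, ht⟩ := hy
    refine ⟨s ∪ t, fun u hu => ?_⟩
    obtain ⟨h1, h2⟩ := hs u (Finset.union_subset_left hu)
    obtain ⟨h3, h4⟩ := ht u (Finset.union_subset_right hu)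
    refine ⟨?_, fun ν hν => by rw [map_add, h2 ν hν, h4 ν hν, add_zero]⟩
    simp only [map_add, Finset.sum_add_distrib]
    rw [← h1, ← h3]

theorem proj_smul_add {f : MultiPoly n A} {d : Fin q → ℕ} (hf : IsMultihomogeneous f d)
    (ν : Fin q → ℕ) (m : M) : hgr.proj (ν + d) (f • m) = f • hgr.proj ν m := by
  induction m using hgr.induction_on with
  | hmem μ x hx =>
    rw [hgr.proj_apply_of_mem hx, hgr.proj_apply_of_mem (hgr.smul_mem _ _ _ _ hf hx), add_comm ν]
    by_cases h : ν = μ <;> simp [h]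
  | hzero => simp
  | hadd x y hx hy => simp [smul_add, hx, hy]

theorem proj_smul_of_not_le {f : MultiPoly n A} {d : Fin q → ℕ} (hf : IsMultihomogeneous f d)
    {ν : Fin q → ℕ} (hν : ¬ d ≤ ν) (m : M) : hgr.proj ν (f • m) = 0 := by
  induction m using hgr.induction_on with
  | hmem μ x hx =>
    refine hgr.proj_of_mem_ne (hgr.smul_mem _ _ _ _ hf hx) ?_
    rintro rfl
    exact hν (le_add_of_nonneg_right zero_le)
  | hzero => simp
  | hadd x y hx hy => simp [smul_add, hx, hy]

/-- Multihomogeneous submodules. -/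
def IsHomog (X : Submodule (MultiPoly n A) M) : Prop :=
  ∀ m ∈ X, ∀ ν, hgr.proj ν m ∈ X

theorem proj_smul_mem {X : Submodule (MultiPoly n A) M} {f : MultiPoly n A} {d : Fin q → ℕ}
    (hf : IsMultihomogeneous f d) {m : M} (hm : ∀ ν, f • hgr.proj ν m ∈ X) (ν : Fin q → ℕ) :
    hgr.proj ν (f • m) ∈ X := by
  by_cases h : d ≤ ν
  · obtain ⟨μ, rfl⟩ := exists_add_of_le h
    rw [add_comm, hgr.proj_smul_add hf]
    exact hm μ
  · rw [hgr.proj_smul_of_not_le hf h]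
    exact zero_mem X

theorem isHomog_top : hgr.IsHomog ⊤ := fun _ _ _ => trivial

theorem IsHomog.sup {X Y : Submodule (MultiPoly n A) M} (hX : hgr.IsHomog X)
    (hY : hgr.IsHomog Y) : hgr.IsHomog (X ⊔ Y) := by
  intro m hm ν
  obtain ⟨x, hx, y, hy, rfl⟩ := Submodule.mem_sup.mp hm
  rw [map_add]
  exact Submodule.add_mem_sup (hX x hx ν) (hY y hy ν)

theorem IsHomog.inf {X Y : Submodule (MultiPoly n A) M} (hX : hgr.IsHomog X)
    (hY : hgr.IsHomog Y) : hgr.IsHomog (X ⊓ Y) :=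
  fun m hm ν => ⟨hX m hm.1 ν, hY m hm.2 ν⟩

theorem IsHomog.map_lsmul {X : Submodule (MultiPoly n A) M} (hX : hgr.IsHomog X)
    {f : MultiPoly n A} {d : Fin q → ℕ} (hf : IsMultihomogeneous f d) :
    hgr.IsHomog (X.map (LinearMap.lsmul (MultiPoly n A) M f)) := by
  rintro _ ⟨m, hm, rfl⟩ ν
  exact hgr.proj_smul_mem (X := X.map (LinearMap.lsmul (MultiPoly n A) M f)) hf
    (fun μ => ⟨_, hX m hm μ, rfl⟩) ν

theorem IsHomog.comap_lsmul {X : Submodule (MultiPoly n A) M} (hX : hgr.IsHomog X)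
    {f : MultiPoly n A} {d : Fin q → ℕ} (hf : IsMultihomogeneous f d) :
    hgr.IsHomog (X.comap (LinearMap.lsmul (MultiPoly n A) M f)) := by
  intro m hm ν
  change f • hgr.proj ν m ∈ X
  rw [← hgr.proj_smul_add hf]
  exact hX _ hm _

theorem isHomog_span_smul_top {S : Set (MultiPoly n A)}
    (hS : ∀ f ∈ S, ∃ d, IsMultihomogeneous f d) :
    hgr.IsHomog (Ideal.span S • ⊤ : Submodule (MultiPoly n A) M) := by
  intro m hm ν
  induction hm using Submodule.smul_induction_on' with
  | add x _ y _ hx hy => rw [map_add]; exact add_mem hx hy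
  | smul r hr m _ =>
    induction hr using Submodule.span_induction generalizing m ν with
    | mem f hf =>
      obtain ⟨d, hd⟩ := hS f hf
      exact hgr.proj_smul_mem hd
        (fun μ => Submodule.smul_mem_smul (Ideal.subset_span hf) Submodule.mem_top) ν
    | zero => simp
    | add x y _ _ hx hy => rw [add_smul, map_add]; exact add_mem (hx ν m trivial) (hy ν m trivial)
    | smul a x _ hx =>
      rw [smul_eq_mul, mul_comm, mul_smul]
      exact hx ν (a • m) trivial

/-- Modulo `Y`, the variables of the `j`-th group kill `X`, so multiplication never raises the
`j`-th degree of a nonzero class; `b` bounds the `j`-th degrees of finitely many generators of `X`.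
-/
theorem exists_proj_mem_of_variables_mem [IsNoetherian (MultiPoly n A) M]
    {X Y : Submodule (MultiPoly n A) M} (hX : hgr.IsHomog X) (j : Fin q)
    (hj : ∀ v : MultiVar n, v.1 = j → ∀ m ∈ X, (MvPolynomial.X v : MultiPoly n A) • m ∈ Y) :
    ∃ b : ℕ, ∀ m ∈ X, ∀ ν : Fin q → ℕ, b < ν j → hgr.proj ν m ∈ Y := by
  classical
  have key : ∀ (p : MultiPoly n A) (b : ℕ) (m : M), m ∈ X →
      (∀ ν : Fin q → ℕ, b < ν j → hgr.proj ν m ∈ Y) →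
      ∀ ν : Fin q → ℕ, b < ν j → hgr.proj ν (p • m) ∈ Y := by
    intro p b m hmX hm
    induction p using MvPolynomial.induction_on generalizing m with
    | C a =>
      intro ν hν
      have h0 : IsMultihomogeneous (MvPolynomial.C a : MultiPoly n A) 0 :=
        MvPolynomial.isWeightedHomogeneous_C _ _
      have := hgr.proj_smul_add h0 ν m
      rw [add_zero] at this
      rw [this]
      exact Y.smul_mem _ (hm ν hν)
    | add p p' hp hp' =>
      intro ν hν
      rw [add_smul, map_add]
      exact add_mem (hp m hmX hm ν hν) (hp' m hmX hm ν hν)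
    | mul_X p v hp =>
      rw [mul_smul]
      refine hp _ (X.smul_mem _ hmX) fun ν hν => ?_
      have hv : IsMultihomogeneous (MvPolynomial.X v : MultiPoly n A) (Pi.single v.1 1) :=
        MvPolynomial.isWeightedHomogeneous_X _ _ _
      by_cases hle : Pi.single v.1 1 ≤ ν
      · obtain ⟨μ, rfl⟩ := exists_add_of_le hle
        rw [add_comm, hgr.proj_smul_add hv]
        by_cases hvj : v.1 = j
        · exact hj v hvj _ (hX m hmX μ)
        · refine Y.smul_mem _ (hm μ ?_)
          simpa [Pi.single_apply, Ne.symm hvj] using hν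
      · rw [hgr.proj_smul_of_not_le hv hle]
        exact zero_mem Y
  obtain ⟨G, hG⟩ := IsNoetherian.noetherian X
  have hb : ∀ g : M, ∃ b : ℕ, ∀ ν : Fin q → ℕ, b < ν j → hgr.proj ν g = 0 := by
    intro g
    obtain ⟨s, -, hs⟩ := hgr.exists_sum_proj g
    refine ⟨s.sup fun ν => ν j, fun ν hν => hs ν fun hmem => ?_⟩
    exact absurd (Finset.le_sup (f := fun ν : Fin q → ℕ => ν j) hmem) (not_le.mpr hν)
  choose b hb using hb
  refine ⟨G.sup b, fun m hm => ?_⟩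
  rw [← hG] at hm
  induction hm using Submodule.span_induction with
  | mem x hx =>
    intro ν hν
    rw [hb x ν (lt_of_le_of_lt (Finset.le_sup hx) hν)]
    exact zero_mem Y
  | zero => simp
  | add x y _ _ hx hy =>
    intro ν hν
    rw [map_add]
    exact add_mem (hx ν hν) (hy ν hν)
  | smul a x hx ih => exact key a _ x (hG ▸ hx) ih

end IsMultigraded

section GradedLength

variable {q : ℕ} {n : Fin q → ℕ} {A : Type*} [CommRing A]
  {M : Type*} [AddCommGroup M] [Module A M] [Module (MultiPoly n A) M]
  [IsScalarTower A (MultiPoly n A) M]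
  (gr : (Fin q → ℕ) → Submodule A M)

/-- The component of multidegree `ν` of a multihomogeneous submodule. -/
noncomputable def gradedPiece (X : Submodule (MultiPoly n A) M) (ν : Fin q → ℕ) : Submodule A M :=
  gr ν ⊓ X.restrictScalars A

/-- The length over `O` of the component of multidegree `ν` of `O ⊗_A (X / (X ∩ Y))`. -/
noncomputable def gradedLength (O : Type*) [CommRing O] [Algebra A O]
    (X Y : Submodule (MultiPoly n A) M) (ν : Fin q → ℕ) : ℕ∞ :=
  relLength O (gradedPiece gr X ν) (Y.restrictScalars A)

/-- Multiplication by a polynomial as an `A`-linear map. -/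
noncomputable def smulMap (M : Type*) [AddCommGroup M] [Module A M] [Module (MultiPoly n A) M]
    [IsScalarTower A (MultiPoly n A) M] (f : MultiPoly n A) : M →ₗ[A] M :=
  (LinearMap.lsmul (MultiPoly n A) M f).restrictScalars A

@[simp] theorem smulMap_apply (f : MultiPoly n A) (m : M) : smulMap M f m = f • m := rfl

variable {gr} (O : Type*) [CommRing O] [Algebra A O]

/-- The multiplication by a multihomogeneous polynomial and its cokernel. -/
theorem gradedLength_add_degree [Module.Flat A O] (hgr : IsMultigraded n gr)
    {X Y : Submodule (MultiPoly n A) M} (hX : hgr.IsHomog X)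
    (hY : hgr.IsHomog Y) {f : MultiPoly n A} {d : Fin q → ℕ} (hf : IsMultihomogeneous f d)
    (ν : Fin q → ℕ) :
    gradedLength gr O X Y (ν + d) =
      gradedLength gr O X (Y.comap (LinearMap.lsmul (MultiPoly n A) M f)) ν +
      gradedLength gr O X (Y ⊔ X.map (LinearMap.lsmul (MultiPoly n A) M f)) (ν + d) := by
  have hle : (gradedPiece gr X ν).map (smulMap M f) ≤ gradedPiece gr X (ν + d) := by
    rintro _ ⟨m, hm, rfl⟩
    refine ⟨?_, X.smul_mem f hm.2⟩
    rw [add_comm]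
    exact hgr.smul_mem _ _ _ _ hf hm.1
  unfold gradedLength
  rw [relLength_add O hle, relLength_map]
  congr 1
  refine relLength_congr O fun x hx => ⟨fun h => ?_, fun h => ?_⟩
  · obtain ⟨y, hy, _, ⟨m, hm, rfl⟩, rfl⟩ := Submodule.mem_sup.mp h
    exact Submodule.add_mem_sup hy ⟨m, hm.2, rfl⟩
  · obtain ⟨y, hy, _, ⟨m, hm, rfl⟩, hx'⟩ := Submodule.mem_sup.mp
      (show x ∈ Y ⊔ X.map (LinearMap.lsmul (MultiPoly n A) M f) from h)
    have e : x = hgr.proj (ν + d) y + f • hgr.proj ν m := by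
      rw [← hgr.proj_smul_add hf, ← hgr.proj_of_mem hx.1, ← hx', map_add]
      rfl
    rw [e]
    exact Submodule.add_mem_sup (hY y hy _) ⟨_, ⟨hgr.proj_mem _ _, hX m hm _⟩, rfl⟩

/-- The kernel of the multiplication by a polynomial. -/
theorem gradedLength_eq_add_comap [Module.Flat A O] {X Y : Submodule (MultiPoly n A) M}
    {f : MultiPoly n A} (ν : Fin q → ℕ) :
    gradedLength gr O X Y ν =
      gradedLength gr O (X ⊓ Y.comap (LinearMap.lsmul (MultiPoly n A) M f)) Y ν +
      gradedLength gr O X (Y.comap (LinearMap.lsmul (MultiPoly n A) M f)) ν := by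
  unfold gradedLength
  have hle : gradedPiece gr (X ⊓ Y.comap (LinearMap.lsmul (MultiPoly n A) M f)) ν ≤
      gradedPiece gr X ν := fun x hx => ⟨hx.1, hx.2.1⟩
  rw [relLength_add O hle]
  congr 1
  refine relLength_congr O fun x hx => ⟨fun h => ?_, fun h => ?_⟩
  · obtain ⟨y, hy, m, hm, rfl⟩ := Submodule.mem_sup.mp h
    change f • (y + m) ∈ Y
    rw [smul_add]
    exact add_mem (Y.smul_mem f hy) hm.2.2
  · exact Submodule.mem_sup_right ⟨hx.1, hx.2, h⟩

theorem gradedLength_mono_left [Module.Flat A O] {X X' Y : Submodule (MultiPoly n A) M} (h : X ≤ X')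
    (ν : Fin q → ℕ) : gradedLength gr O X Y ν ≤ gradedLength gr O X' Y ν :=
  relLength_mono_left O fun _ hx => ⟨hx.1, h hx.2⟩

theorem gradedLength_anti_right {X Y Y' : Submodule (MultiPoly n A) M} (h : Y ≤ Y')
    (ν : Fin q → ℕ) : gradedLength gr O X Y' ν ≤ gradedLength gr O X Y ν :=
  relLength_anti_right O fun _ hx => h hx

/-- The Hilbert–Serre theorem: the lengths of the components of a finitely generated multigraded
module are eventually polynomial. -/
theorem exists_isDeg_gradedLength [Module.Flat A O] [IsNoetherian (MultiPoly n A) M]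
    (hgr : IsMultigraded n gr)
    {X Y : Submodule (MultiPoly n A) M} (hX : hgr.IsHomog X) (hY : hgr.IsHomog Y)
    (hfin : ∃ ν₀, ∀ ν, ν₀ ≤ ν → gradedLength gr O X Y ν ≠ ⊤) :
    ∃ D, IsDeg D fun ν => ((gradedLength gr O X Y ν).toNat : ℚ) := by
  classical
  -- Induction on the set `S` of variables that may act nontrivially on `X/(X ∩ Y)`. Working with
  -- pairs of submodules of the fixed module `M` keeps kernels and cokernels of multiplications in
  -- the same form.
  suffices H : ∀ (S : Finset (MultiVar n)) (X Y : Submodule (MultiPoly n A) M),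
      hgr.IsHomog X → hgr.IsHomog Y →
      (∀ v ∉ S, ∀ m ∈ X, (MvPolynomial.X v : MultiPoly n A) • m ∈ Y) →
      (∃ ν₀, ∀ ν, ν₀ ≤ ν → gradedLength gr O X Y ν ≠ ⊤) →
      ∃ D, IsDeg D fun ν => ((gradedLength gr O X Y ν).toNat : ℚ) from
    H Finset.univ X Y hX hY (by simp) hfin
  clear hX hY hfin X Y
  intro S
  induction S using Finset.strongInduction with
  | H S ih =>
  intro X Y hX hY hS hfin
  -- If no variable of some group `j` is left, the components with large `ν_j` vanish. Otherwise
  -- pick one variable in each group: its kernel `K j` and cokernel `C j` are covered by the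
  -- induction, and the difference of lengths in direction `j` is that of `C j` at `ν + e_j` minus
  -- that of `K j` at `ν`.
  by_cases hj : ∃ j, ∀ v ∈ S, v.1 ≠ j
  · obtain ⟨j, hj⟩ := hj
    obtain ⟨b, hb⟩ := hgr.exists_proj_mem_of_variables_mem (Y := Y) hX j
      fun v hv m hm => hS v (fun hvS => hj v hvS hv) m hm
    refine ⟨0, Pi.single j (b + 1), fun ν hν => ?_⟩
    have hbν : b < ν j := by
      have := hν j
      simp only [Pi.single_eq_same] at this
      omega
    have : gradedLength gr O X Y ν = 0 := relLength_eq_zero O fun x hx => by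
      have := hb x hx.2 ν hbν
      rwa [hgr.proj_of_mem hx.1] at this
    simp [this]
  · push Not at hj
    choose v hvS hvj using hj
    have hv : ∀ j, IsMultihomogeneous (MvPolynomial.X (v j) : MultiPoly n A) (Pi.single j 1) := by
      intro j
      have := MvPolynomial.isWeightedHomogeneous_X A (multiWeight n) (v j)
      rwa [multiWeight, hvj j] at this
    obtain ⟨ν₀, hfin⟩ := hfin
    set K := fun j => X ⊓ Y.comap (LinearMap.lsmul (MultiPoly n A) M (MvPolynomial.X (v j)))
    set C := fun j => Y ⊔ X.map (LinearMap.lsmul (MultiPoly n A) M (MvPolynomial.X (v j)))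
    have hKfin : ∀ j ν, ν₀ ≤ ν → gradedLength gr O (K j) Y ν ≠ ⊤ := fun j ν hν =>
      ne_top_of_le_ne_top (hfin ν hν) (gradedLength_mono_left O inf_le_left ν)
    have hCfin : ∀ j ν, ν₀ ≤ ν → gradedLength gr O X (C j) ν ≠ ⊤ := fun j ν hν =>
      ne_top_of_le_ne_top (hfin ν hν) (gradedLength_anti_right O le_sup_left ν)
    have hK : ∀ j, ∃ D, IsDeg D fun ν => ((gradedLength gr O (K j) Y ν).toNat : ℚ) := by
      intro j
      refine ih _ (Finset.erase_ssubset (hvS j)) _ _ (hX.inf hgr (hY.comap_lsmul hgr (hv j))) hY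
        (fun w hw m hm => ?_) ⟨ν₀, hKfin j⟩
      by_cases hwS : w ∈ S
      · have : w = v j := by simpa [hwS] using hw
        rw [this]
        exact hm.2
      · exact hS w hwS m hm.1
    have hC : ∀ j, ∃ D, IsDeg D fun ν => ((gradedLength gr O X (C j) ν).toNat : ℚ) := by
      intro j
      refine ih _ (Finset.erase_ssubset (hvS j)) _ _ hX (hY.sup hgr (hX.map_lsmul hgr (hv j)))
        (fun w hw m hm => ?_) ⟨ν₀, hCfin j⟩
      by_cases hwS : w ∈ S
      · have : w = v j := by simpa [hwS] using hw
        rw [this]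
        exact Submodule.mem_sup_right ⟨m, hm, rfl⟩
      · exact Submodule.mem_sup_left (hS w hwS m hm)
    choose a ha using hK
    choose b hb using hC
    refine ⟨Finset.univ.sup (fun j => a j ⊔ b j) + 1, fun j => ?_⟩
    have hle : a j ⊔ b j ≤ Finset.univ.sup (fun j => a j ⊔ b j) :=
      Finset.le_sup (f := fun j => a j ⊔ b j) (Finset.mem_univ j)
    refine ((((hb j).mono (le_sup_right.trans hle)).shift (Pi.single j 1)).sub
      ((ha j).mono (le_sup_left.trans hle))).congr ⟨ν₀, fun ν hν => ?_⟩
    have hν' : ν₀ ≤ ν + Pi.single j 1 := le_trans hν (le_add_of_nonneg_right zero_le)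
    have h1 := gradedLength_add_degree O hgr hX hY (hv j) ν
    have h2 := gradedLength_eq_add_comap (gr := gr) O (X := X) (Y := Y)
      (f := MvPolynomial.X (v j)) ν
    have t1 := hfin ν hν
    have t2 := hfin _ hν'
    have t3 := hKfin j ν hν
    have t4 := hCfin j _ hν'
    have t5 : gradedLength gr O X
        (Y.comap (LinearMap.lsmul (MultiPoly n A) M (MvPolynomial.X (v j)))) ν ≠ ⊤ := by
      intro h
      rw [h] at h2
      exact t1 (by simp [h2])
    have h3 := congrArg ENat.toNat h1
    have h4 := congrArg ENat.toNat h2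
    rw [ENat.toNat_add t5 t4] at h3
    rw [ENat.toNat_add t3 t5] at h4
    dsimp only
    rw [h3, h4]
    push_cast
    ring

end GradedLength


/-! ### Lengths over discrete valuation rings -/

section Length

theorem LinearMap.injective_of_det_ne_zero {O : Type*} [CommRing O] [IsDomain O] {T : Type*}
    [AddCommGroup T] [Module O T] [Module.Free O T] [Module.Finite O T] {e : T →ₗ[O] T}
    (he : LinearMap.det e ≠ 0) : Function.Injective e := by
  classical
  set b := Module.Free.chooseBasis O T
  rw [← LinearMap.ker_eq_bot, LinearMap.ker_eq_bot']
  intro x hx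
  rw [← LinearMap.det_toMatrix b] at he
  apply b.repr.injective
  rw [map_zero, ← DFunLike.coe_injective.eq_iff]
  apply Matrix.mulVec_injective_of_det_ne_zero he
  rw [LinearMap.toMatrix_mulVec_repr, hx]
  simp

/-- The length of the cokernel of an injective endomorphism is the order of its determinant. -/
theorem length_quotient_range_eq_ord_det {O : Type*} [CommRing O] [IsDomain O]
    [IsPrincipalIdealRing O] {T : Type*} [AddCommGroup T] [Module O T] [Module.Free O T]
    [Module.Finite O T] (e : T →ₗ[O] T) (he : LinearMap.det e ≠ 0) :
    Module.length O (T ⧸ LinearMap.range e) = Ring.ord O (LinearMap.det e) := by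
  classical
  set b := Module.Free.chooseBasis O T
  have hinj : Function.Injective e := LinearMap.injective_of_det_ne_zero he
  set e' := LinearEquiv.ofInjective e hinj
  have hr : Module.finrank O (LinearMap.range e) = Module.finrank O T :=
    e'.finrank_eq.symm
  -- Smith normal form of the range: the cokernel is the sum of the `O/(a_i)`. The determinant is
  -- associated to `∏ a_i` because `e` is an isomorphism onto its range followed by the inclusion.
  set b' := Submodule.smithNormalFormTopBasis b hr
  set c := Submodule.smithNormalFormBotBasis b hr
  set a := Submodule.smithNormalFormCoeffs b hr
  have hc : ∀ i, (c i : T) = a i • b' i := Submodule.smithNormalFormBotBasis_def b hr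
  have h1 : Associated (LinearMap.det e) (∏ i, a i) := by
    have h2 : e = (LinearMap.range e).subtype ∘ₗ e'.toLinearMap := by
      ext x
      rfl
    have h3 : LinearMap.det ((LinearMap.range e).subtype ∘ₗ
        (b'.equiv c (Equiv.refl _)).toLinearMap) = ∏ i, a i := by
      rw [← LinearMap.det_toMatrix b', ← Matrix.det_diagonal]
      congr 1
      ext i j
      rw [LinearMap.toMatrix_apply]
      simp only [LinearMap.coe_comp, Function.comp_apply, LinearEquiv.coe_coe,
        Module.Basis.equiv_apply, Equiv.refl_apply, Submodule.subtype_apply, hc, map_smul,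
        Module.Basis.repr_self, Finsupp.smul_apply, Finsupp.single_apply, Matrix.diagonal_apply,
        smul_eq_mul]
      by_cases h : i = j
      · subst h; simp
      · simp [h, Ne.symm h]
    rw [← h3]
    conv_lhs => rw [h2]
    exact LinearMap.associated_det_comp_equiv _ _ _
  rw [Ring.ord_eq_of_associated h1, (Submodule.quotientEquivPiSpan _ b hr).length_eq,
    Module.length_pi_of_fintype]
  have hne : ∀ i, a i ≠ 0 := fun i =>
    Submodule.smithNormalFormCoeffs_ne_zero b hr i
  have : ∀ s : Finset (Module.Free.ChooseBasisIndex O T),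
      ∑ i ∈ s, Ring.ord O (a i) = Ring.ord O (∏ i ∈ s, a i) := by
    intro s
    induction s using Finset.induction_on with
    | empty => simp
    | insert i s hi ih =>
      rw [Finset.sum_insert hi, Finset.prod_insert hi, ih, Ring.ord_mul]
      exact mem_nonZeroDivisors_of_ne_zero (Finset.prod_ne_zero_iff.mpr fun i _ => hne i)
  exact this Finset.univ

variable {A : Type*} [CommRing A] (O : Type*) [CommRing O] [Algebra A O]

theorem flatLength_quotient_range {X Y : Type*} [AddCommGroup X] [Module A X] [AddCommGroup Y]
    [Module A Y] (f : X →ₗ[A] Y) :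
    flatLength A O (Y ⧸ LinearMap.range f) =
      Module.length O ((O ⊗[A] Y) ⧸ LinearMap.range (f.baseChange O)) := by
  have hex : Function.Exact (f.baseChange O) ((LinearMap.range f).mkQ.baseChange O) := by
    rw [LinearMap.baseChange_eq_ltensor, LinearMap.baseChange_eq_ltensor]
    exact lTensor_exact O (LinearMap.exact_map_mkQ_range f) (Submodule.mkQ_surjective _)
  have hs : Function.Surjective ((LinearMap.range f).mkQ.baseChange O) := by
    rw [LinearMap.baseChange_eq_ltensor]
    exact LinearMap.lTensor_surjective O (Submodule.mkQ_surjective _)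
  exact ((Submodule.quotEquivOfEq _ _ hex.linearMap_ker_eq.symm).trans
    (LinearMap.quotKerEquivOfSurjective _ hs)).symm.length_eq

theorem flatLength_quotient_range_eq_ord_det [IsDomain O] [IsPrincipalIdealRing O] {T : Type*}
    [AddCommGroup T] [Module A T] [Module.Free A T] [Module.Finite A T] (e : T →ₗ[A] T)
    (he : algebraMap A O (LinearMap.det e) ≠ 0) :
    flatLength A O (T ⧸ LinearMap.range e) = Ring.ord O (algebraMap A O (LinearMap.det e)) := by
  rw [flatLength_quotient_range, length_quotient_range_eq_ord_det, LinearMap.det_baseChange]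
  rwa [LinearMap.det_baseChange]

/-- A finitely generated torsion module has finite length over a localization which is a discrete
valuation ring. -/
theorem flatLength_ne_top_of_torsion [IsDomain O] [IsDiscreteValuationRing O] {T : Type*}
    [AddCommGroup T] [Module A T] [Module.Finite A T] (a : A) (ha : algebraMap A O a ≠ 0)
    (h : ∀ x : T, a • x = 0) : flatLength A O T ≠ ⊤ := by
  obtain ⟨k, g, hg⟩ := Module.Finite.exists_fin' A T
  -- `T` is a quotient of `(A/a)^k`, whose length over `O` is the order of `a ^ k`.
  have hle : LinearMap.range (LinearMap.lsmul A (Fin k → A) a) ≤ LinearMap.ker g := by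
    rintro _ ⟨x, rfl⟩
    simp [h]
  refine ne_top_of_le_ne_top ?_ (flatLength_le_of_surjective O (Submodule.liftQ _ g hle)
    (by rw [← LinearMap.range_eq_top, Submodule.range_liftQ]; exact LinearMap.range_eq_top.mpr hg))
  have hdet : algebraMap A O (LinearMap.det (LinearMap.lsmul A (Fin k → A) a)) =
      algebraMap A O a ^ k := by
    have : LinearMap.lsmul A (Fin k → A) a = a • LinearMap.id := by ext; simp
    have : Nontrivial A := ⟨a, 0, fun h => ha (by rw [h, map_zero])⟩
    rw [‹LinearMap.lsmul A (Fin k → A) a = _›, LinearMap.det_smul]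
    simp
  rw [flatLength_quotient_range_eq_ord_det _ _ (by rw [hdet]; exact pow_ne_zero _ ha)]
  refine Ring.ord_ne_top ?_
  rw [hdet]
  exact mem_nonZeroDivisors_of_ne_zero (pow_ne_zero _ ha)

variable {O}

/-- Up to a unit an element of the localization `O` comes from some `a` in `A`, and multiplication
by `a` stays injective on `O ⊗ F` by flatness. -/
theorem isTorsionFree_baseChange [IsDomain O] [Module.Flat A O] (S : Submonoid A)
    [IsLocalization S O] {F : Type*} [AddCommGroup F] [Module A F]
    (hF : ∀ a : A, algebraMap A O a ≠ 0 → ∀ x : F, a • x = 0 → x = 0) :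
    Module.IsTorsionFree O (O ⊗[A] F) := by
  refine Module.IsTorsionFree.of_smul_eq_zero fun c t hct => ?_
  by_cases hc : c = 0
  · exact Or.inl hc
  right
  obtain ⟨a, s, rfl⟩ := IsLocalization.exists_mk'_eq S c
  have ha : algebraMap A O a ≠ 0 := by
    intro h
    apply hc
    rw [IsLocalization.mk'_eq_zero_iff]
    rw [← map_zero (algebraMap A O), IsLocalization.eq_iff_exists S] at h
    simpa using h
  have hat : a • t = 0 := by
    rw [← algebraMap_smul O a t, ← IsLocalization.mk'_spec' O a s, mul_smul, hct, smul_zero]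
  have hinj : Function.Injective (LinearMap.lTensor O (LinearMap.lsmul A F a)) := by
    apply Module.Flat.lTensor_preserves_injective_linearMap
    rw [← LinearMap.ker_eq_bot, LinearMap.ker_eq_bot']
    exact fun x hx => hF a ha x hx
  have e : LinearMap.lTensor O (LinearMap.lsmul A F a) = LinearMap.lsmul A (O ⊗[A] F) a := by
    ext
    simp
  apply hinj
  rw [map_zero, e]
  exact hat

/-- `O ⊗ F` is finitely generated and torsion-free over a principal ideal domain, hence free.
Multiplication by `a` on it has determinant `a` to the power of the rank, which is the dimension of
`L ⊗ F`. -/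
theorem flatLength_quotient_smul [IsDomain O] [IsPrincipalIdealRing O] [Module.Flat A O]
    (S : Submonoid A) [IsLocalization S O]
    (L : Type*) [Field L] [Algebra A L] [Algebra O L] [IsScalarTower A O L]
    {F : Type*} [AddCommGroup F] [Module A F] [Module.Finite A F]
    (hF : ∀ a : A, algebraMap A O a ≠ 0 → ∀ x : F, a • x = 0 → x = 0) (a : A)
    (ha : algebraMap A O a ≠ 0) :
    flatLength A O (F ⧸ LinearMap.range (LinearMap.lsmul A F a)) =
      flatLength A L F * Ring.ord O (algebraMap A O a) := by
  have := isTorsionFree_baseChange (O := O) S hF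
  have hfin : flatLength A L F = Module.finrank O (O ⊗[A] F) := by
    unfold flatLength
    rw [Module.length_eq_finrank, ← Module.finrank_baseChange (R := L) (S := O),
      (TensorProduct.AlgebraTensorModule.cancelBaseChange A O L L F).finrank_eq]
  have hmap : (LinearMap.lsmul A F a).baseChange O = algebraMap A O a • LinearMap.id := by
    ext x
    simp
  have hdet : LinearMap.det ((LinearMap.lsmul A F a).baseChange O) =
      algebraMap A O a ^ Module.finrank O (O ⊗[A] F) := by
    rw [hmap, LinearMap.det_smul]
    simp
  rw [flatLength_quotient_range, length_quotient_range_eq_ord_det, hdet, Ring.ord_pow, hfin]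
  · simp
  · exact mem_nonZeroDivisors_of_ne_zero ha
  · rw [hdet]
    exact pow_ne_zero _ ha

/-- A Noetherian local domain with principal nonzero maximal ideal, here generated by `π`. -/
theorem isDiscreteValuationRing_localization_prime {A : Type*} [CommRing A] [IsDomain A]
    [IsNoetherianRing A] {π : A} (hπ : Prime π) [(Ideal.span {π}).IsPrime] :
    IsDiscreteValuationRing (Localization.AtPrime (Ideal.span {π})) := by
  set O := Localization.AtPrime (Ideal.span {π})
  have hmax : IsLocalRing.maximalIdeal O = Ideal.span {algebraMap A O π} := by
    rw [← Localization.AtPrime.map_eq_maximalIdeal, Ideal.map_span, Set.image_singleton]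
  have : IsDomain O := IsLocalization.isDomain_of_local_atPrime inferInstance
  have : IsNoetherianRing O := IsLocalization.isNoetherianRing
    (Ideal.span {π}).primeCompl O inferInstance
  have hpr : (IsLocalRing.maximalIdeal O).IsPrincipal := ⟨_, hmax⟩
  have hpir : IsPrincipalIdealRing O :=
    ((tfae_of_isNoetherianRing_of_isLocalRing_of_isDomain O).out 0 4).mpr hpr
  refine { hpir with not_a_field' := ?_ }
  rw [hmax]
  simp only [ne_eq, Ideal.span_singleton_eq_bot]
  intro h
  apply hπ.ne_zero
  exact (IsLocalization.injective O (Ideal.primeCompl_le_nonZeroDivisors (Ideal.span {π}))) (by simpa using h)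

end Length


theorem IsDeg.of_shift {q D : ℕ} {h : (Fin q → ℕ) → ℚ} (c : Fin q → ℕ)
    (hh : IsDeg D fun ν => h (ν + c)) : IsDeg D h := by
  induction D generalizing h with
  | zero =>
    obtain ⟨b, hb⟩ := hh
    refine ⟨b + c, fun ν hν => ?_⟩
    obtain ⟨μ, rfl⟩ := exists_add_of_le hν
    have := hb (b + μ) (le_add_of_nonneg_right zero_le)
    dsimp only at this
    rwa [add_right_comm] at this
  | succ D ih =>
    intro j
    refine ih ((hh j).congr ⟨0, fun ν _ => ?_⟩)
    dsimp only
    rw [add_right_comm]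

/-! ### Filter-regular elements and Hilbert functions -/

section FilterRegularLength

variable {q : ℕ} {n : Fin q → ℕ} {A : Type*} [CommRing A]
  {M : Type*} [AddCommGroup M] [Module A M] [Module (MultiPoly n A) M]
  {gr : (Fin q → ℕ) → Submodule A M}

/-- The submodule `Y + f M`. -/
noncomputable def addMul (Y : Submodule (MultiPoly n A) M) (f : MultiPoly n A) :
    Submodule (MultiPoly n A) M :=
  Y ⊔ (⊤ : Submodule (MultiPoly n A) M).map (LinearMap.lsmul (MultiPoly n A) M f)

/-- `f` is filter-regular modulo `Y`. -/
def FilterRegularMod (gr : (Fin q → ℕ) → Submodule A M) (Y : Submodule (MultiPoly n A) M)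
    (f : MultiPoly n A) : Prop :=
  ∃ ν₀, ∀ ν, ν₀ ≤ ν → ∀ m ∈ gr ν, f • m ∈ Y → m ∈ Y

variable {Y : Submodule (MultiPoly n A) M} {f : MultiPoly n A} {d : Fin q → ℕ}

theorem IsMultigraded.IsHomog.addMul {hgr : IsMultigraded n gr} (hY : hgr.IsHomog Y)
    (hf : IsMultihomogeneous f d) : hgr.IsHomog (addMul Y f) :=
  IsMultigraded.IsHomog.sup hgr hY (IsMultigraded.IsHomog.map_lsmul hgr hgr.isHomog_top hf)

/-- Homogeneous elements of `Y + f M`. -/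
theorem mem_addMul_iff {hgr : IsMultigraded n gr} (hY : hgr.IsHomog Y)
    (hf : IsMultihomogeneous f d) {ν : Fin q → ℕ} {m : M} (hm : m ∈ gr (ν + d)) :
    m ∈ addMul Y f ↔ ∃ x ∈ gr ν, m - f • x ∈ Y := by
  constructor
  · intro h
    obtain ⟨y, hy, _, ⟨x, -, rfl⟩, hyx⟩ := Submodule.mem_sup.mp h
    refine ⟨hgr.proj ν x, hgr.proj_mem _ _, ?_⟩
    have e : m - f • hgr.proj ν x = hgr.proj (ν + d) y := by
      rw [← hgr.proj_smul_add hf, ← hgr.proj_of_mem hm, ← hyx, map_add]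
      simp
    rw [e]
    exact hY y hy _
  · rintro ⟨x, -, h⟩
    rw [← sub_add_cancel m (f • x)]
    exact Submodule.add_mem_sup h ⟨x, trivial, rfl⟩

variable [IsScalarTower A (MultiPoly n A) M] (O : Type*) [CommRing O] [Algebra A O]
  [Module.Flat A O]

theorem gradedLength_ne_top_of_bot
    (hfin : ∀ ν, gradedLength gr O (⊤ : Submodule (MultiPoly n A) M) ⊥ ν ≠ ⊤)
    (X Y : Submodule (MultiPoly n A) M) (ν : Fin q → ℕ) : gradedLength gr O X Y ν ≠ ⊤ :=
  ne_top_of_le_ne_top (hfin ν) ((gradedLength_mono_left O le_top ν).trans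
    (gradedLength_anti_right O bot_le ν))

/-- Dividing by a filter-regular element lowers the degree of the Hilbert function. -/
theorem isDeg_addMul (hgr : IsMultigraded n gr)
    (hfin : ∀ ν, gradedLength gr O (⊤ : Submodule (MultiPoly n A) M) ⊥ ν ≠ ⊤)
    (hY : hgr.IsHomog Y) (hf : IsMultihomogeneous f d) (hreg : FilterRegularMod gr Y f) {D : ℕ}
    (hD : IsDeg (D + 1) fun ν => ((gradedLength gr O ⊤ Y ν).toNat : ℚ)) :
    IsDeg D fun ν => ((gradedLength gr O ⊤ (addMul Y f) ν).toNat : ℚ) := by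
  -- For large `ν` multiplication by `f` is injective on `(M/Y)_ν`, so the Hilbert function of the
  -- quotient at `ν + d` is the difference with step `d` of that of `M/Y`.
  refine IsDeg.of_shift d ((hD.diff d).congr ?_)
  obtain ⟨ν₀, h0⟩ := hreg
  refine ⟨ν₀, fun ν hν => ?_⟩
  have h1 := gradedLength_add_degree O hgr hgr.isHomog_top hY hf ν
  have h2 : gradedLength gr O ⊤ (Y.comap (LinearMap.lsmul (MultiPoly n A) M f)) ν =
      gradedLength gr O ⊤ Y ν :=
    relLength_congr O fun x hx => ⟨fun h => h0 ν hν x hx.1 h, fun h => Y.smul_mem f h⟩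
  rw [h2] at h1
  have h3 := congrArg ENat.toNat h1
  rw [ENat.toNat_add (gradedLength_ne_top_of_bot O hfin _ _ _)
    (gradedLength_ne_top_of_bot O hfin _ _ _)] at h3
  rw [h3]
  push_cast
  unfold addMul
  ring

/-- The submodule of the elements which are torsion modulo `Y`. -/
def torsionClosure [IsDomain A] (Y : Submodule (MultiPoly n A) M) :
    Submodule (MultiPoly n A) M where
  carrier := {m | ∃ a : A, a ≠ 0 ∧ a • m ∈ Y}
  add_mem' := by
    rintro x y ⟨a, ha, hx⟩ ⟨b, hb, hy⟩
    refine ⟨a * b, mul_ne_zero ha hb, ?_⟩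
    rw [smul_add]
    refine add_mem ?_ ?_
    · rw [mul_comm, mul_smul]
      exact (Y.restrictScalars A).smul_mem b hx
    · rw [mul_smul]
      exact (Y.restrictScalars A).smul_mem a hy
  zero_mem' := ⟨1, one_ne_zero, by simp⟩
  smul_mem' := by
    rintro p x ⟨a, ha, hx⟩
    refine ⟨a, ha, ?_⟩
    rw [← algebraMap_smul (MultiPoly n A) a (p • x), smul_comm, algebraMap_smul]
    exact Y.smul_mem p hx

variable [IsDomain A]

theorem le_torsionClosure (Y : Submodule (MultiPoly n A) M) : Y ≤ torsionClosure Y :=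
  fun x hx => ⟨1, one_ne_zero, by simpa using hx⟩

theorem mem_torsionClosure_of_smul_mem {a : A} (ha : a ≠ 0) {x : M}
    (h : a • x ∈ torsionClosure Y) : x ∈ torsionClosure Y := by
  obtain ⟨b, hb, hx⟩ := h
  exact ⟨b * a, mul_ne_zero hb ha, by rwa [mul_smul]⟩

theorem IsMultigraded.IsHomog.torsionClosure {hgr : IsMultigraded n gr} (hY : hgr.IsHomog Y) :
    hgr.IsHomog (torsionClosure Y) := by
  rintro m ⟨a, ha, hm⟩ ν
  refine ⟨a, ha, ?_⟩
  rw [← map_smul]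
  exact hY _ hm ν

theorem exists_smul_torsionClosure_le [IsNoetherian (MultiPoly n A) M]
    (Y : Submodule (MultiPoly n A) M) :
    ∃ a : A, a ≠ 0 ∧ ∀ m ∈ torsionClosure Y, a • m ∈ Y := by
  classical
  obtain ⟨G, hG⟩ := IsNoetherian.noetherian (torsionClosure Y)
  have : ∀ g : M, ∃ a : A, a ≠ 0 ∧ (g ∈ torsionClosure Y → a • g ∈ Y) := by
    intro g
    by_cases h : g ∈ torsionClosure Y
    · obtain ⟨a, ha, hg⟩ := h
      exact ⟨a, ha, fun _ => hg⟩
    · exact ⟨1, one_ne_zero, fun h' => absurd h' h⟩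
  choose a ha hag using this
  refine ⟨∏ g ∈ G, a g, Finset.prod_ne_zero_iff.mpr fun g _ => ha g, fun m hm => ?_⟩
  rw [← hG] at hm
  induction hm using Submodule.span_induction with
  | mem x hx =>
    obtain ⟨c, hc⟩ := Finset.dvd_prod_of_mem a hx
    rw [hc, mul_comm, mul_smul]
    exact (Y.restrictScalars A).smul_mem c (hag x (hG ▸ Submodule.subset_span hx))
  | zero => simp
  | add x y _ _ hx hy => rw [smul_add]; exact add_mem hx hy
  | smul p x _ hx =>
    rw [← algebraMap_smul (MultiPoly n A), smul_comm, algebraMap_smul]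
    exact Y.smul_mem p hx

/-- The torsion of `M / Y` and that of `M / (Y + f M)`. -/
theorem gradedLength_torsion_addMul_le (hgr : IsMultigraded n gr) (hY : hgr.IsHomog Y)
    (hf : IsMultihomogeneous f d) {ν : Fin q → ℕ}
    (hreg : ∀ m ∈ gr ν, f • m ∈ Y → m ∈ Y)
    {a : A} (ha : a ≠ 0) (haY : ∀ m ∈ torsionClosure (addMul Y f), a • m ∈ addMul Y f) :
    gradedLength gr O (torsionClosure (addMul Y f)) (addMul Y f) (ν + d) +
      gradedLength gr O (torsionClosure Y) Y ν ≤
    gradedLength gr O (torsionClosure Y) Y (ν + d) +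
      gradedLength gr O ⊤ (addMul (torsionClosure Y) (algebraMap A (MultiPoly n A) a)) ν := by
  have hX := hY.torsionClosure
  set X := torsionClosure Y
  set X' := torsionClosure (addMul Y f)
  have hYX : Y ≤ X := le_torsionClosure Y
  have hXX' : X ≤ X' := by
    rintro x ⟨b, hb, hx⟩
    exact ⟨b, hb, Submodule.mem_sup_left hx⟩
  have hregX : ∀ m ∈ gr ν, f • m ∈ X → m ∈ X := by
    rintro m hm ⟨b, hb, h⟩
    refine ⟨b, hb, hreg _ ((gr ν).smul_mem b hm) ?_⟩
    rwa [← algebraMap_smul (MultiPoly n A), smul_comm, algebraMap_smul]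
  -- Here `X/Y` is the torsion of `M/Y`. Since `f` is also regular modulo `X` in degree `ν`, one has
  -- `X ∩ (Y + fM) = Y + fX` in degree `ν + d`.
  have h1 : gradedLength gr O X Y (ν + d) =
      gradedLength gr O X Y ν + gradedLength gr O X (addMul Y f) (ν + d) := by
    rw [gradedLength_add_degree O hgr hX hY hf ν]
    congr 1
    · exact relLength_congr O fun x hx => ⟨fun h => hreg x hx.1 h, fun h => Y.smul_mem f h⟩
    · refine relLength_congr O fun x hx => ⟨fun h => ?_, fun h => ?_⟩
      · exact sup_le_sup_left (Submodule.map_mono le_top) Y h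
      · obtain ⟨w, hw, hxw⟩ := (mem_addMul_iff hY hf hx.1).mp h
        change x ∈ Y ⊔ X.map _
        rw [← sub_add_cancel x (f • w)]
        have hfw : f • w ∈ X := by
          rw [← sub_sub_cancel x (f • w)]
          exact sub_mem hx.2 (hYX hxw)
        exact Submodule.add_mem_sup hxw (Submodule.mem_map_of_mem (hregX w hw hfw))
  -- The torsion `X'/(Y + fM)` splits into the image of the old torsion `X` and the new part `X'/(Y
  -- + fM + X)`.
  have h2 : gradedLength gr O X' (addMul Y f) (ν + d) =
      gradedLength gr O X (addMul Y f) (ν + d) +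
        relLength O (gradedPiece gr X' (ν + d)) ((addMul Y f ⊔ X).restrictScalars A) := by
    unfold gradedLength
    rw [relLength_add O (show gradedPiece gr X (ν + d) ≤ gradedPiece gr X' (ν + d) from
      fun x hx => ⟨hx.1, hXX' hx.2⟩)]
    congr 1
    refine relLength_congr O fun x hx => ⟨fun h => ?_, fun h => ?_⟩
    · obtain ⟨y, hy, z, hz, rfl⟩ := Submodule.mem_sup.mp h
      exact Submodule.add_mem_sup hy hz.2
    · obtain ⟨y, hy, z, hz, hyz⟩ := Submodule.mem_sup.mp
        (show x ∈ addMul Y f ⊔ X from h)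
      rw [← hgr.proj_of_mem hx.1, ← hyz, map_add]
      exact Submodule.add_mem_sup (hY.addMul hf y hy _) ⟨hgr.proj_mem _ _, hX z hz _⟩
  -- Multiplication by `a` embeds the new torsion into `(fM + X)/(afM + X)`, because `M/X` is
  -- torsion-free. Multiplication by `f` maps `M/(aM + X)` onto that quotient.
  have h3 : relLength O (gradedPiece gr X' (ν + d)) ((addMul Y f ⊔ X).restrictScalars A) ≤
      gradedLength gr O ⊤ (addMul X (algebraMap A (MultiPoly n A) a)) ν := by
    set Q := (addMul X (algebraMap A (MultiPoly n A) a * f)).restrictScalars A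
    have hXQ : X.restrictScalars A ≤ Q := fun x hx => Submodule.mem_sup_left hx
    have e1 : relLength O (gradedPiece gr X' (ν + d)) ((addMul Y f ⊔ X).restrictScalars A) =
        relLength O ((gradedPiece gr X' (ν + d)).map (LinearMap.lsmul A M a)) Q := by
      rw [relLength_map]
      refine relLength_congr O fun x hx => ⟨fun h => ?_, fun h => ?_⟩
      · obtain ⟨_, hu, z, hz, rfl⟩ := Submodule.mem_sup.mp
          (show x ∈ addMul Y f ⊔ X from h)
        obtain ⟨y, hy, _, ⟨w, -, rfl⟩, rfl⟩ := Submodule.mem_sup.mp hu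
        change a • (y + f • w + z) ∈ addMul X (algebraMap A (MultiPoly n A) a * f)
        have e : a • (y + f • w + z) =
            (a • (y + z)) + (algebraMap A (MultiPoly n A) a * f) • w := by
          rw [mul_smul, algebraMap_smul, smul_add, smul_add, smul_add]
          abel
        rw [e]
        exact Submodule.add_mem_sup ((X.restrictScalars A).smul_mem a (add_mem (hYX hy) hz))
          ⟨w, trivial, rfl⟩
      · obtain ⟨z, hz, _, ⟨w, -, rfl⟩, hzw⟩ := Submodule.mem_sup.mp
          (show a • x ∈ addMul X (algebraMap A (MultiPoly n A) a * f) from h)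
        have hw : z + a • f • w = a • x := by
          rw [← hzw, ← algebraMap_smul (MultiPoly n A) a (f • w), ← mul_smul]
          rfl
        change x ∈ addMul Y f ⊔ X
        rw [← add_sub_cancel (f • w) x]
        refine Submodule.add_mem_sup (Submodule.mem_sup_right ⟨w, trivial, rfl⟩)
          (mem_torsionClosure_of_smul_mem ha ?_)
        rw [smul_sub, ← hw, add_sub_cancel_right]
        exact hz
    have e2 : (gradedPiece gr X' (ν + d)).map (LinearMap.lsmul A M a) ≤
        (gr ν).map (smulMap M f) ⊔ X.restrictScalars A := by
      rintro _ ⟨x, hx, rfl⟩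
      obtain ⟨w, hw, hxw⟩ := (mem_addMul_iff hY hf ((gr (ν + d)).smul_mem a hx.1)).mp
        (haY x hx.2)
      change a • x ∈ _
      rw [← add_sub_cancel (f • w) (a • x)]
      exact Submodule.add_mem_sup ⟨w, hw, rfl⟩ (hYX hxw)
    rw [e1]
    refine (relLength_mono_left O e2).trans ?_
    rw [relLength_sup_left O hXQ, relLength_map]
    refine (relLength_anti_right O ?_).trans (relLength_mono_left O fun x hx => ⟨hx, trivial⟩)
    intro x hx
    obtain ⟨z, hz, _, ⟨w, -, rfl⟩, rfl⟩ := Submodule.mem_sup.mp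
      (show x ∈ addMul X (algebraMap A (MultiPoly n A) a) from hx)
    change f • (z + algebraMap A (MultiPoly n A) a • w) ∈ addMul X _
    rw [smul_add, smul_smul, mul_comm f]
    exact Submodule.add_mem_sup (X.smul_mem f hz) ⟨w, trivial, rfl⟩
  rw [h1, h2]
  calc _ = gradedLength gr O X Y ν + gradedLength gr O X (addMul Y f) (ν + d) +
        relLength O (gradedPiece gr X' (ν + d)) ((addMul Y f ⊔ X).restrictScalars A) := by
          ring
    _ ≤ _ := by gcongr

/-- In degree `ν` the left-hand side is the length of `F/aF` for the torsion-free module `F =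
(M/X)_ν`, with `X` the torsion closure of `Y`. The rank of `F` is at most that of `(M/Y)_ν`, because
`Y ⊆ X`. -/
theorem gradedLength_addMul_algebraMap_le [IsDomain O] [IsPrincipalIdealRing O] (S : Submonoid A)
    [IsLocalization S O] (hinj : Function.Injective (algebraMap A O))
    (L : Type*) [Field L] [Algebra A L] [Algebra O L] [IsScalarTower A O L] [Module.Flat A L]
    (hgr : IsMultigraded n gr) (hY : hgr.IsHomog Y) {ν : Fin q → ℕ} [Module.Finite A (gr ν)]
    {a : A} (ha : a ≠ 0) :
    gradedLength gr O ⊤ (addMul (torsionClosure Y) (algebraMap A (MultiPoly n A) a)) ν ≤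
      gradedLength gr L ⊤ Y ν * Ring.ord O (algebraMap A O a) := by
  have hX := hY.torsionClosure
  set X := torsionClosure Y
  set P := gradedPiece gr (⊤ : Submodule (MultiPoly n A) M) ν
  have hP : P = gr ν := by
    ext x
    exact ⟨fun h => h.1, fun h => ⟨h, trivial⟩⟩
  have : Module.Finite A P := by rw [hP]; infer_instance
  set F := P.map (X.restrictScalars A).mkQ
  have hF : ∀ b : A, algebraMap A O b ≠ 0 → ∀ x : F, b • x = 0 → x = 0 := by
    rintro b hb ⟨_, x, hx, rfl⟩ h
    have hb' : b ≠ 0 := fun h0 => hb (by rw [h0, map_zero])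
    have h' : b • (X.restrictScalars A).mkQ x = 0 := congrArg Subtype.val h
    rw [← map_smul, Submodule.mkQ_apply, Submodule.Quotient.mk_eq_zero] at h'
    apply Subtype.ext
    change (X.restrictScalars A).mkQ x = 0
    rw [Submodule.mkQ_apply, Submodule.Quotient.mk_eq_zero]
    exact mem_torsionClosure_of_smul_mem hb' h'
  have haO : algebraMap A O a ≠ 0 := by
    rw [← map_zero (algebraMap A O)]
    exact hinj.ne ha
  have h0 : IsMultihomogeneous (algebraMap A (MultiPoly n A) a) 0 :=
    MvPolynomial.isWeightedHomogeneous_C _ _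
  have e1 : gradedLength gr O ⊤ (addMul X (algebraMap A (MultiPoly n A) a)) ν =
      flatLength A O (F ⧸ LinearMap.range (LinearMap.lsmul A F a)) := by
    refine relLength_eq_of_surjective O ((LinearMap.range (LinearMap.lsmul A F a)).mkQ ∘ₗ
      (X.restrictScalars A).mkQ.submoduleMap P) ?_ fun x => ?_
    · rw [LinearMap.coe_comp]
      exact (Submodule.mkQ_surjective _).comp (LinearMap.submoduleMap_surjective _ _)
    · rw [LinearMap.comp_apply, Submodule.mkQ_apply, Submodule.Quotient.mk_eq_zero]
      change _ ↔ (x : M) ∈ addMul X (algebraMap A (MultiPoly n A) a)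
      rw [mem_addMul_iff hX h0 (ν := ν) (by rw [add_zero]; exact x.2.1)]
      constructor
      · rintro ⟨⟨_, y, hy, rfl⟩, h⟩
        refine ⟨y, hy.1, ?_⟩
        have h' : a • (X.restrictScalars A).mkQ y = (X.restrictScalars A).mkQ x :=
          congrArg Subtype.val h
        rw [← map_smul, Submodule.mkQ_apply, Submodule.mkQ_apply, eq_comm,
          Submodule.Quotient.eq] at h'
        rw [algebraMap_smul]
        exact h'
      · rintro ⟨y, hy, h⟩
        refine ⟨⟨_, y, ⟨hy, trivial⟩, rfl⟩, ?_⟩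
        apply Subtype.ext
        change a • (X.restrictScalars A).mkQ y = (X.restrictScalars A).mkQ x
        rw [algebraMap_smul] at h
        rw [← map_smul, Submodule.mkQ_apply, Submodule.mkQ_apply, eq_comm,
          Submodule.Quotient.eq]
        exact h
  rw [e1, flatLength_quotient_smul S L hF a haO]
  gcongr
  exact gradedLength_anti_right L (le_torsionClosure Y) ν

/-- One nonzero `a` kills this torsion, whose components are finitely generated over the Noetherian
ring `A`. -/
theorem gradedLength_torsionClosure_ne_top [IsDomain O] [IsDiscreteValuationRing O]
    (hinj : Function.Injective (algebraMap A O)) [IsNoetherianRing A]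
    [IsNoetherian (MultiPoly n A) M] (Y : Submodule (MultiPoly n A) M)
    (ν : Fin q → ℕ) [Module.Finite A (gr ν)] :
    gradedLength gr O (torsionClosure Y) Y ν ≠ ⊤ := by
  obtain ⟨a, ha, haY⟩ := exists_smul_torsionClosure_le Y
  have : IsNoetherian A (gr ν) := isNoetherian_of_isNoetherianRing_of_finite A (gr ν)
  have hfg : (gradedPiece gr (torsionClosure Y) ν).FG :=
    isNoetherian_submodule.mp this _ inf_le_left
  have : Module.Finite A ((gradedPiece gr (torsionClosure Y) ν).map (Y.restrictScalars A).mkQ) :=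
    Module.Finite.iff_fg.mpr (hfg.map _)
  refine flatLength_ne_top_of_torsion O a ?_ ?_
  · rw [← map_zero (algebraMap A O)]
    exact hinj.ne ha
  · rintro ⟨_, x, hx, rfl⟩
    apply Subtype.ext
    change a • (Y.restrictScalars A).mkQ x = 0
    rw [← map_smul, Submodule.mkQ_apply, Submodule.Quotient.mk_eq_zero]
    exact haY x hx.2

/-- Dividing by a filter-regular element lowers the degree of the length of the torsion. -/
theorem isDeg_torsion_addMul [IsDomain O] [IsDiscreteValuationRing O] (S : Submonoid A)
    [IsLocalization S O] (hinj : Function.Injective (algebraMap A O))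
    (L : Type*) [Field L] [Algebra A L] [Algebra O L] [IsScalarTower A O L] [Module.Flat A L]
    [IsNoetherianRing A] [IsNoetherian (MultiPoly n A) M]
    (hgr : IsMultigraded n gr) (hfin : ∀ ν, Module.Finite A (gr ν)) (hY : hgr.IsHomog Y)
    (hf : IsMultihomogeneous f d) (hreg : FilterRegularMod gr Y f) {D : ℕ}
    (hL : ∀ ν, gradedLength gr L (⊤ : Submodule (MultiPoly n A) M) ⊥ ν ≠ ⊤)
    (hρ : IsDeg D fun ν => ((gradedLength gr L ⊤ Y ν).toNat : ℚ))
    (hτ : IsDeg (D + 1) fun ν => ((gradedLength gr O (torsionClosure Y) Y ν).toNat : ℚ)) :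
    IsDeg D fun ν =>
      ((gradedLength gr O (torsionClosure (addMul Y f)) (addMul Y f) ν).toNat : ℚ) := by
  have ht : ∀ (Z : Submodule (MultiPoly n A) M) ν, gradedLength gr O (torsionClosure Z) Z ν ≠ ⊤ :=
    fun Z ν => gradedLength_torsionClosure_ne_top O hinj Z ν
  obtain ⟨a, ha, haY⟩ := exists_smul_torsionClosure_le (addMul Y f)
  have haO : algebraMap A O a ≠ 0 := by
    rw [← map_zero (algebraMap A O)]
    exact hinj.ne ha
  have hc : Ring.ord O (algebraMap A O a) ≠ ⊤ :=
    Ring.ord_ne_top (mem_nonZeroDivisors_of_ne_zero haO)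
  -- Hilbert–Serre provides eventual polynomiality of some unknown degree. The degree is then read
  -- off from the upper bound: a difference of the old torsion length plus `ord(a)` times the
  -- generic rank, both of degree less than `D`.
  obtain ⟨k, hk⟩ := exists_isDeg_gradedLength (gr := gr) O hgr (hY.addMul hf).torsionClosure
    (hY.addMul hf) ⟨0, fun ν _ => ht (addMul Y f) ν⟩
  obtain ⟨ν₀, h0⟩ := hreg
  refine IsDeg.of_shift d (IsDeg.of_le (hk.shift d) ((hτ.diff d).add
    (hρ.const_mul ((Ring.ord O (algebraMap A O a)).toNat : ℚ)))
    ⟨0, fun ν _ => Nat.cast_nonneg _⟩ ⟨ν₀, fun ν hν => ?_⟩)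
  have h1 := gradedLength_torsion_addMul_le O hgr hY hf (h0 ν hν) ha haY
  have h2 := h1.trans (add_le_add_right (gradedLength_addMul_algebraMap_le O S hinj L hgr hY ha) _)
  have t1 := ht (addMul Y f) (ν + d)
  have t2 := ht Y ν
  have t3 := ht Y (ν + d)
  have t4 := gradedLength_ne_top_of_bot L hL ⊤ Y ν
  have t5 : gradedLength gr L ⊤ Y ν * Ring.ord O (algebraMap A O a) ≠ ⊤ :=
    WithTop.mul_ne_top t4 hc
  have h3 := ENat.toNat_le_toNat h2 (WithTop.add_ne_top.mpr ⟨t3, t5⟩)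
  rw [ENat.toNat_add t1 t2, ENat.toNat_add t3 t5, ENat.toNat_mul] at h3
  have h4 : (((gradedLength gr O (torsionClosure (addMul Y f)) (addMul Y f) (ν + d)).toNat +
    (gradedLength gr O (torsionClosure Y) Y ν).toNat : ℕ) : ℚ) ≤ _ := Nat.cast_le.mpr h3
  push_cast at h4
  linarith

end FilterRegularLength


/-! ### Filter-regular sequences and lengths -/

section SeqMod

variable {q : ℕ} {n : Fin q → ℕ} {A : Type*} [CommRing A]
  (M : Type*) [AddCommGroup M] [Module (MultiPoly n A) M] {s : ℕ}

/-- The submodule `(f_0, …, f_{k-1}) M`. -/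
noncomputable def seqMod (f : Fin s → MultiPoly n A) (k : ℕ) : Submodule (MultiPoly n A) M :=
  Ideal.span (f '' {j | (j : ℕ) < k}) • ⊤

variable {M} (f : Fin s → MultiPoly n A)

theorem seqMod_zero : seqMod M f 0 = ⊥ := by
  simp [seqMod]

theorem seqMod_succ (i : Fin s) : seqMod M f (i + 1) = addMul (seqMod M f i) (f i) := by
  have e : {j : Fin s | (j : ℕ) < i + 1} = {j : Fin s | (j : ℕ) < i} ∪ {i} := by
    ext j
    simp only [Set.mem_ofPred_eq, Set.union_singleton, Set.mem_insert_iff, Fin.ext_iff]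
    omega
  unfold seqMod addMul
  rw [e, Set.image_union, Ideal.span_union, Submodule.sup_smul, Set.image_singleton]
  congr 1
  rw [Submodule.ideal_span_singleton_smul]
  rfl

theorem seqMod_self : seqMod M f s = Ideal.span (Set.range f) • ⊤ := by
  unfold seqMod
  congr 2
  ext x
  simp

variable [Module A M] {gr : (Fin q → ℕ) → Submodule A M} {f} {d : Fin s → (Fin q → ℕ)}

theorem isHomog_seqMod (hgr : IsMultigraded n gr) (hf : ∀ i, IsMultihomogeneous (f i) (d i))
    (k : ℕ) : hgr.IsHomog (seqMod M f k) := by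
  apply hgr.isHomog_span_smul_top
  rintro _ ⟨j, -, rfl⟩
  exact ⟨d j, hf j⟩

variable [IsScalarTower A (MultiPoly n A) M]

theorem IsFilterRegularSeq.filterRegularMod (hreg : IsFilterRegularSeq n gr f) (i : Fin s) :
    FilterRegularMod gr (seqMod M f i) (f i) := by
  obtain ⟨ν₀, h0⟩ := (hreg i).2
  refine ⟨ν₀, fun ν hν m hm h => ?_⟩
  have := h0 ν hν _ (Submodule.mem_map_of_mem hm) (by
    change f i • Submodule.Quotient.mk m = 0
    rw [← Submodule.Quotient.mk_smul, Submodule.Quotient.mk_eq_zero]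
    exact h)
  exact (Submodule.Quotient.mk_eq_zero _).mp this

theorem isDeg_seqMod (L : Type*) [CommRing L] [Algebra A L] [Module.Flat A L]
    (hgr : IsMultigraded n gr) (hf : ∀ i, IsMultihomogeneous (f i) (d i))
    (hreg : IsFilterRegularSeq n gr f)
    (hL : ∀ ν, gradedLength gr L (⊤ : Submodule (MultiPoly n A) M) ⊥ ν ≠ ⊤) {E : ℕ} (k : ℕ)
    (hk : k ≤ s)
    (h0 : IsDeg (E + k) fun ν =>
      ((gradedLength gr L (⊤ : Submodule (MultiPoly n A) M) ⊥ ν).toNat : ℚ)) :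
    IsDeg E fun ν => ((gradedLength gr L ⊤ (seqMod M f k) ν).toNat : ℚ) := by
  induction k generalizing E with
  | zero => rwa [seqMod_zero]
  | succ k ih =>
    rw [show k + 1 = ((⟨k, hk⟩ : Fin s) : ℕ) + 1 from rfl, seqMod_succ]
    exact isDeg_addMul L hgr hL (isHomog_seqMod hgr hf k) (hf _) (hreg.filterRegularMod ⟨k, hk⟩)
      (ih (by omega) (by rwa [add_assoc, add_comm 1]))

variable [IsDomain A] [IsNoetherianRing A] [IsNoetherian (MultiPoly n A) M]

/-- The degree bound for the torsion is one weaker than the one for the generic rank after the same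
`k` steps, because each step adds to the torsion a multiple of the rank before that step. The
induction therefore raises `E` by one. -/
theorem isDeg_torsion_seqMod (O : Type*) [CommRing O] [Algebra A O] [Module.Flat A O]
    [IsDomain O] [IsDiscreteValuationRing O] (S : Submonoid A)
    [IsLocalization S O] (hinj : Function.Injective (algebraMap A O))
    (L : Type*) [Field L] [Algebra A L] [Algebra O L] [IsScalarTower A O L] [Module.Flat A L]
    (hgr : IsMultigraded n gr) (hfin : ∀ ν, Module.Finite A (gr ν))
    (hf : ∀ i, IsMultihomogeneous (f i) (d i)) (hreg : IsFilterRegularSeq n gr f)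
    (hL : ∀ ν, gradedLength gr L (⊤ : Submodule (MultiPoly n A) M) ⊥ ν ≠ ⊤)
    (htf : gradedLength gr O (torsionClosure (⊥ : Submodule (MultiPoly n A) M)) ⊥ = 0)
    {E : ℕ} (k : ℕ) (hk : k ≤ s)
    (h0 : IsDeg (E + k) fun ν =>
      ((gradedLength gr L (⊤ : Submodule (MultiPoly n A) M) ⊥ ν).toNat : ℚ)) :
    IsDeg (E + 1) fun ν =>
      ((gradedLength gr O (torsionClosure (seqMod M f k)) (seqMod M f k) ν).toNat : ℚ) := by
  induction k generalizing E with
  | zero =>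
    rw [seqMod_zero, htf]
    simpa using IsDeg.zero_fun
  | succ k ih =>
    have h0' : IsDeg (E + 1 + k) fun ν =>
      ((gradedLength gr L (⊤ : Submodule (MultiPoly n A) M) ⊥ ν).toNat : ℚ) := by
      rwa [add_assoc, add_comm 1]
    rw [show k + 1 = ((⟨k, hk⟩ : Fin s) : ℕ) + 1 from rfl, seqMod_succ]
    exact isDeg_torsion_addMul O S hinj L hgr hfin (isHomog_seqMod hgr hf k) (hf _)
      (hreg.filterRegularMod ⟨k, hk⟩) hL
      (isDeg_seqMod L hgr hf hreg hL k (by omega) h0') (ih (by omega) h0')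

end SeqMod

/-! ### Eventual constancy of lengths, uniformly over the prime elements -/

section UniformLength

theorem flatLength_eq_zero_of_isUnit {A : Type*} [CommRing A] (O : Type*) [CommRing O]
    [Algebra A O] {T : Type*} [AddCommGroup T] [Module A T] (a : A)
    (ha : IsUnit (algebraMap A O a)) (h : ∀ x : T, a • x = 0) : flatLength A O T = 0 := by
  have : Subsingleton (O ⊗[A] T) := by
    refine subsingleton_of_forall_eq 0 fun t => ?_
    have h1 : algebraMap A O a • t = 0 := by
      induction t using TensorProduct.induction_on with
      | zero => simp
      | tmul x y => rw [algebraMap_smul, ← TensorProduct.tmul_smul, h, TensorProduct.tmul_zero]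
      | add x y hx hy => rw [smul_add, hx, hy, add_zero]
    exact ha.smul_eq_zero.mp h1
  exact Module.length_eq_zero

theorem flatLength_field {A : Type*} [CommRing A] [Nontrivial A] (L : Type*) [Field L]
    [Algebra A L] (T : Type*) [AddCommGroup T] [Module A T] [Module.Free A T] [Module.Finite A T] :
    flatLength A L T = Module.finrank A T := by
  unfold flatLength
  rw [Module.length_eq_finrank, Module.finrank_baseChange]

theorem exists_smul_eq_zero_of_flatLength_eq_zero {A : Type*} [CommRing A] [IsDomain A]
    {T : Type*} [AddCommGroup T] [Module A T] (h : flatLength A (FractionRing A) T = 0) (x : T) :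
    ∃ a : A, a ≠ 0 ∧ a • x = 0 := by
  have : Subsingleton (FractionRing A ⊗[A] T) := Module.length_eq_zero_iff.mp h
  have h1 : TensorProduct.mk A (FractionRing A) T 1 x = 0 := Subsingleton.elim _ _
  have : IsLocalizedModule (nonZeroDivisors A) (TensorProduct.mk A (FractionRing A) T 1) :=
    (isLocalizedModule_iff_isBaseChange (nonZeroDivisors A) (FractionRing A) _).mpr
      (TensorProduct.isBaseChange A T (FractionRing A))
  obtain ⟨c, hc⟩ := (IsLocalizedModule.eq_zero_iff (nonZeroDivisors A)
    (TensorProduct.mk A (FractionRing A) T 1)).mp h1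
  exact ⟨c, nonZeroDivisors.coe_ne_zero c, hc⟩

variable {q : ℕ} {n : Fin q → ℕ} {A : Type*} [CommRing A] [IsDomain A]
  {M : Type*} [AddCommGroup M] [Module A M] [Module (MultiPoly n A) M]
  [IsScalarTower A (MultiPoly n A) M] {s : ℕ}
  {gr : (Fin q → ℕ) → Submodule A M} {f : Fin s → MultiPoly n A} {d : Fin s → (Fin q → ℕ)}

theorem gradedLength_top_bot_field (hfree : ∀ ν, Module.Free A (gr ν))
    (hfin : ∀ ν, Module.Finite A (gr ν)) (L : Type*) [Field L] [Algebra A L] (ν : Fin q → ℕ) :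
    gradedLength gr L (⊤ : Submodule (MultiPoly n A) M) ⊥ ν = Module.finrank A (gr ν) := by
  have e : gradedPiece gr (⊤ : Submodule (MultiPoly n A) M) ν = gr ν := by
    ext x
    exact ⟨fun h => h.1, fun h => ⟨h, trivial⟩⟩
  unfold gradedLength
  rw [e]
  have := relLength_bot L (P := gr ν)
  rw [flatLength_field] at this
  exact this

variable [IsNoetherianRing A] [IsNoetherian (MultiPoly n A) M]

/-- The components of `M` are free, so there is no torsion at the start; `s` filter-regular elements
bring the bound `s` for the rank of `M` down to the bound `1` for the torsion, that is, to an
eventually constant length. -/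
theorem isDeg_one_torsion_seqMod (O : Type*) [CommRing O] [Algebra A O] [Module.Flat A O]
    [IsDomain O] [IsDiscreteValuationRing O] (S : Submonoid A)
    [IsLocalization S O] (hinj : Function.Injective (algebraMap A O))
    (hgr : IsMultigraded n gr) (hfree : ∀ ν, Module.Free A (gr ν))
    (hfin : ∀ ν, Module.Finite A (gr ν))
    (hf : ∀ i, IsMultihomogeneous (f i) (d i)) (hreg : IsFilterRegularSeq n gr f)
    (hdeg : IsDeg s fun ν => (Module.finrank A (gr ν) : ℚ)) :
    IsDeg 1 fun ν =>
      ((gradedLength gr O (torsionClosure (seqMod M f s)) (seqMod M f s) ν).toNat : ℚ) := by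
  have : Module.Flat A (FractionRing O) := Module.Flat.trans A O (FractionRing O)
  have hL : ∀ ν, gradedLength gr (FractionRing O) (⊤ : Submodule (MultiPoly n A) M) ⊥ ν =
    Module.finrank A (gr ν) := gradedLength_top_bot_field hfree hfin _
  have htf : gradedLength gr O (torsionClosure (⊥ : Submodule (MultiPoly n A) M)) ⊥ = 0 := by
    funext ν
    refine relLength_eq_zero O fun x hx => ?_
    obtain ⟨c, hc, hcx⟩ := hx.2
    have : c • (⟨x, hx.1⟩ : gr ν) = 0 := Subtype.ext hcx
    have := (smul_eq_zero.mp this).resolve_left hc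
    exact congrArg Subtype.val this
  refine isDeg_torsion_seqMod O S hinj (FractionRing O) hgr hfin
    hf hreg (fun ν => by rw [hL]; exact ENat.natCast_ne_top _) htf s le_rfl ?_
  simp only [hL, ENat.toNat_natCast, zero_add]
  exact hdeg

/-- Over the localizations of `A` at its prime elements, the lengths of the components of
`M / (f_0, …, f_{s-1}) M` are eventually finite and constant, uniformly. -/
theorem exists_forall_prime_gradedLength_eq [UniqueFactorizationMonoid A]
    (hgr : IsMultigraded n gr) (hfree : ∀ ν, Module.Free A (gr ν))
    (hfin : ∀ ν, Module.Finite A (gr ν))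
    (hf : ∀ i, IsMultihomogeneous (f i) (d i)) (hreg : IsFilterRegularSeq n gr f)
    (hdeg : IsDeg s fun ν => (Module.finrank A (gr ν) : ℚ)) :
    ∃ ν₀, (∀ ν, ν₀ ≤ ν → ∀ m ∈ gr ν, ∃ a : A, a ≠ 0 ∧ a • m ∈ seqMod M f s) ∧
      ∀ (P : Ideal A) [P.IsPrime], (∃ π, Prime π ∧ P = Ideal.span {π}) → ∀ ν, ν₀ ≤ ν →
        gradedLength gr (Localization.AtPrime P) ⊤ (seqMod M f s) ν ≠ ⊤ ∧
        gradedLength gr (Localization.AtPrime P) ⊤ (seqMod M f s) ν =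
          gradedLength gr (Localization.AtPrime P) ⊤ (seqMod M f s) ν₀ := by
  classical
  set Y := seqMod M f s
  have hL : ∀ ν, gradedLength gr (FractionRing A) (⊤ : Submodule (MultiPoly n A) M) ⊥ ν =
    Module.finrank A (gr ν) := gradedLength_top_bot_field hfree hfin _
  have hdegL : IsDeg (0 + s) fun ν =>
      ((gradedLength gr (FractionRing A) (⊤ : Submodule (MultiPoly n A) M) ⊥ ν).toNat : ℚ) := by
    simp only [hL, ENat.toNat_natCast, zero_add]
    exact hdeg
  -- With `E = 0` the generic rank is eventually zero: beyond `ν₁` the quotient is torsion, and its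
  -- whole length is the torsion length.
  obtain ⟨ν₁, h1⟩ := isDeg_seqMod (FractionRing A) hgr hf hreg
    (fun ν => by rw [hL]; exact ENat.natCast_ne_top _) s le_rfl hdegL
  have htors : ∀ ν, ν₁ ≤ ν → ∀ m ∈ gr ν, m ∈ torsionClosure Y := by
    intro ν hν m hm
    have h2 : gradedLength gr (FractionRing A) ⊤ Y ν = 0 := by
      have h3 := h1 ν hν
      have h4 : gradedLength gr (FractionRing A) ⊤ Y ν ≠ ⊤ :=
        gradedLength_ne_top_of_bot _ (fun ν => by rw [hL]; exact ENat.natCast_ne_top _) _ _ _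
      rcases ENat.toNat_eq_zero.mp (Nat.cast_eq_zero.mp h3) with h | h
      · exact h
      · exact absurd h h4
    obtain ⟨a, ha, hx⟩ := exists_smul_eq_zero_of_flatLength_eq_zero h2
      ⟨_, Submodule.mem_map_of_mem (⟨hm, trivial⟩ : m ∈ gradedPiece gr ⊤ ν)⟩
    refine ⟨a, ha, ?_⟩
    have h' : a • (Y.restrictScalars A).mkQ m = 0 := congrArg Subtype.val hx
    rw [← map_smul, Submodule.mkQ_apply, Submodule.Quotient.mk_eq_zero] at h'
    exact h'
  have hpiece : ∀ ν, ν₁ ≤ ν → gradedPiece gr (⊤ : Submodule (MultiPoly n A) M) ν =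
      gradedPiece gr (torsionClosure Y) ν := by
    intro ν hν
    ext x
    exact ⟨fun h => ⟨h.1, htors ν hν x h.1⟩, fun h => ⟨h.1, trivial⟩⟩
  obtain ⟨a, ha, haY⟩ := exists_smul_torsionClosure_le Y
  -- Primality is required only after the threshold `b`, so that `b` can be chosen as a function on
  -- all ideals, with the junk value `ν₁` at irrelevant ones.
  have hlocal : ∀ P : Ideal A, ∃ b, ν₁ ≤ b ∧ ∀ [P.IsPrime], (∃ π, Prime π ∧ P = Ideal.span {π}) →
      ∀ ν, b ≤ ν → gradedLength gr (Localization.AtPrime P) ⊤ Y ν ≠ ⊤ ∧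
        gradedLength gr (Localization.AtPrime P) ⊤ Y ν =
          gradedLength gr (Localization.AtPrime P) ⊤ Y b := by
    intro P
    by_cases hP : ∃ π, Prime π ∧ P = Ideal.span {π}
    · obtain ⟨π, hπ, rfl⟩ := hP
      have : (Ideal.span {π}).IsPrime := (Ideal.span_singleton_prime hπ.ne_zero).mpr hπ
      set O := Localization.AtPrime (Ideal.span {π})
      have : IsDomain O := IsLocalization.isDomain_of_local_atPrime inferInstance
      have : IsDiscreteValuationRing O := isDiscreteValuationRing_localization_prime hπ
      have hinj : Function.Injective (algebraMap A O) :=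
        IsLocalization.injective O (Ideal.primeCompl_le_nonZeroDivisors (Ideal.span {π}))
      have : Module.Flat A O := IsLocalization.flat O (Ideal.span {π}).primeCompl
      obtain ⟨b, hb⟩ := (isDeg_one_torsion_seqMod O (Ideal.span {π}).primeCompl hinj hgr hfree hfin
        hf hreg hdeg).eventually_const
      have hne : ∀ ν, gradedLength gr O (torsionClosure Y) Y ν ≠ ⊤ := fun ν =>
        gradedLength_torsionClosure_ne_top O hinj Y ν
      refine ⟨b ⊔ ν₁, le_sup_right, fun {_} _ ν hν => ?_⟩
      unfold gradedLength
      rw [hpiece ν (le_trans le_sup_right hν), hpiece _ le_sup_right]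
      refine ⟨hne ν, ?_⟩
      have h3 := (hb ν (le_trans le_sup_left hν)).trans (hb (b ⊔ ν₁) le_sup_left).symm
      refine (ENat.natCast_toNat (hne ν)).symm.trans (Eq.trans ?_ (ENat.natCast_toNat (hne _)))
      exact congrArg _ (Nat.cast_injective h3)
    · exact ⟨ν₁, le_rfl, fun h => absurd h hP⟩
  choose b hb1 hb using hlocal
  refine ⟨(UniqueFactorizationMonoid.factors a).toFinset.sup (fun π => b (Ideal.span {π})) ⊔ ν₁,
    fun ν hν => htors ν (le_trans le_sup_right hν), ?_⟩
  rintro P hPp ⟨π, hπ, rfl⟩ ν hν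
  -- The element `a` kills the quotient in large degrees. If `π ∣ a`, then `π` generates the same
  -- ideal as one of the finitely many factors of `a`; otherwise `a` is a unit at `π` and the length
  -- is zero.
  by_cases hdvd : π ∣ a
  · obtain ⟨π', hπ', hassoc⟩ :=
      UniqueFactorizationMonoid.exists_mem_factors_of_dvd ha hπ.irreducible hdvd
    have he : Ideal.span {π} = Ideal.span {π'} := Ideal.span_singleton_eq_span_singleton.mpr hassoc
    have hle : b (Ideal.span {π}) ≤
        (UniqueFactorizationMonoid.factors a).toFinset.sup (fun π => b (Ideal.span {π})) := by
      rw [he]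
      exact Finset.le_sup (f := fun π => b (Ideal.span {π})) (by simpa using hπ')
    have h1 := hb _ ⟨π, hπ, rfl⟩ ν (le_trans (le_trans hle le_sup_left) hν)
    have h2 := hb _ ⟨π, hπ, rfl⟩ (_ ⊔ ν₁) (le_trans hle le_sup_left)
    exact ⟨h1.1, h1.2.trans h2.2.symm⟩
  · have hu : IsUnit (algebraMap A (Localization.AtPrime (Ideal.span {π})) a) := by
      refine IsLocalization.map_units _ (⟨a, ?_⟩ : (Ideal.span {π}).primeCompl)
      intro h
      exact hdvd (Ideal.mem_span_singleton.mp h)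
    have h0 : ∀ μ, ν₁ ≤ μ →
        gradedLength gr (Localization.AtPrime (Ideal.span {π})) ⊤ Y μ = 0 := by
      intro μ hμ
      refine flatLength_eq_zero_of_isUnit _ a hu ?_
      rintro ⟨_, x, hx, rfl⟩
      apply Subtype.ext
      change a • (Y.restrictScalars A).mkQ x = 0
      rw [← map_smul, Submodule.mkQ_apply, Submodule.Quotient.mk_eq_zero]
      exact haY x (htors μ hμ x hx.1)
    rw [h0 ν (le_trans le_sup_right hν), h0 _ le_sup_right]
    simp

end UniformLength


/-! ### Koszul complexes -/

section KoszulSign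

variable {s : ℕ}

/-- The sign of `e_i ∧ e_T` with respect to the basis vector `e_{T ∪ {i}}`. -/
def koszulSign (T : Finset (Fin s)) (i : Fin s) : ℤ :=
  (-1) ^ (T.filter fun j => j < i).card

theorem koszulSign_mul_self (T : Finset (Fin s)) (i : Fin s) :
    koszulSign T i * koszulSign T i = 1 := by
  unfold koszulSign
  rw [← mul_pow]
  simp

theorem koszulSign_insert {T : Finset (Fin s)} {j : Fin s} (hj : j ∉ T) (i : Fin s) :
    koszulSign (insert j T) i = (if j < i then -1 else 1) * koszulSign T i := by
  unfold koszulSign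
  rw [Finset.filter_insert]
  split_ifs with h
  · rw [Finset.card_insert_of_notMem (by simp [hj]), pow_succ, mul_comm]
  · rw [one_mul]

/-- The sign rule `e_i ∧ e_j = - e_j ∧ e_i`. -/
theorem koszulSign_insert_mul {T : Finset (Fin s)} {i j : Fin s} (hij : i ≠ j) (hi : i ∉ T)
    (hj : j ∉ T) : koszulSign (insert j T) i * koszulSign T j =
      -(koszulSign (insert i T) j * koszulSign T i) := by
  rw [koszulSign_insert hi, koszulSign_insert hj]
  rcases lt_or_gt_of_ne hij with h | h
  · rw [if_pos h, if_neg (not_lt.mpr h.le)]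
    ring
  · rw [if_pos h, if_neg (not_lt.mpr h.le)]
    ring

end KoszulSign

section Koszul

variable {R : Type*} [CommRing R] {M : Type*} [AddCommGroup M] [Module R M] {s : ℕ}

/-- The differential of the total Koszul complex. -/
noncomputable def koszulD (M : Type*) [AddCommGroup M] [Module R M] (f : Fin s → R) :
    (Finset (Fin s) → M) →ₗ[R] (Finset (Fin s) → M) :=
  LinearMap.pi fun T => ∑ i, if i ∈ T then 0 else
    koszulSign T i • f i • LinearMap.proj (R := R) (φ := fun _ => M) (insert i T)

theorem koszulD_apply (f : Fin s → R) (c : Finset (Fin s) → M) (T : Finset (Fin s)) :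
    koszulD M f c T = ∑ i, if i ∈ T then 0 else koszulSign T i • f i • c (insert i T) := by
  simp only [koszulD, LinearMap.pi_apply, LinearMap.sum_apply]
  refine Finset.sum_congr rfl fun i _ => ?_
  split_ifs <;> simp

/-- The exterior multiplication by `a e_j`. -/
noncomputable def koszulH (M : Type*) [AddCommGroup M] [Module R M] (j : Fin s) (a : R) :
    (Finset (Fin s) → M) →ₗ[R] (Finset (Fin s) → M) :=
  LinearMap.pi fun S => if j ∈ S then
    koszulSign (S.erase j) j • a • LinearMap.proj (R := R) (φ := fun _ => M) (S.erase j) else 0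

theorem koszulH_apply (j : Fin s) (a : R) (c : Finset (Fin s) → M) (S : Finset (Fin s)) :
    koszulH M j a c S =
      if j ∈ S then koszulSign (S.erase j) j • a • c (S.erase j) else 0 := by
  simp only [koszulH, LinearMap.pi_apply]
  split_ifs <;> simp

theorem koszulD_koszulD (f : Fin s → R) (c : Finset (Fin s) → M) :
    koszulD M f (koszulD M f c) = 0 := by
  funext T
  simp only [koszulD_apply, Pi.zero_apply]
  set g : Fin s × Fin s → M := fun x => if x.1 ∈ T ∨ x.2 ∈ insert x.1 T then 0 else
    (koszulSign (insert x.1 T) x.2 * koszulSign T x.1) • (f x.1 * f x.2) •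
      c (insert x.2 (insert x.1 T)) with hg
  have e : ∀ i, (if i ∈ T then 0 else koszulSign T i • f i • ∑ k, if k ∈ insert i T then 0 else
      koszulSign (insert i T) k • f k • c (insert k (insert i T))) = ∑ k, g (i, k) := by
    intro i
    simp only [hg]
    by_cases hi : i ∈ T
    · simp [hi]
    · simp only [hi, if_false, false_or, Finset.smul_sum]
      refine Finset.sum_congr rfl fun k _ => ?_
      split_ifs
      · simp
      · rw [mul_comm (koszulSign _ _), mul_smul, mul_smul, smul_comm (f i) (koszulSign _ _)]
  rw [Finset.sum_congr rfl fun i _ => e i, ← Fintype.sum_prod_type' (f := fun i k => g (i, k))]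
  -- Removing `e_i` then `e_k`, or `e_k` then `e_i`, gives opposite signs.
  refine Finset.sum_involution (fun x _ => x.swap) ?_ ?_ (fun _ _ => Finset.mem_univ _)
    (fun x _ => Prod.swap_swap x)
  · rintro ⟨i, k⟩ -
    simp only [hg, Prod.swap_prod_mk, Finset.mem_insert]
    by_cases hi : i ∈ T
    · simp [hi]
    by_cases hk : k ∈ T
    · simp [hk]
    by_cases hik : i = k
    · simp [hik]
    simp only [hi, hk, hik, Ne.symm hik, or_self, if_false]
    rw [koszulSign_insert_mul hik hi hk, Finset.insert_comm, mul_comm (f k), neg_smul,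
      add_neg_cancel]
  · rintro ⟨i, k⟩ - hne h
    have hik : k = i := congrArg Prod.fst h
    apply hne
    simp [hg, hik]

/-- The differential is the contraction with `f`, an antiderivation, so it satisfies `D(e_j ∧ c) +
e_j ∧ Dc = f_j c`. Summed over `j`, this is a null-homotopy of the multiplication by any element `∑
a_j f_j` of the ideal. -/
theorem koszulD_koszulH (f : Fin s → R) (j : Fin s) (a : R) (c : Finset (Fin s) → M) :
    koszulD M f (koszulH M j a c) + koszulH M j a (koszulD M f c) = (a * f j) • c := by
  funext T
  simp only [Pi.add_apply, koszulD_apply, koszulH_apply, Pi.smul_apply]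
  by_cases hj : j ∈ T
  · rw [if_pos hj]
    obtain ⟨U, hU, rfl⟩ : ∃ U, j ∉ U ∧ T = insert j U :=
      ⟨T.erase j, Finset.notMem_erase j T, (Finset.insert_erase hj).symm⟩
    rw [Finset.erase_insert hU, Finset.smul_sum, Finset.smul_sum, ← Finset.sum_add_distrib,
      Finset.sum_eq_single j]
    · simp only [Finset.mem_insert_self, if_true, zero_add, hU, if_false]
      rw [smul_comm a (koszulSign U j), smul_smul, koszulSign_mul_self, one_smul, mul_smul]
    · intro i _ hij
      by_cases hi : i ∈ U
      · simp [hi]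
      · have e : (insert i (insert j U)).erase j = insert i U := by
          rw [Finset.insert_comm, Finset.erase_insert (by simp [hU, Ne.symm hij])]
        simp only [Finset.mem_insert, hij, hi, or_self, if_false, true_or, or_true, if_true, e]
        have hx : ∀ (z w : ℤ) (x y : R) (m : M), z • x • w • y • m = (z * w) • (x * y) • m := by
          intro z w x y m
          rw [smul_comm x w, smul_smul, smul_smul]
        rw [hx, hx, mul_comm a, ← add_smul, koszulSign_insert (T := U) hU, koszulSign_insert hi]
        have h0 : (if j < i then (-1 : ℤ) else 1) * (if i < j then (-1 : ℤ) else 1) = -1 := by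
          rcases lt_or_gt_of_ne hij with h | h
          · rw [if_pos h, if_neg (not_lt.mpr h.le)]; ring
          · rw [if_pos h, if_neg (not_lt.mpr h.le)]; ring
        have h1 : (if j < i then (-1 : ℤ) else 1) * koszulSign U i *
            ((if i < j then (-1 : ℤ) else 1) * koszulSign U j) + koszulSign U j * koszulSign U i =
            ((if j < i then (-1 : ℤ) else 1) * (if i < j then (-1 : ℤ) else 1) + 1) *
              (koszulSign U i * koszulSign U j) := by ring
        rw [h1, h0]
        simp
    · simp
  · rw [if_neg hj, add_zero, Finset.sum_eq_single j]
    · rw [if_neg hj, if_pos (Finset.mem_insert_self j T), Finset.erase_insert hj,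
        smul_comm (f j) (koszulSign _ _), smul_smul, koszulSign_mul_self, one_smul, mul_comm,
        mul_smul]
    · intro i _ hij
      by_cases hi : i ∈ T
      · simp [hi]
      · simp [hj, Ne.symm hij]
    · simp

end Koszul

/-! ### Multihomogeneous coefficients -/

section GradedCoefficients

variable {q : ℕ} {n : Fin q → ℕ} {A : Type*} [CommRing A]

theorem isMultigraded_weightedHomogeneous :
    IsMultigraded n (MvPolynomial.weightedHomogeneousSubmodule A (multiWeight n)) where
  isInternal := by
    classical
    have := MvPolynomial.weightedDecomposition A (multiWeight n)
    exact DirectSum.Decomposition.isInternal _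
  smul_mem a b f m hf hm := by
    rw [MvPolynomial.mem_weightedHomogeneousSubmodule] at hm ⊢
    exact MvPolynomial.IsWeightedHomogeneous.mul hf hm

/-- The coefficients of a multihomogeneous element of an ideal with multihomogeneous generators
can be taken multihomogeneous. -/
theorem exists_homogeneous_coeff {s : ℕ} {f : Fin s → MultiPoly n A} {d : Fin s → (Fin q → ℕ)}
    (hf : ∀ i, IsMultihomogeneous (f i) (d i)) {g : MultiPoly n A} {δ : Fin q → ℕ}
    (hg : IsMultihomogeneous g δ) (hgf : g ∈ Ideal.span (Set.range f)) :
    ∃ (a : Fin s → MultiPoly n A), (∀ j, a j ≠ 0 → ∃ e, IsMultihomogeneous (a j) e ∧ e + d j = δ) ∧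
      ∑ j, a j * f j = g := by
  classical
  obtain ⟨c, hc⟩ := Ideal.mem_span_range_iff_exists_fun.mp hgf
  have hgr := isMultigraded_weightedHomogeneous (n := n) (A := A)
  -- Keep of each coefficient its part of degree `δ - d j`. When `d j ≤ δ` fails, that generator
  -- contributes nothing in degree `δ` and the coefficient is zero, to which no degree is assigned.
  refine ⟨fun j => if d j ≤ δ then hgr.proj (δ - d j) (c j) else 0, fun j hj => ?_, ?_⟩
  · have hle : d j ≤ δ := by
      by_contra h
      simp [h] at hj
    dsimp only
    rw [if_pos hle]
    refine ⟨δ - d j, hgr.proj_mem _ _, ?_⟩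
    funext i
    exact Nat.sub_add_cancel (hle i)
  · have h1 : hgr.proj δ g = g := hgr.proj_of_mem hg
    rw [← h1, ← hc, map_sum]
    refine Finset.sum_congr rfl fun j _ => ?_
    rw [mul_comm, mul_comm (c j), ← smul_eq_mul, ← smul_eq_mul]
    by_cases hle : d j ≤ δ
    · simp only [hle, if_true]
      obtain ⟨μ, rfl⟩ := exists_add_of_le hle
      rw [add_comm (d j), hgr.proj_smul_add (hf j), add_tsub_cancel_right]
    · simp only [hle, if_false]
      rw [hgr.proj_smul_of_not_le (hf j) hle, smul_zero]

end GradedCoefficients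


/-! ### Acyclicity of Koszul complexes -/

section KoszulSub

variable {R : Type*} [CommRing R] {M : Type*} [AddCommGroup M] [Module R M] {s : ℕ}

theorem koszulD_mem {f : Fin s → R} {Y : Submodule R M} {c : Finset (Fin s) → M}
    (hc : ∀ S, c S ∈ Y) (T : Finset (Fin s)) : koszulD M f c T ∈ Y := by
  rw [koszulD_apply]
  refine sum_mem fun i _ => ?_
  split_ifs
  · exact zero_mem _
  · exact zsmul_mem (Y.smul_mem _ (hc _)) _

theorem koszulH_mem {j : Fin s} {a : R} {Y : Submodule R M} {c : Finset (Fin s) → M}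
    (hc : ∀ S, c S ∈ Y) (T : Finset (Fin s)) : koszulH M j a c T ∈ Y := by
  rw [koszulH_apply]
  split_ifs
  · exact zsmul_mem (Y.smul_mem _ (hc _)) _
  · exact zero_mem _

/-- The families of total degree `p`. -/
def KoszulSupp (p : ℕ) (c : Finset (Fin s) → M) : Prop :=
  ∀ S : Finset (Fin s), S.card ≠ p → c S = 0

theorem KoszulSupp.koszulD {f : Fin s → R} {p : ℕ} {c : Finset (Fin s) → M}
    (hc : KoszulSupp (p + 1) c) : KoszulSupp p (koszulD M f c) := by
  intro T hT
  rw [koszulD_apply]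
  refine Finset.sum_eq_zero fun i _ => ?_
  split_ifs with hi
  · rfl
  · rw [hc _ (by rw [Finset.card_insert_of_notMem hi]; omega), smul_zero, smul_zero]

theorem KoszulSupp.koszulH {j : Fin s} {a : R} {p : ℕ} {c : Finset (Fin s) → M}
    (hc : KoszulSupp p c) : KoszulSupp (p + 1) (koszulH M j a c) := by
  intro T hT
  rw [koszulH_apply]
  split_ifs with hj
  · rw [hc _ (by rw [Finset.card_erase_of_mem hj]; have := Finset.card_pos.mpr ⟨j, hj⟩; omega),
      smul_zero, smul_zero]
  · rfl

end KoszulSub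

section KoszulDepth

variable {q : ℕ} {n : Fin q → ℕ} {A : Type*} [CommRing A]
  {M : Type*} [AddCommGroup M] [Module A M] [Module (MultiPoly n A) M]
  {gr : (Fin q → ℕ) → Submodule A M} {s : ℕ} {d : Fin s → (Fin q → ℕ)}
  {f : Fin s → MultiPoly n A}

theorem koszulD_mem_koszulPiece (hgr : IsMultigraded n gr)
    (hf : ∀ i, IsMultihomogeneous (f i) (d i)) {ν : Fin q → ℕ} {c : Finset (Fin s) → M}
    (hc : ∀ S, c S ∈ koszulPiece gr d ν S) (T : Finset (Fin s)) :
    koszulD M f c T ∈ koszulPiece gr d ν T := by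
  rw [koszulD_apply]
  refine sum_mem fun i _ => ?_
  split_ifs with hi
  · exact zero_mem _
  · exact zsmul_mem (koszulPiece_smul_mem hgr hf ν T i hi _ (hc _)) _

theorem koszulH_mem_koszulPiece (hgr : IsMultigraded n gr) {j : Fin s} {a : MultiPoly n A}
    {e δ : Fin q → ℕ} (ha : IsMultihomogeneous a e) (he : e + d j = δ) {ν : Fin q → ℕ}
    {c : Finset (Fin s) → M} (hc : ∀ S, c S ∈ koszulPiece gr d ν S) (T : Finset (Fin s)) :
    koszulH M j a c T ∈ koszulPiece gr d (ν + δ) T := by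
  classical
  rw [koszulH_apply]
  split_ifs with hj
  · refine zsmul_mem ?_ _
    have h := hc (T.erase j)
    have hsum : ∑ i ∈ T, d i = d j + ∑ i ∈ T.erase j, d i := (Finset.add_sum_erase T d hj).symm
    unfold koszulPiece at *
    split_ifs at h with hle
    · have hle' : ∑ i ∈ T, d i ≤ ν + δ := by
        rw [hsum, ← he, add_comm]
        exact add_le_add hle (le_add_of_nonneg_left zero_le)
      rw [if_pos hle']
      have key := hgr.smul_mem _ _ _ _ ha h
      have e1 : e + (ν - ∑ i ∈ T.erase j, d i) = ν + δ - ∑ i ∈ T, d i := by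
        rw [hsum, ← he]
        funext k
        have := hle k
        simp only [Pi.add_apply, Pi.sub_apply] at *
        omega
      rwa [e1] at key
    · rw [(Submodule.mem_bot A).mp h, smul_zero]
      exact zero_mem _
  · exact zero_mem _

theorem koszulPiece_of_le {ν : Fin q → ℕ} (hν : ∑ i, d i ≤ ν) (S : Finset (Fin s)) :
    koszulPiece gr d ν S = gr (ν - ∑ i ∈ S, d i) := by
  unfold koszulPiece
  exact if_pos ((Finset.sum_le_sum_of_subset (Finset.subset_univ S)).trans hν)

theorem le_sub_sum {ν ν₀ : Fin q → ℕ} (hν : ν₀ + ∑ i, d i ≤ ν) (S : Finset (Fin s)) :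
    ν₀ ≤ ν - ∑ i ∈ S, d i := by
  intro k
  have h1 := hν k
  have h2 := (Finset.sum_le_sum_of_subset (f := d) (Finset.subset_univ S)) k
  simp only [Pi.add_apply, Pi.sub_apply] at *
  omega

/-- A cycle modulo the first elements of a filter-regular sequence in `(f)` is a boundary modulo
these elements. -/
theorem exists_koszulD_sub_mem (hgr : IsMultigraded n gr)
    (hf : ∀ i, IsMultihomogeneous (f i) (d i)) {t : ℕ} {g : Fin t → MultiPoly n A}
    {δ : Fin t → (Fin q → ℕ)} (hg : ∀ i, IsMultihomogeneous (g i) (δ i))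
    (hgf : ∀ i, g i ∈ Ideal.span (Set.range f))
    (hreg : ∀ i : Fin t, FilterRegularMod gr (seqMod M g i) (g i)) (l k : ℕ) (hlk : k + l = t) :
    ∃ ν₀, ∀ ν, ν₀ ≤ ν → ∀ p, s + k < p + t → ∀ c : Finset (Fin s) → M,
      (∀ S, c S ∈ koszulPiece gr d ν S) → KoszulSupp p c →
      (∀ S, koszulD M f c S ∈ seqMod M g k) →
      ∃ b : Finset (Fin s) → M, (∀ S, b S ∈ koszulPiece gr d ν S) ∧ KoszulSupp (p + 1) b ∧
        ∀ S, (c - koszulD M f b) S ∈ seqMod M g k := by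
  induction l generalizing k with
  | zero =>
    -- The whole sequence is used up, `k = t`, so `p > s` and there is no subset of size `p`.
    refine ⟨0, fun ν _ p hp c _ hs _ => ⟨0, fun S => zero_mem _, fun S _ => rfl, fun S => ?_⟩⟩
    have h1 : c S = 0 := hs S (by have := Finset.card_le_univ S; simp at this; omega)
    simp [h1]
  | succ l ih =>
    obtain ⟨ν₁, h1⟩ := ih (k + 1) (by omega)
    have hk : k < t := by omega
    obtain ⟨ν₂, h2⟩ := hreg ⟨k, hk⟩
    obtain ⟨a, ha, hag⟩ := exists_homogeneous_coeff hf (hg ⟨k, hk⟩) (hgf ⟨k, hk⟩)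
    have hYs : seqMod M g (k + 1) = addMul (seqMod M g k) (g ⟨k, hk⟩) := seqMod_succ g ⟨k, hk⟩
    refine ⟨ν₁ + (ν₂ + ∑ i, d i), fun ν hν p hp c hc hs hD => ?_⟩
    have hν1 : ν₁ ≤ ν := (le_add_of_nonneg_right zero_le).trans hν
    have hν2 : ν₂ + ∑ i, d i ≤ ν := (le_add_of_nonneg_left zero_le).trans hν
    have hνd : ∑ i, d i ≤ ν := (le_add_of_nonneg_left zero_le).trans hν2
    set δ' := δ ⟨k, hk⟩
    set g' := g ⟨k, hk⟩
    set Y := seqMod M g k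
    -- With `g' = ∑ a_j f_j`, the homotopy gives `D c' ≡ g' c` modulo `Y`, since `D c` lies in `Y`.
    -- Hence `c'` is a cycle modulo `Y + g'M`, one exterior degree higher, and the induction applies
    -- to it.
    set c' : Finset (Fin s) → M := ∑ j, koszulH M j (a j) c with hc'
    have hc'D : ∀ S, koszulD M f c' S - g' • c S ∈ Y := by
      intro S
      have e : koszulD M f c' - g' • c = -∑ j, koszulH M j (a j) (koszulD M f c) := by
        rw [hc', map_sum, ← hag, Finset.sum_smul, ← Finset.sum_sub_distrib,
          ← Finset.sum_neg_distrib]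
        refine Finset.sum_congr rfl fun j _ => ?_
        rw [← koszulD_koszulH]
        abel
      have e' := congrFun e S
      simp only [Pi.sub_apply, Pi.smul_apply, Pi.neg_apply, Finset.sum_apply] at e'
      rw [e']
      exact neg_mem (sum_mem fun j _ => koszulH_mem hD S)
    have hc'gr : ∀ S, c' S ∈ koszulPiece gr d (ν + δ') S := by
      intro S
      rw [hc', Finset.sum_apply]
      refine sum_mem fun j _ => ?_
      by_cases h0 : a j = 0
      · rw [h0, koszulH_apply]
        simp
      · obtain ⟨e, he, hed⟩ := ha j h0
        exact koszulH_mem_koszulPiece hgr he hed hc S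
    have hc's : KoszulSupp (p + 1) c' := by
      intro S hS
      rw [hc', Finset.sum_apply]
      exact Finset.sum_eq_zero fun j _ => hs.koszulH S hS
    have hgY : ∀ x : M, g' • x ∈ seqMod M g (k + 1) := fun x => by
      rw [hYs]
      exact Submodule.mem_sup_right ⟨x, trivial, rfl⟩
    have hYle : Y ≤ seqMod M g (k + 1) := by
      rw [hYs]
      exact le_sup_left
    obtain ⟨b', hb', hb's, hb'Y⟩ := h1 (ν + δ') (hν1.trans (le_add_of_nonneg_right zero_le))
      (p + 1) (by omega) c' hc'gr hc's (fun S => by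
        have := add_mem (hYle (hc'D S)) (hgY (c S))
        rwa [sub_add_cancel] at this)
    set y := c' - koszulD M f b' with hy
    have hygr : ∀ S, y S ∈ koszulPiece gr d (ν + δ') S := fun S =>
      sub_mem (hc'gr S) (koszulD_mem_koszulPiece hgr hf hb' S)
    have hys : KoszulSupp (p + 1) y := fun S hS => by
      have h := hb's.koszulD (f := f) S hS
      simp only [hy, Pi.sub_apply, h, hc's S hS, sub_zero]
    -- The remainder `y = c' - D b'` lies in `Y + g'M`, so it is `g' z` modulo `Y` with `z`
    -- homogeneous of exterior degree `p + 1`.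
    have hex : ∀ S, ∃ z ∈ gr (ν - ∑ i ∈ S, d i), (S.card ≠ p + 1 → z = 0) ∧
        y S - g' • z ∈ Y := by
      intro S
      by_cases hS : S.card = p + 1
      · have hm := hygr S
        rw [koszulPiece_of_le (hνd.trans (le_add_of_nonneg_right zero_le))] at hm
        have e1 : ν + δ' - ∑ i ∈ S, d i = (ν - ∑ i ∈ S, d i) + δ' := by
          have := (Finset.sum_le_sum_of_subset (f := d) (Finset.subset_univ S)).trans hνd
          funext i
          have := this i
          simp only [Pi.add_apply, Pi.sub_apply] at *
          omega
        rw [e1] at hm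
        have h := hb'Y S
        rw [hYs] at h
        obtain ⟨x, hx, hxY⟩ := (mem_addMul_iff (isHomog_seqMod hgr hg k) (hg ⟨k, hk⟩) hm).mp h
        exact ⟨x, hx, fun h => absurd hS h, hxY⟩
      · exact ⟨0, zero_mem _, fun _ => rfl, by simp [hys S hS]⟩
    choose z hz hzs hzY using hex
    refine ⟨z, fun S => by rw [koszulPiece_of_le hνd]; exact hz S, fun S hS => hzs S hS, ?_⟩
    intro S
    have hzgr : ∀ S, z S ∈ koszulPiece gr d ν S := fun S => by
      rw [koszulPiece_of_le hνd]
      exact hz S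
    refine h2 (ν - ∑ i ∈ S, d i) (le_sub_sum hν2 S) _ ?_ ?_
    · rw [← koszulPiece_of_le (gr := gr) hνd]
      exact sub_mem (hc S) (koszulD_mem_koszulPiece hgr hf hzgr S)
    -- Modulo `Y` one has `g' D z ≡ D y = D c' ≡ g' c`, hence `g' (c - D z) ∈ Y`, and `g'` is
    -- filter-regular modulo `Y`. Thus `z` is the required primitive of `c`.
    · have e1 : koszulD M f y = koszulD M f c' := by
        rw [hy, map_sub, koszulD_koszulD, sub_zero]
      have e2 : ∀ S, koszulD M f (y - g' • z) S ∈ Y := koszulD_mem fun S => hzY S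
      have e3 := sub_mem (e2 S) (hc'D S)
      have e4 : koszulD M f (y - g' • z) S - (koszulD M f c' S - g' • c S) =
          g' • (c - koszulD M f z) S := by
        rw [map_sub, e1, map_smul]
        simp only [Pi.sub_apply, Pi.smul_apply, smul_sub]
        abel
      rwa [e4] at e3

variable [IsScalarTower A (MultiPoly n A) M]

/-- The extension by zero of an element of a component of the Koszul complex. -/
noncomputable def koszulExtend {ν : Fin q → ℕ} {p : ℕ} (c : KoszulSlice gr d ν p) :
    Finset (Fin s) → M :=
  fun S => if h : S.card = p then c ⟨S, h⟩ else 0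

theorem koszulExtend_mem {ν : Fin q → ℕ} {p : ℕ} (c : KoszulSlice gr d ν p)
    (S : Finset (Fin s)) : koszulExtend c S ∈ koszulPiece gr d ν S := by
  unfold koszulExtend
  split_ifs with h
  · exact (c ⟨S, h⟩).2
  · exact zero_mem _

theorem koszulSupp_koszulExtend {ν : Fin q → ℕ} {p : ℕ} (c : KoszulSlice gr d ν p) :
    KoszulSupp p (koszulExtend c) := fun _ hS => dif_neg hS

theorem koszulExtend_apply {ν : Fin q → ℕ} {p : ℕ} (c : KoszulSlice gr d ν p)
    (S : {S : Finset (Fin s) // S.card = p}) : koszulExtend c S.1 = c S := dif_pos S.2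

theorem koszulDiff_apply (hgr : IsMultigraded n gr) (hf : ∀ i, IsMultihomogeneous (f i) (d i))
    (ν : Fin q → ℕ) (p : ℕ) (c : KoszulSlice gr d ν (p + 1))
    (T : {S : Finset (Fin s) // S.card = p}) :
    (koszulDiff hgr hf ν p c T : M) = koszulD M f (koszulExtend c) T.1 := by
  rw [koszulD_apply]
  simp only [koszulDiff, LinearMap.pi_apply, LinearMap.sum_apply, LinearMap.smul_apply,
    Submodule.coe_sum]
  rw [← Finset.sum_filter_add_sum_filter_not Finset.univ (fun i => i ∈ T.1)]
  rw [Finset.sum_eq_zero (s := Finset.univ.filter fun i => i ∈ T.1), zero_add]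
  · rw [Finset.sum_subtype (p := fun i => i ∉ T.1) _ (by simp)]
    refine Finset.sum_congr rfl fun i _ => ?_
    rw [if_neg i.2, koszulExtend, dif_pos (by rw [Finset.card_insert_of_notMem i.2, T.2])]
    rfl
  · intro i hi
    rw [if_pos (Finset.mem_filter.mp hi).2]

theorem koszulExtend_koszulDiff (hgr : IsMultigraded n gr)
    (hf : ∀ i, IsMultihomogeneous (f i) (d i)) (ν : Fin q → ℕ) (p : ℕ)
    (c : KoszulSlice gr d ν (p + 1)) :
    koszulExtend (koszulDiff hgr hf ν p c) = koszulD M f (koszulExtend c) := by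
  funext T
  by_cases hT : T.card = p
  · rw [koszulExtend_apply _ ⟨T, hT⟩, koszulDiff_apply]
  · rw [koszulSupp_koszulExtend _ T hT, (koszulSupp_koszulExtend c).koszulD T hT]

theorem koszulExtend_injective {ν : Fin q → ℕ} {p : ℕ} :
    Function.Injective (koszulExtend (gr := gr) (d := d) (ν := ν) (p := p)) := by
  intro c c' h
  funext S
  apply Subtype.ext
  rw [← koszulExtend_apply, ← koszulExtend_apply, h]

/-- The restriction of a family to the subsets of a given size. -/
def koszulRestrict {ν : Fin q → ℕ} (p : ℕ) (c : Finset (Fin s) → M)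
    (hc : ∀ S, c S ∈ koszulPiece gr d ν S) : KoszulSlice gr d ν p :=
  fun S => ⟨c S.1, hc S.1⟩

theorem koszulExtend_koszulRestrict {ν : Fin q → ℕ} {p : ℕ} {c : Finset (Fin s) → M}
    (hc : ∀ S, c S ∈ koszulPiece gr d ν S) (hs : KoszulSupp p c) :
    koszulExtend (koszulRestrict p c hc) = c := by
  funext S
  by_cases hS : S.card = p
  · rw [koszulExtend_apply _ ⟨S, hS⟩]
    rfl
  · rw [koszulSupp_koszulExtend _ S hS, hs S hS]

theorem koszulDiff_koszulDiff (hgr : IsMultigraded n gr)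
    (hf : ∀ i, IsMultihomogeneous (f i) (d i)) (ν : Fin q → ℕ) (p : ℕ)
    (c : KoszulSlice gr d ν (p + 1 + 1)) :
    koszulDiff hgr hf ν p (koszulDiff hgr hf ν (p + 1) c) = 0 := by
  apply koszulExtend_injective
  rw [koszulExtend_koszulDiff, koszulExtend_koszulDiff, koszulD_koszulD]
  funext S
  simp [koszulExtend]

/-- The Koszul complex is exact, in large degrees, above the number of generators minus the length
of a filter-regular sequence in the ideal. -/
theorem exact_koszulDiff (hgr : IsMultigraded n gr)
    (hf : ∀ i, IsMultihomogeneous (f i) (d i)) {t : ℕ} {g : Fin t → MultiPoly n A}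
    {δ : Fin t → (Fin q → ℕ)} (hg : ∀ i, IsMultihomogeneous (g i) (δ i))
    (hgf : ∀ i, g i ∈ Ideal.span (Set.range f))
    (hreg : ∀ i : Fin t, FilterRegularMod gr (seqMod M g i) (g i)) :
    ∃ ν₀, ∀ ν, ν₀ ≤ ν → ∀ p, s ≤ p + t →
      Function.Exact (koszulDiff hgr hf ν (p + 1)) (koszulDiff hgr hf ν p) := by
  obtain ⟨ν₀, h0⟩ := exists_koszulD_sub_mem hgr hf hg hgf hreg t 0 (zero_add t)
  refine ⟨ν₀, fun ν hν p hp c => ⟨fun h => ?_, ?_⟩⟩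
  · simp only [seqMod_zero, Submodule.mem_bot] at h0
    have hD : koszulD M f (koszulExtend c) = 0 := by
      rw [← koszulExtend_koszulDiff hgr hf, h]
      funext S
      simp [koszulExtend]
    obtain ⟨b, hb, hbs, hbc⟩ := h0 ν hν (p + 1) (by omega) (koszulExtend c) (koszulExtend_mem c)
      (koszulSupp_koszulExtend c) (fun S => congrFun hD S)
    refine ⟨koszulRestrict (p + 1 + 1) b hb, koszulExtend_injective ?_⟩
    rw [koszulExtend_koszulDiff, koszulExtend_koszulRestrict hb hbs]
    funext S
    have := hbc S
    rw [Pi.sub_apply, sub_eq_zero] at this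
    exact this.symm
  · rintro ⟨b, rfl⟩
    exact koszulDiff_koszulDiff hgr hf ν p b

theorem koszulPiece_empty {ν : Fin q → ℕ} : koszulPiece gr d ν ∅ = gr ν := by
  simp [koszulPiece]

theorem mem_range_koszulDiff_zero (hgr : IsMultigraded n gr)
    (hf : ∀ i, IsMultihomogeneous (f i) (d i)) (ν : Fin q → ℕ) (c : KoszulSlice gr d ν 0) :
    c ∈ LinearMap.range (koszulDiff hgr hf ν 0) ↔
      (c ⟨∅, Finset.card_empty⟩ : M) ∈ seqMod M f s := by
  classical
  rw [seqMod_self]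
  constructor
  · rintro ⟨b, rfl⟩
    rw [koszulDiff_apply, koszulD_apply]
    refine sum_mem fun i _ => ?_
    rw [if_neg (Finset.notMem_empty i)]
    exact zsmul_mem (Submodule.smul_mem_smul (Ideal.subset_span (Set.mem_range_self i))
      Submodule.mem_top) _
  · intro h
    obtain ⟨y, hy⟩ : ∃ y : Fin s → M,
        (c ⟨∅, Finset.card_empty⟩ : M) = ∑ i, f i • y i := by
      refine Submodule.smul_induction_on (p := fun z => ∃ y : Fin s → M, z = ∑ i, f i • y i) h
        (fun a ha m _ => ?_) ?_
      · obtain ⟨b, rfl⟩ := Ideal.mem_span_range_iff_exists_fun.mp ha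
        exact ⟨fun i => b i • m, by
          rw [Finset.sum_smul]
          exact Finset.sum_congr rfl fun i _ => by rw [smul_smul, mul_comm]⟩
      · rintro _ _ ⟨y, rfl⟩ ⟨z, rfl⟩
        exact ⟨y + z, by simp [Finset.sum_add_distrib]⟩
    have hm : (c ⟨∅, Finset.card_empty⟩ : M) ∈ gr ν := by
      exact koszulPiece_empty.le (c ⟨∅, Finset.card_empty⟩).2
    -- Only the component of `y i` in degree `ν - d i` contributes to degree `ν`; it is placed at
    -- the singleton `{i}`.
    set b : Finset (Fin s) → M := fun S => ∑ i, if S = {i} ∧ d i ≤ ν then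
      hgr.proj (ν - d i) (y i) else 0 with hb
    have hbS : ∀ S, b S ∈ koszulPiece gr d ν S := by
      intro S
      refine sum_mem fun i _ => ?_
      split_ifs with h
      · obtain ⟨rfl, h⟩ := h
        simp only [koszulPiece, Finset.sum_singleton, if_pos h]
        exact hgr.proj_mem _ _
      · exact zero_mem _
    refine ⟨koszulRestrict 1 b hbS, ?_⟩
    funext S
    obtain ⟨S, hS⟩ := S
    obtain rfl : S = ∅ := Finset.card_eq_zero.mp hS
    apply Subtype.ext
    rw [koszulDiff_apply, koszulExtend_koszulRestrict hbS, koszulD_apply]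
    · have e1 : (c ⟨∅, hS⟩ : M) = hgr.proj ν (∑ i, f i • y i) := by
        rw [← hy, hgr.proj_of_mem hm]
      rw [e1, map_sum]
      refine Finset.sum_congr rfl fun i _ => ?_
      rw [if_neg (Finset.notMem_empty i)]
      have e2 : koszulSign (∅ : Finset (Fin s)) i = 1 := by simp [koszulSign]
      have e3 : b (insert i ∅) = if d i ≤ ν then hgr.proj (ν - d i) (y i) else 0 := by
        simp only [hb, insert_empty_eq, Finset.singleton_inj]
        rw [Finset.sum_eq_single i]
        · simp
        · intro k _ hk
          simp [Ne.symm hk]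
        · simp
      rw [e2, one_smul, e3]
      split_ifs with hle
      · obtain ⟨μ, rfl⟩ := exists_add_of_le hle
        rw [add_comm (d i), hgr.proj_smul_add (hf i), add_tsub_cancel_right]
      · rw [hgr.proj_smul_of_not_le (hf i) hle, smul_zero]
    · intro S hS
      simp only [hb]
      refine Finset.sum_eq_zero fun i _ => if_neg ?_
      rintro ⟨rfl, -⟩
      simp at hS

theorem flatLength_quotient_range_koszulDiff (O : Type*) [CommRing O] [Algebra A O]
    (hgr : IsMultigraded n gr) (hf : ∀ i, IsMultihomogeneous (f i) (d i)) (ν : Fin q → ℕ) :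
    flatLength A O (KoszulSlice gr d ν 0 ⧸ LinearMap.range (koszulDiff hgr hf ν 0)) =
      gradedLength gr O ⊤ (seqMod M f s) ν := by
  unfold gradedLength
  have hmem : ∀ x : gradedPiece gr (⊤ : Submodule (MultiPoly n A) M) ν,
      ∀ S : {S : Finset (Fin s) // S.card = 0}, (x : M) ∈ koszulPiece gr d ν S.1 := by
    rintro ⟨x, hx⟩ ⟨S, hS⟩
    obtain rfl : S = ∅ := Finset.card_eq_zero.mp hS
    rw [koszulPiece_empty]
    exact hx.1
  let φ : gradedPiece gr (⊤ : Submodule (MultiPoly n A) M) ν →ₗ[A] KoszulSlice gr d ν 0 :=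
    LinearMap.pi fun S => (Submodule.subtype _).codRestrict _ fun x => hmem x S
  symm
  refine relLength_eq_of_surjective O ((LinearMap.range (koszulDiff hgr hf ν 0)).mkQ ∘ₗ φ) ?_ ?_
  · rw [LinearMap.coe_comp]
    refine (Submodule.mkQ_surjective _).comp fun c => ?_
    have hm := koszulPiece_empty.le (c ⟨∅, Finset.card_empty⟩).2
    refine ⟨⟨c ⟨∅, Finset.card_empty⟩, hm, trivial⟩, ?_⟩
    funext S
    obtain ⟨S, hS⟩ := S
    obtain rfl : S = ∅ := Finset.card_eq_zero.mp hS
    rfl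
  · intro x
    rw [LinearMap.comp_apply, Submodule.mkQ_apply, Submodule.Quotient.mk_eq_zero,
      mem_range_koszulDiff_zero]
    rfl

end KoszulDepth


/-! ### Blocks of matrices of linear maps -/

section Block

variable {A : Type*} [CommRing A] {X Y : Type*} [AddCommGroup X] [Module A X] [AddCommGroup Y]
  [Module A Y] {ι κ : Type*}

theorem Module.Basis.mem_span_range_inr_iff (b : Module.Basis (ι ⊕ κ) A X) {x : X} :
    x ∈ Submodule.span A (Set.range fun j => b (Sum.inr j)) ↔ ∀ i, b.repr x (Sum.inl i) = 0 := by
  have e : (Set.range fun j => b (Sum.inr j)) = b '' Set.range Sum.inr := by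
    rw [← Set.range_comp]
    rfl
  rw [e, b.mem_span_image]
  constructor
  · intro h i
    by_contra hi
    obtain ⟨j, hj⟩ := h (Finsupp.mem_support_iff.mpr hi)
    cases hj
  · rintro h (i | j) hx
    · exact absurd (h i) (Finsupp.mem_support_iff.mp hx)
    · exact ⟨j, rfl⟩

variable {k : ℕ} [Fintype ι] [Fintype κ] [DecidableEq ι] [DecidableEq κ]
  (bX : Module.Basis (ι ⊕ Fin k) A X) (bY : Module.Basis (Fin k ⊕ κ) A Y) (d : X →ₗ[A] Y)

/-- The block is the matrix of the map from the span of the right half of `bX` to the quotient of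
`Y` by the span of the right half of `bY`. Its determinant is nonzero exactly when that map is
injective, which the next two lemmas express. -/
theorem toBlocks₁₂_mulVec_repr {x : X}
    (hx : x ∈ Submodule.span A (Set.range fun j => bX (Sum.inr j))) :
    (LinearMap.toMatrix bX bY d).toBlocks₁₂.mulVec (fun j => bX.repr x (Sum.inr j)) =
      fun i => bY.repr (d x) (Sum.inl i) := by
  rw [bX.mem_span_range_inr_iff] at hx
  funext i
  have h := congrFun (LinearMap.toMatrix_mulVec_repr bX bY d x) (Sum.inl i)
  rw [← h]
  simp [Matrix.mulVec, dotProduct, Fintype.sum_sum_type, hx, Matrix.toBlocks₁₂]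

theorem eq_zero_of_det_toBlocks₁₂_ne_zero [IsDomain A]
    (hdet : (LinearMap.toMatrix bX bY d).toBlocks₁₂.det ≠ 0) {x : X}
    (hx : x ∈ Submodule.span A (Set.range fun j => bX (Sum.inr j)))
    (hdx : d x ∈ Submodule.span A (Set.range fun j => bY (Sum.inr j))) : x = 0 := by
  have h := toBlocks₁₂_mulVec_repr bX bY d hx
  rw [bY.mem_span_range_inr_iff] at hdx
  have h0 : (LinearMap.toMatrix bX bY d).toBlocks₁₂.mulVec (fun j => bX.repr x (Sum.inr j)) = 0 := by
    rw [h]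
    funext i
    exact hdx i
  have h1 := Matrix.eq_zero_of_mulVec_eq_zero hdet h0
  rw [bX.mem_span_range_inr_iff] at hx
  apply bX.repr.injective
  rw [map_zero]
  ext (i | j)
  · exact hx i
  · exact congrFun h1 j

theorem det_toBlocks₁₂_ne_zero [IsDomain A]
    (h : ∀ x ∈ Submodule.span A (Set.range fun j => bX (Sum.inr j)),
      d x ∈ Submodule.span A (Set.range fun j => bY (Sum.inr j)) → x = 0) :
    (LinearMap.toMatrix bX bY d).toBlocks₁₂.det ≠ 0 := by
  intro hdet
  obtain ⟨v, hv, hv0⟩ := Matrix.exists_mulVec_eq_zero_iff.mpr hdet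
  set x : X := ∑ j, v j • bX (Sum.inr j) with hx
  have hxm : x ∈ Submodule.span A (Set.range fun j => bX (Sum.inr j)) :=
    sum_mem fun j _ => Submodule.smul_mem _ _ (Submodule.subset_span ⟨j, rfl⟩)
  have hr : (fun j => bX.repr x (Sum.inr j)) = v := by
    funext j
    simp [hx, Finsupp.single_apply]
  have h1 := toBlocks₁₂_mulVec_repr bX bY d hxm
  rw [hr, hv0] at h1
  have h2 := h x hxm ((bY.mem_span_range_inr_iff).mpr fun i => (congrFun h1 i).symm)
  apply hv
  rw [← hr, h2]
  simp
  rfl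

variable (O : Type*) [CommRing O] [Algebra A O]

theorem relLength_top (Q : Submodule A X) : relLength O ⊤ Q = flatLength A O (X ⧸ Q) := by
  refine relLength_eq_of_surjective O (Q.mkQ ∘ₗ Submodule.subtype _) ?_ fun x => by simp
  intro y
  obtain ⟨x, rfl⟩ := Q.mkQ_surjective y
  exact ⟨⟨x, trivial⟩, rfl⟩

/-- The order of the determinant of a block. -/
theorem ord_det_toBlocks₁₂ [IsDomain O] [IsPrincipalIdealRing O] [Module.Flat A O]
    (hdet : algebraMap A O (LinearMap.toMatrix bX bY d).toBlocks₁₂.det ≠ 0)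
    (h0 : ∀ x, d x ∈ Submodule.span A (Set.range fun j => bY (Sum.inr j)) → d x = 0) :
    Ring.ord O (algebraMap A O (LinearMap.toMatrix bX bY d).toBlocks₁₂.det) =
      flatLength A O
        (X ⧸ (LinearMap.ker d ⊔ Submodule.span A (Set.range fun j => bX (Sum.inr j)))) +
      flatLength A O
        (Y ⧸ (LinearMap.range d ⊔ Submodule.span A (Set.range fun j => bY (Sum.inr j)))) := by
  set UX := Submodule.span A (Set.range fun j => bX (Sum.inr j))
  set UY := Submodule.span A (Set.range fun j => bY (Sum.inr j))
  have : Module.Free A Y := Module.Free.of_basis bY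
  have : Module.Finite A Y := Module.Finite.of_basis bY
  -- This endomorphism has as columns the images of the right half of `bX` and the right half of
  -- `bY` itself. It is block triangular with the determinant of the block, and its cokernel is
  -- `Y/(d UX + UY)`.
  set e : Y →ₗ[A] Y := bY.constr A
    (Sum.elim (fun j => d (bX (Sum.inr j))) (fun j => bY (Sum.inr j))) with he
  have hdete : LinearMap.det e = (LinearMap.toMatrix bX bY d).toBlocks₁₂.det := by
    rw [← LinearMap.det_toMatrix bY]
    have : LinearMap.toMatrix bY bY e = Matrix.fromBlocks
        (LinearMap.toMatrix bX bY d).toBlocks₁₂ 0 (LinearMap.toMatrix bX bY d).toBlocks₂₂ 1 := by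
      ext (i | i) (j | j)
      · simp [LinearMap.toMatrix_apply, he, Matrix.toBlocks₁₂]
      · simp [LinearMap.toMatrix_apply, he]
      · simp [LinearMap.toMatrix_apply, he, Matrix.toBlocks₂₂]
      · simp [LinearMap.toMatrix_apply, he, Matrix.one_apply, Finsupp.single_apply, eq_comm]
    rw [this, Matrix.det_fromBlocks_zero₁₂, Matrix.det_one, mul_one]
  have hrange : LinearMap.range e = UX.map d ⊔ UY := by
    rw [he, Module.Basis.constr_range, Set.Sum.elim_range, Submodule.span_union,
      Submodule.map_span, ← Set.range_comp]
    rfl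
  have hle : LinearMap.range e ≤ LinearMap.range d ⊔ UY := by
    rw [hrange]
    exact sup_le_sup_right LinearMap.map_le_range _
  rw [← hdete, ← flatLength_quotient_range_eq_ord_det O e (by rwa [hdete]), ← relLength_top,
    relLength_add O (le_top : LinearMap.range d ⊔ UY ≤ ⊤), sup_eq_right.mpr hle, relLength_top]
  congr 1
  have h1 : LinearMap.range d ⊔ UY = LinearMap.range d ⊔ LinearMap.range e := by
    rw [hrange, ← sup_assoc, sup_eq_left.mpr (LinearMap.map_le_range : UX.map d ≤ _)]
  rw [h1, relLength_sup_left O le_rfl, LinearMap.range_eq_map d, relLength_map, ← relLength_top]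
  -- The cokernel of `e` is filtered by the image of `d`. By `h0` the image meets `UY` trivially, so
  -- `d` identifies the first layer `(im d + UY)/(d UX + UY)` with `X/(ker d + UX)`.
  refine relLength_congr O fun x _ => ?_
  rw [Submodule.mem_comap, hrange]
  constructor
  · intro h
    obtain ⟨_, ⟨u, hu, rfl⟩, v, hv, huv⟩ := Submodule.mem_sup.mp h
    have h2 : d (x - u) = v := by rw [map_sub, ← huv, add_sub_cancel_left]
    rw [← sub_add_cancel x u]
    exact Submodule.add_mem_sup (h0 _ (by rwa [h2])) hu
  · intro h
    obtain ⟨z, hz, u, hu, rfl⟩ := Submodule.mem_sup.mp h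
    rw [map_add, LinearMap.mem_ker.mp hz, zero_add]
    exact Submodule.mem_sup_left ⟨u, hu, rfl⟩

end Block

/-! ### Divisibility in factorial domains -/

section Divisibility

variable {A : Type*} [CommRing A] [IsDomain A] [UniqueFactorizationMonoid A]

/-- After cancelling common factors, a prime dividing what remains of `x` would divide `s`, or else
contradict coprimality. -/
theorem dvd_of_forall_prime {x y : A} (hx : x ≠ 0)
    (h : ∀ π, Prime π → ∃ s, ¬ π ∣ s ∧ x ∣ s * y) : x ∣ y := by
  obtain ⟨x', y', c, hrel, rfl, rfl⟩ := UniqueFactorizationMonoid.exists_reduced_factors x hx y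
  have hu : IsUnit x' := by
    by_contra hu
    have hx' : x' ≠ 0 := right_ne_zero_of_mul hx
    obtain ⟨π, hπ, hπx⟩ := WfDvdMonoid.exists_irreducible_factor hu hx'
    have hπ' : Prime π := UniqueFactorizationMonoid.irreducible_iff_prime.mp hπ
    obtain ⟨s, hs, hd⟩ := h π hπ'
    rw [mul_left_comm] at hd
    have hd' : x' ∣ s * y' := (mul_dvd_mul_iff_left (left_ne_zero_of_mul hx)).mp hd
    rcases hπ'.dvd_or_dvd (hπx.trans hd') with h1 | h1
    · exact hs h1
    · exact hπ.not_isUnit (hrel hπx h1)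
  exact mul_dvd_mul_left c hu.dvd

theorem dvd_of_forall_ord_le [IsNoetherianRing A] {x y : A} (hx : x ≠ 0)
    (h : ∀ (P : Ideal A) [P.IsPrime], (∃ π, Prime π ∧ P = Ideal.span {π}) →
      Ring.ord (Localization.AtPrime P) (algebraMap A _ x) ≤
        Ring.ord (Localization.AtPrime P) (algebraMap A _ y)) : x ∣ y := by
  refine dvd_of_forall_prime hx fun π hπ => ?_
  have hP : (Ideal.span {π}).IsPrime := (Ideal.span_singleton_prime hπ.ne_zero).mpr hπ
  set O := Localization.AtPrime (Ideal.span {π})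
  have : IsDomain O := IsLocalization.isDomain_of_local_atPrime inferInstance
  have : IsDiscreteValuationRing O := isDiscreteValuationRing_localization_prime hπ
  have h1 := h (Ideal.span {π}) ⟨π, hπ, rfl⟩
  rw [Ring.ord_eq_addVal, Ring.ord_eq_addVal, IsDiscreteValuationRing.addVal_le_iff_dvd] at h1
  obtain ⟨z, hz⟩ := h1
  obtain ⟨a, s, rfl⟩ := IsLocalization.exists_mk'_eq (Ideal.span {π}).primeCompl z
  refine ⟨s, fun hs => s.2 (Ideal.mem_span_singleton.mpr hs), a, ?_⟩
  have hinj := IsLocalization.injective O (Ideal.primeCompl_le_nonZeroDivisors (Ideal.span {π}))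
  apply hinj
  rw [map_mul, map_mul, hz, mul_left_comm, mul_comm (algebraMap A O s), IsLocalization.mk'_spec]

end Divisibility

/-! ### Cayley determinants and lengths -/

section CayleyDefect

variable {A : Type*} [CommRing A] {C : ℕ → Type*} [∀ i, AddCommGroup (C i)]
  [∀ i, Module A (C i)] {d : ∀ i, C (i + 1) →ₗ[A] C i} {s : ℕ}

variable (O : Type*) [CommRing O] [Algebra A O]

/-- The length that measures the failure of `u_i''` to complement the boundaries. -/
noncomputable def PartitionedBases.defect (u : PartitionedBases (A := A) C s)
    (d : ∀ i, C (i + 1) →ₗ[A] C i) (i : ℕ) : ℕ∞ :=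
  flatLength A O (C i ⧸ (LinearMap.range (d i) ⊔
    Submodule.span A (Set.range fun j => u.basis i (Sum.inr j))))

variable {O}

theorem PartitionedBases.defect_zero (u : PartitionedBases (A := A) C s) :
    u.defect O d 0 = flatLength A O (C 0 ⧸ LinearMap.range (d 0)) := by
  have e : (Submodule.span A (Set.range fun j => u.basis 0 (Sum.inr j))) = ⊥ := by
    rw [Submodule.span_eq_bot]
    rintro _ ⟨j, rfl⟩
    rw [u.size_zero] at j
    exact j.elim0
  unfold defect
  rw [e, sup_bot_eq]

theorem PartitionedBases.defect_top (u : PartitionedBases (A := A) C s) :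
    u.defect O d s = 0 := by
  have e : (Submodule.span A (Set.range fun j => u.basis s (Sum.inr j))) = ⊤ := by
    rw [eq_top_iff]
    intro x _
    rw [Module.Basis.mem_span_range_inr_iff]
    intro i
    rw [u.size_top (s + 1) (by omega)] at i
    exact i.elim0
  have : Subsingleton (C s ⧸ (LinearMap.range (d s) ⊔
      Submodule.span A (Set.range fun j => u.basis s (Sum.inr j)))) := by
    rw [Submodule.Quotient.subsingleton_iff, e, sup_top_eq]
  exact flatLength_eq_zero A O

end CayleyDefect

section CayleyLength

variable {A : Type*} [CommRing A] [IsDomain A] {C : ℕ → Type*} [∀ i, AddCommGroup (C i)]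
  [∀ i, Module A (C i)] {d : ∀ i, C (i + 1) →ₗ[A] C i} {s : ℕ}

/-- The product of the determinants of the blocks of even index. -/
noncomputable def PartitionedBases.evenDet (u : PartitionedBases (A := A) C s)
    (d : ∀ i, C (i + 1) →ₗ[A] C i) (k : ℕ) : A :=
  ∏ i ∈ Finset.range k, if Even i then (u.block d i).det else 1

/-- The product of the determinants of the blocks of odd index. -/
noncomputable def PartitionedBases.oddDet (u : PartitionedBases (A := A) C s)
    (d : ∀ i, C (i + 1) →ₗ[A] C i) (k : ℕ) : A :=
  ∏ i ∈ Finset.range k, if Even i then 1 else (u.block d i).det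

theorem PartitionedBases.oddDet_ne_zero {u : PartitionedBases (A := A) C s}
    (hu : ∀ i < s, (u.block d i).det ≠ 0) {k : ℕ} (hk : k ≤ s) : u.oddDet d k ≠ 0 := by
  unfold oddDet
  refine Finset.prod_ne_zero_iff.mpr fun i hi => ?_
  split_ifs
  · exact one_ne_zero
  · exact hu i (lt_of_lt_of_le (Finset.mem_range.mp hi) hk)

theorem PartitionedBases.evenDet_ne_zero {u : PartitionedBases (A := A) C s}
    (hu : ∀ i < s, (u.block d i).det ≠ 0) {k : ℕ} (hk : k ≤ s) : u.evenDet d k ≠ 0 := by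
  unfold evenDet
  refine Finset.prod_ne_zero_iff.mpr fun i hi => ?_
  split_ifs
  · exact hu i (lt_of_lt_of_le (Finset.mem_range.mp hi) hk)
  · exact one_ne_zero

theorem PartitionedBases.prod_mul_oddDet {u : PartitionedBases (A := A) C s}
    (hu : ∀ i < s, (u.block d i).det ≠ 0) :
    (∏ i ∈ Finset.range s, (algebraMap A (FractionRing A) (u.block d i).det) ^ ((-1 : ℤ) ^ i)) *
      algebraMap A (FractionRing A) (u.oddDet d s) =
      algebraMap A (FractionRing A) (u.evenDet d s) := by
  unfold oddDet evenDet
  rw [map_prod, map_prod, ← Finset.prod_mul_distrib]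
  refine Finset.prod_congr rfl fun i hi => ?_
  have h0 : algebraMap A (FractionRing A) (u.block d i).det ≠ 0 := by
    rw [Ne, FaithfulSMul.algebraMap_eq_zero_iff]
    exact hu i (Finset.mem_range.mp hi)
  split_ifs with h
  · rw [h.neg_one_pow, zpow_one, map_one, mul_one]
  · rw [(Nat.not_even_iff_odd.mp h).neg_one_pow, zpow_neg, zpow_one, map_one, inv_mul_cancel₀ h0]

variable {O : Type*} [CommRing O] [Algebra A O] [IsDomain O] [IsPrincipalIdealRing O]
  [Module.Flat A O]

/-- By exactness the kernel of `d i` is the image of `d (i + 1)`, so the first summand in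
`ord_det_toBlocks₁₂` is the defect at `i + 1`. -/
theorem PartitionedBases.ord_det_block {u : PartitionedBases (A := A) C s}
    (hinj : Function.Injective (algebraMap A O))
    (hu : ∀ i < s, (u.block d i).det ≠ 0)
    (hex : ∀ i, Function.Exact (d (i + 1)) (d i)) {i : ℕ} (hi : i < s) :
    Ring.ord O (algebraMap A O (u.block d i).det) = u.defect O d i + u.defect O d (i + 1) := by
  unfold defect
  have e : LinearMap.range (d (i + 1)) = LinearMap.ker (d i) :=
    (LinearMap.exact_iff.mp (hex i)).symm
  rw [add_comm (flatLength A O _), e]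
  refine ord_det_toBlocks₁₂ (u.basis (i + 1)) (u.basis i) (d i) O ?_ ?_
  · rw [Ne, map_eq_zero_iff _ hinj]
    exact hu i hi
  · intro x hx
    -- At `i = 0` the set `u_0''` is empty. Above, `d x` is a cycle in the span of `u_i''`, on which
    -- the block one step below is injective.
    cases i with
    | zero =>
      rw [Module.Basis.mem_span_range_inr_iff] at hx
      apply (u.basis 0).repr.injective
      rw [map_zero]
      ext (i | j)
      · exact hx i
      · rw [u.size_zero] at j
        exact j.elim0
    | succ i =>
      refine eq_zero_of_det_toBlocks₁₂_ne_zero (u.basis (i + 1)) (u.basis i) (d i)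
        (hu i (by omega)) hx ?_
      rw [(hex i).apply_apply_eq_zero]
      exact zero_mem _

/-- The alternating sum of consecutive defects telescopes to the defect at `0`, the length of `H_0`,
since the defect at `s` vanishes. Even and odd blocks stay on separate sides because orders live in
`ℕ∞`. -/
theorem PartitionedBases.ord_evenDet {u : PartitionedBases (A := A) C s}
    (hinj : Function.Injective (algebraMap A O))
    (hu : ∀ i < s, (u.block d i).det ≠ 0)
    (hex : ∀ i, Function.Exact (d (i + 1)) (d i)) :
    Ring.ord O (algebraMap A O (u.evenDet d s)) = Ring.ord O (algebraMap A O (u.oddDet d s)) +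
      flatLength A O (C 0 ⧸ LinearMap.range (d 0)) := by
  -- The last defect not yet cancelled stands on the left or the right according to the parity of
  -- `k`.
  have key : ∀ k ≤ s, Ring.ord O (algebraMap A O (u.evenDet d k)) +
      (if Even k then u.defect O d k else 0) = Ring.ord O (algebraMap A O (u.oddDet d k)) +
        flatLength A O (C 0 ⧸ LinearMap.range (d 0)) +
        (if Even k then 0 else u.defect O d k) := by
    intro k
    induction k with
    | zero => simp [evenDet, oddDet, u.defect_zero]
    | succ k ih =>
      intro hk
      have h1 := ih (by omega)
      have h2 := u.ord_det_block (O := O) hinj hu hex (i := k) (by omega)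
      have h3 : u.evenDet d (k + 1) = u.evenDet d k * if Even k then (u.block d k).det else 1 :=
        Finset.prod_range_succ _ _
      have h4 : u.oddDet d (k + 1) = u.oddDet d k * if Even k then 1 else (u.block d k).det :=
        Finset.prod_range_succ _ _
      have h5 : algebraMap A O (u.block d k).det ∈ nonZeroDivisors O := by
        rw [mem_nonZeroDivisors_iff_ne_zero, Ne, map_eq_zero_iff _ hinj]
        exact hu k (by omega)
      rw [h3, h4]
      by_cases hk2 : Even k
      · have hk3 : ¬ Even (k + 1) := by rwa [Nat.even_add_one, not_not]
        rw [if_pos hk2, if_pos hk2] at h1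
        rw [if_pos hk2, if_pos hk2, if_neg hk3, if_neg hk3, mul_one, map_mul, Ring.ord_mul _ h5,
          h2, add_zero, ← add_assoc, h1, add_zero]
      · have hk3 : Even (k + 1) := by rwa [Nat.even_add_one]
        rw [if_neg hk2, if_neg hk2] at h1
        rw [if_neg hk2, if_neg hk2, if_pos hk3, if_pos hk3, mul_one, map_mul, Ring.ord_mul _ h5,
          h2, add_zero]
        rw [add_zero] at h1
        rw [h1]
        abel
  have := key s le_rfl
  simpa only [u.defect_top, ite_self, add_zero] using this

end CayleyLength

/-! ### Integrality and uniqueness of Cayley determinants -/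

section CayleyUnique

variable {A : Type*} [CommRing A] [IsDomain A]

theorem injective_algebraMap_localization (P : Ideal A) [P.IsPrime] :
    Function.Injective (algebraMap A (Localization.AtPrime P)) :=
  IsLocalization.injective _ P.primeCompl_le_nonZeroDivisors

theorem isDiscreteValuationRing_of_principal [IsNoetherianRing A] (P : Ideal A) [P.IsPrime]
    (hP : ∃ π, Prime π ∧ P = Ideal.span {π}) : IsDiscreteValuationRing (Localization.AtPrime P) := by
  obtain ⟨π, hπ, rfl⟩ := hP
  exact isDiscreteValuationRing_localization_prime hπ

variable {C : ℕ → Type*} [∀ i, AddCommGroup (C i)]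
  [∀ i, Module A (C i)] {d : ∀ i, C (i + 1) →ₗ[A] C i} {s : ℕ}

theorem PartitionedBases.isCayleyDet {u : PartitionedBases (A := A) C s}
    (hu : ∀ i < s, (u.block d i).det ≠ 0) {a : A} (ha : u.evenDet d s = u.oddDet d s * a) :
    IsCayleyDet d s (algebraMap A (FractionRing A) a) := by
  refine ⟨u, hu, ?_⟩
  have h := u.prod_mul_oddDet hu
  rw [ha, map_mul, mul_comm] at h
  refine (mul_left_cancel₀ ?_ h).symm
  rw [Ne, FaithfulSMul.algebraMap_eq_zero_iff]
  exact u.oddDet_ne_zero hu le_rfl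

theorem IsCayleyDet.exists_partitionedBases {a : A}
    (ha : IsCayleyDet d s (algebraMap A (FractionRing A) a)) :
    ∃ u : PartitionedBases (A := A) C s, (∀ i < s, (u.block d i).det ≠ 0) ∧
      u.evenDet d s = u.oddDet d s * a := by
  obtain ⟨u, hu, hD⟩ := ha
  refine ⟨u, hu, ?_⟩
  apply FaithfulSMul.algebraMap_injective A (FractionRing A)
  rw [map_mul, hD, ← u.prod_mul_oddDet hu, mul_comm]

variable [UniqueFactorizationMonoid A] [IsNoetherianRing A]

/-- The Cayley determinant of a complex without higher homology lies in the ring. -/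
theorem PartitionedBases.exists_evenDet_eq {u : PartitionedBases (A := A) C s}
    (hu : ∀ i < s, (u.block d i).det ≠ 0)
    (hex : ∀ i, Function.Exact (d (i + 1)) (d i)) :
    ∃ a, u.evenDet d s = u.oddDet d s * a := by
  refine dvd_of_forall_ord_le (u.oddDet_ne_zero hu le_rfl) fun P _ hP => ?_
  have := isDiscreteValuationRing_of_principal P hP
  rw [u.ord_evenDet (injective_algebraMap_localization P) hu hex]
  exact le_self_add

/-- The order of the product of the odd blocks is finite, so it cancels in `ord_evenDet`. The
right-hand side does not involve the bases, whence the independence of their choice. -/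
theorem IsCayleyDet.ord_eq {a : A} (ha : IsCayleyDet d s (algebraMap A (FractionRing A) a))
    (hex : ∀ i, Function.Exact (d (i + 1)) (d i)) (P : Ideal A) [P.IsPrime]
    (hP : ∃ π, Prime π ∧ P = Ideal.span {π}) :
    Ring.ord (Localization.AtPrime P) (algebraMap A _ a) =
      flatLength A (Localization.AtPrime P) (C 0 ⧸ LinearMap.range (d 0)) := by
  obtain ⟨u, hu, h⟩ := ha.exists_partitionedBases
  have := isDiscreteValuationRing_of_principal P hP
  have hinj := injective_algebraMap_localization P
  have h1 := u.ord_evenDet hinj hu hex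
  have h0 : algebraMap A (Localization.AtPrime P) (u.oddDet d s) ∈
      nonZeroDivisors (Localization.AtPrime P) := by
    rw [mem_nonZeroDivisors_iff_ne_zero, Ne, map_eq_zero_iff _ hinj]
    exact u.oddDet_ne_zero hu le_rfl
  rw [h, map_mul, Ring.ord_mul' _ h0] at h1
  exact ENat.add_right_injective_of_ne_top (Ring.ord_ne_top h0) h1

theorem IsCayleyDet.ne_zero {a : A} (ha : IsCayleyDet d s (algebraMap A (FractionRing A) a)) :
    a ≠ 0 := by
  obtain ⟨u, hu, h⟩ := ha.exists_partitionedBases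
  rintro rfl
  exact u.evenDet_ne_zero hu le_rfl (by rw [h, mul_zero])

/-- Two Cayley determinants with the same orders are associated. -/
theorem IsCayleyDet.associated {C' : ℕ → Type*} [∀ i, AddCommGroup (C' i)]
    [∀ i, Module A (C' i)] {d' : ∀ i, C' (i + 1) →ₗ[A] C' i} {a a' : A}
    (ha : IsCayleyDet d s (algebraMap A (FractionRing A) a))
    (ha' : IsCayleyDet d' s (algebraMap A (FractionRing A) a'))
    (hex : ∀ i, Function.Exact (d (i + 1)) (d i))
    (hex' : ∀ i, Function.Exact (d' (i + 1)) (d' i))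
    (h : ∀ (P : Ideal A) [P.IsPrime], (∃ π, Prime π ∧ P = Ideal.span {π}) →
      flatLength A (Localization.AtPrime P) (C 0 ⧸ LinearMap.range (d 0)) =
        flatLength A (Localization.AtPrime P) (C' 0 ⧸ LinearMap.range (d' 0))) :
    Associated a a' := by
  apply associated_of_dvd_dvd
  · refine dvd_of_forall_ord_le ha.ne_zero fun P _ hP => ?_
    rw [ha.ord_eq hex P hP, ha'.ord_eq hex' P hP, h P hP]
  · refine dvd_of_forall_ord_le ha'.ne_zero fun P _ hP => ?_
    rw [ha.ord_eq hex P hP, ha'.ord_eq hex' P hP, h P hP]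

end CayleyUnique


/-! ### Adapted bases -/

section Adapted

/-- Each term of the Leibniz expansion has one factor from every row in `T`. -/
theorem det_mem_pow_card {R : Type*} [CommRing R] {ι : Type*} [Fintype ι] [DecidableEq ι]
    (I : Ideal R) (X : Matrix ι ι R) (T : Finset ι) (h : ∀ i ∈ T, ∀ j, X i j ∈ I) :
    X.det ∈ I ^ T.card := by
  rw [← Matrix.det_transpose, Matrix.det_apply]
  refine sum_mem fun τ _ => ?_
  rw [Units.smul_def]
  refine zsmul_mem ?_ _
  rw [← Finset.prod_mul_prod_compl T, ← Finset.prod_const]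
  exact Ideal.mul_mem_right _ _ (Ideal.prod_mem_prod fun i hi => h i hi _)

/-- The determinant of a matrix over a local ring whose reduction has corank at least `e` lies in
the `e`-th power of the maximal ideal. -/
theorem det_mem_maximalIdeal_pow {R : Type*} [CommRing R] [IsLocalRing R] {k : ℕ}
    (X : Matrix (Fin k) (Fin k) R)
    (W : Submodule (IsLocalRing.ResidueField R) (Fin k → IsLocalRing.ResidueField R))
    (h : ∀ v, (X.map (IsLocalRing.residue R)).mulVec v ∈ W) :
    X.det ∈ IsLocalRing.maximalIdeal R ^
      Module.finrank (IsLocalRing.ResidueField R) ((Fin k → IsLocalRing.ResidueField R) ⧸ W) := by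
  classical
  set κ := IsLocalRing.ResidueField R
  obtain ⟨W', hW⟩ := W.exists_isCompl
  set b := ((Module.finBasis κ W).prod (Module.finBasis κ W')).map
    (Submodule.prodEquivOfIsCompl W W' hW) with hb
  have hcard : Fintype.card (Fin (Module.finrank κ W) ⊕ Fin (Module.finrank κ W')) =
      Fintype.card (Fin k) := by
    rw [← Module.finrank_eq_card_basis b, Module.finrank_fin_fun, Fintype.card_fin]
  set σ := Fintype.equivOfCardEq hcard
  set b' := b.reindex σ with hb'
  have hfin : Module.finrank κ ((Fin k → κ) ⧸ W) = Module.finrank κ W' :=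
    (Submodule.quotientEquivOfIsCompl W W' hW).finrank_eq
  have hzero : ∀ v ∈ W, ∀ j, b'.repr v (σ (Sum.inr j)) = 0 := by
    intro v hv j
    have : (Submodule.prodEquivOfIsCompl W W' hW).symm v = (⟨v, hv⟩, 0) :=
      Submodule.prodEquivOfIsCompl_symm_apply_left W W' hW ⟨v, hv⟩
    simp [hb', hb, this]
  -- Lift to the local ring the change of basis of the residue space adapted to `W ⊕ W'`. The lift
  -- is invertible, and after multiplying by it the rows indexed by a basis of `W'` vanish in the
  -- residue field.
  choose P hP using fun i j => IsLocalRing.residue_surjective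
    (LinearMap.toMatrix' b'.equivFun.toLinearMap i j)
  have hPmap : (Matrix.of P).map (IsLocalRing.residue R) =
      LinearMap.toMatrix' b'.equivFun.toLinearMap := by
    ext i j
    exact hP i j
  have hunit : IsUnit (Matrix.of P).det := by
    by_contra hu
    have h1 : IsLocalRing.residue R (Matrix.of P).det = 0 :=
      (IsLocalRing.residue_eq_zero_iff _).mpr ((IsLocalRing.mem_maximalIdeal _).mpr hu)
    rw [RingHom.map_det, RingHom.mapMatrix_apply, hPmap, LinearMap.det_toMatrix'] at h1
    exact b'.equivFun.isUnit_det'.ne_zero h1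
  have hdet : (Matrix.of P * X).det ∈ IsLocalRing.maximalIdeal R ^
      (Finset.univ.image fun j : Fin (Module.finrank κ W') => σ (Sum.inr j)).card := by
    refine det_mem_pow_card _ _ _ fun i hi c => ?_
    obtain ⟨j, -, rfl⟩ := Finset.mem_image.mp hi
    rw [← IsLocalRing.residue_eq_zero_iff]
    have e1 : IsLocalRing.residue R ((Matrix.of P * X) (σ (Sum.inr j)) c) =
        ((Matrix.of P).map (IsLocalRing.residue R)).mulVec
          ((X.map (IsLocalRing.residue R)).mulVec (Pi.single c 1)) (σ (Sum.inr j)) := by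
      rw [Matrix.mulVec_mulVec, Matrix.mulVec_single_one, ← Matrix.map_mul]
      rfl
    rw [e1, hPmap, LinearMap.toMatrix'_mulVec]
    exact hzero _ (h _) j
  have hinj : Function.Injective fun j : Fin (Module.finrank κ W') => σ (Sum.inr j) :=
    σ.injective.comp Sum.inr_injective
  rw [Finset.card_image_of_injective _ hinj, Finset.card_univ,
    Fintype.card_fin, ← hfin, Matrix.det_mul] at hdet
  exact (Ideal.unit_mul_mem_iff_mem _ hunit).mp hdet

/-- Part of a basis spans a complement of a given subspace. -/
theorem exists_equiv_disjoint_span {κ : Type*} [Field κ] {V : Type*} [AddCommGroup V] [Module κ V]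
    {m : ℕ} (b : Module.Basis (Fin m) κ V) (W : Submodule κ V) {a c : ℕ}
    (hc : c + Module.finrank κ W = m) (hac : a + c = m) :
    ∃ σ : Fin m ≃ Fin a ⊕ Fin c,
      Disjoint W (Submodule.span κ (Set.range fun j => b (σ.symm (Sum.inr j)))) := by
  classical
  have : Module.Finite κ V := Module.Finite.of_basis b
  -- The classes of the basis vectors span the quotient by `W`; a maximal independent subfamily of
  -- them is a basis of the quotient, so the chosen vectors span a complement of `W`.
  obtain ⟨ι, g, hg, hspan, hli⟩ := exists_linearIndependent' κ fun i => W.mkQ (b i)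
  have : Finite ι := Finite.of_injective g hg
  have := Fintype.ofFinite ι
  have htop : Submodule.span κ (Set.range fun i => W.mkQ (b i)) = ⊤ := by
    have : (Set.range fun i => W.mkQ (b i)) = W.mkQ '' Set.range b := by
      rw [← Set.range_comp]
      rfl
    rw [this, ← Submodule.map_span, b.span_eq, Submodule.map_top, Submodule.range_mkQ]
  rw [htop] at hspan
  have hcard : Fintype.card ι = c := by
    rw [← finrank_span_eq_card hli, hspan, finrank_top]
    have h1 := W.finrank_quotient_add_finrank
    rw [Module.finrank_eq_card_basis b, Fintype.card_fin] at h1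
    omega
  set τ : Fin c ≃ Set.range g :=
    (Fintype.equivFinOfCardEq hcard).symm.trans (Equiv.ofInjective g hg)
  have hcompl : Fintype.card ((Set.range g)ᶜ : Set (Fin m)) = a := by
    rw [Fintype.card_compl_set, Fintype.card_fin, Set.card_range_of_injective hg, hcard]
    omega
  refine ⟨((Equiv.sumCongr (Fintype.equivFinOfCardEq hcompl).symm τ).trans
    ((Equiv.sumComm _ _).trans (Equiv.Set.sumCompl (Set.range g)))).symm, ?_⟩
  rw [Submodule.disjoint_def]
  intro x hxW hx
  obtain ⟨v, rfl⟩ := (Submodule.mem_span_range_iff_exists_fun κ).mp hx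
  have hli' : LinearIndependent κ (fun j : Fin c =>
      W.mkQ (b (g ((Fintype.equivFinOfCardEq hcard).symm j)))) :=
    hli.comp _ (Fintype.equivFinOfCardEq hcard).symm.injective
  have h0 : ∑ j, v j • W.mkQ (b (g ((Fintype.equivFinOfCardEq hcard).symm j))) = 0 := by
    have := (Submodule.Quotient.mk_eq_zero W).mpr hxW
    rw [← Submodule.mkQ_apply, map_sum] at this
    simpa [τ] using this
  have hv := Fintype.linearIndependent_iff.mp hli' v h0
  exact Finset.sum_eq_zero fun j _ => by rw [hv j, zero_smul]

theorem finrank_eq_of_exact {L : Type*} [Field L] {X Y Z : Type*} [AddCommGroup X] [Module L X]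
    [AddCommGroup Y] [Module L Y] [AddCommGroup Z] [Module L Z] [Module.Finite L Y]
    {f : X →ₗ[L] Y} {g : Y →ₗ[L] Z} (h : Function.Exact f g) :
    Module.finrank L Y = Module.finrank L (LinearMap.range g) +
      Module.finrank L (LinearMap.range f) := by
  rw [← LinearMap.exact_iff.mp h, LinearMap.finrank_range_add_finrank_ker]

theorem finrank_range_eq_zero_of_subsingleton {L : Type*} [Field L] {X Y : Type*}
    [AddCommGroup X] [Module L X] [AddCommGroup Y] [Module L Y] [Subsingleton X] (f : X →ₗ[L] Y) :
    Module.finrank L (LinearMap.range f) = 0 := by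
  have : LinearMap.range f = ⊥ := by
    rw [LinearMap.range_eq_bot]
    exact Subsingleton.elim _ _
  rw [this, finrank_bot]

variable {A : Type*} [CommRing A] {C : ℕ → Type*} [∀ i, AddCommGroup (C i)]
  [∀ i, Module A (C i)]

theorem PartitionedBases.map_block {s : ℕ} (u : PartitionedBases (A := A) C s)
    (d : ∀ i, C (i + 1) →ₗ[A] C i) (L : Type*) [CommRing L] [Algebra A L] (i : ℕ) :
    (u.block d i).map (algebraMap A L) =
      (LinearMap.toMatrix ((u.basis (i + 1)).baseChange L) ((u.basis i).baseChange L)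
        ((d i).baseChange L)).toBlocks₁₂ := by
  ext i j
  simp [PartitionedBases.block, LinearMap.toMatrix_apply, Matrix.toBlocks₁₂,
    Algebra.algebraMap_eq_smul_one]

theorem PartitionedBases.algebraMap_det_block {s : ℕ} (u : PartitionedBases (A := A) C s)
    (d : ∀ i, C (i + 1) →ₗ[A] C i) (L : Type*) [CommRing L] [Algebra A L] (i : ℕ) :
    algebraMap A L (u.block d i).det =
      (LinearMap.toMatrix ((u.basis (i + 1)).baseChange L) ((u.basis i).baseChange L)
        ((d i).baseChange L)).toBlocks₁₂.det := by
  rw [← u.map_block, RingHom.map_det, RingHom.mapMatrix_apply]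

variable [IsDomain A] [∀ i, Module.Free A (C i)] [∀ i, Module.Finite A (C i)]

/-- Bases adapted to a prime ideal at which the complex is acyclic in degrees at least two: the
higher blocks are invertible at the prime ideal. -/
theorem exists_partitionedBases (d : ∀ i, C (i + 1) →ₗ[A] C i) (s : ℕ)
    (hs : ∀ i, s < i → Subsingleton (C i)) (hgen : IsGenericallyExact d) (p : Ideal A) [p.IsPrime]
    (hex : ∀ i, Function.Exact ((d (i + 1 + 1)).baseChange p.ResidueField)
      ((d (i + 1)).baseChange p.ResidueField)) :
    ∃ u : PartitionedBases (A := A) C s, (∀ i, (u.block d (i + 1)).det ∉ p) ∧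
      (u.block d 0).det ≠ 0 ∧
      algebraMap A (Localization.AtPrime p) (u.block d 0).det ∈
        IsLocalRing.maximalIdeal (Localization.AtPrime p) ^
          Module.finrank p.ResidueField ((p.ResidueField ⊗[A] C 0) ⧸
            LinearMap.range ((d 0).baseChange p.ResidueField)) := by
  classical
  set κ := p.ResidueField
  set K := FractionRing A
  set ρ : ℕ → ℕ := fun i => Module.finrank K (LinearMap.range ((d i).baseChange K)) with hρ
  set τ : ℕ → ℕ := fun i => Module.finrank κ (LinearMap.range ((d i).baseChange κ)) with hτ
  set m : ℕ → ℕ := fun i => Module.finrank A (C i) with hm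
  have hmρ : ∀ i, m (i + 1) = ρ i + ρ (i + 1) := fun i => by
    rw [hm, ← finrank_eq_of_exact (hgen.2 i), Module.finrank_baseChange]
  have hmτ : ∀ i, m (i + 2) = τ (i + 1) + τ (i + 2) := fun i => by
    rw [hm, ← finrank_eq_of_exact (hex i), Module.finrank_baseChange]
  have hm0 : m 0 = ρ 0 := by
    rw [hm, hρ]
    simp only
    rw [LinearMap.range_eq_top.mpr hgen.1, finrank_top, Module.finrank_baseChange]
  have hsub : ∀ (L : Type _) [CommRing L] [Algebra A L] (i : ℕ), s < i →
      Subsingleton (L ⊗[A] C i) := fun L _ _ i hi => by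
    have := hs i hi
    infer_instance
  have hρs : ∀ i, s ≤ i → ρ i = 0 := fun i hi => by
    have := hsub K (i + 1) (by omega)
    exact finrank_range_eq_zero_of_subsingleton _
  have hτs : ∀ i, s ≤ i → τ i = 0 := fun i hi => by
    have := hs (i + 1) (by omega)
    have : Subsingleton (κ ⊗[A] C (i + 1)) := inferInstance
    exact finrank_range_eq_zero_of_subsingleton _
  -- Ranks over the fraction field and over `κ` agree for `d (i + 1)`: descending induction from the
  -- top, since exactness gives `ρ (i+1) + ρ (i+2) = m (i+2) = τ (i+1) + τ (i+2)`. Nothing is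
  -- claimed about `d 0`, whose rank may drop at `p`.
  have hρτ : ∀ l i, s ≤ i + 1 + l → τ (i + 1) = ρ (i + 1) := by
    intro l
    induction l with
    | zero =>
      intro i hi
      rw [hρs _ hi, hτs _ hi]
    | succ l ih =>
      intro i hi
      have h1 := ih (i + 1) (by omega)
      have h2 := hmρ (i + 1)
      have h3 := hmτ i
      simp only [add_assoc, one_add_one_eq_two] at *
      omega
  set sz : ℕ → ℕ := fun i => Nat.casesOn i 0 ρ with hsz
  have hsz1 : ∀ i, sz (i + 1) = ρ i := fun _ => rfl
  -- Choose `u_i''` so that its reduction complements the image of `d i` over `κ`, for `i > 0`. The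
  -- dimensions fit by generic exactness and the equality of ranks; exactness over `κ` at `C_1` is
  -- not needed.
  have hbasis : ∀ i, ∃ b : Module.Basis (Fin (sz (i + 1)) ⊕ Fin (sz i)) A (C i), i ≠ 0 →
      Disjoint (LinearMap.range ((d i).baseChange κ))
        (Submodule.span κ (Set.range fun j => b.baseChange κ (Sum.inr j))) := by
    intro i
    set b₀ := Module.finBasis A (C i)
    have hb : ∀ W : Submodule κ (κ ⊗[A] C i), sz i + Module.finrank κ W = m i →
        sz (i + 1) + sz i = m i → ∃ b : Module.Basis (Fin (sz (i + 1)) ⊕ Fin (sz i)) A (C i),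
        Disjoint W (Submodule.span κ (Set.range fun j => b.baseChange κ (Sum.inr j))) := by
      intro W h1 h2
      obtain ⟨σ, hσ⟩ := exists_equiv_disjoint_span (b₀.baseChange κ) W h1 h2
      refine ⟨b₀.reindex σ, ?_⟩
      simpa only [Module.Basis.baseChange_apply, Module.Basis.reindex_apply] using hσ
    cases i with
    | zero =>
      obtain ⟨b, -⟩ := hb ⊤ (by
        rw [finrank_top, Module.finrank_baseChange]
        exact zero_add _) (by rw [hsz1, hm0]; rfl)
      exact ⟨b, fun h => absurd rfl h⟩
    | succ i =>
      obtain ⟨b, hb⟩ := hb (LinearMap.range ((d (i + 1)).baseChange κ)) (by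
        change ρ i + τ (i + 1) = _
        rw [hρτ s i (by omega), hmρ]) (by
        rw [hsz1, hsz1, hmρ, add_comm])
      exact ⟨b, fun _ => hb⟩
  choose b hb using hbasis
  let u : PartitionedBases (A := A) C s :=
    { size := sz
      basis := b
      size_zero := rfl
      size_top := fun i hi => by
        obtain ⟨j, rfl⟩ : ∃ j, i = j + 1 := ⟨i - 1, by omega⟩
        exact hρs j (by omega) }
  -- Injectivity of the reduced block: if `d x` lies in the span of `u_{i+1}''`, it is zero since
  -- that span meets the boundaries trivially. Then `x` is itself a boundary in the span of
  -- `u_{i+2}''`, hence zero.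
  have hblock : ∀ i, (u.block d (i + 1)).det ∉ p := by
    intro i hi
    have h0 : algebraMap A κ (u.block d (i + 1)).det = 0 :=
      Ideal.algebraMap_residueField_eq_zero.mpr hi
    rw [u.algebraMap_det_block] at h0
    refine det_toBlocks₁₂_ne_zero _ _ _ (fun x hx hdx => ?_) h0
    have h1 : (d (i + 1)).baseChange κ x = 0 :=
      Submodule.disjoint_def.mp (hb (i + 1) (Nat.succ_ne_zero i)) _ ⟨x, rfl⟩ hdx
    exact Submodule.disjoint_def.mp (hb (i + 2) (Nat.succ_ne_zero (i + 1))) _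
      ((hex i x).mp h1) hx
  refine ⟨u, hblock, ?_, ?_⟩
  · intro h0
    have h1 : algebraMap A K (u.block d 0).det = 0 := by rw [h0, map_zero]
    rw [u.algebraMap_det_block] at h1
    refine det_toBlocks₁₂_ne_zero _ _ _ (fun x hx hdx => ?_) h1
    have hdet1 : algebraMap A K (u.block d 1).det ≠ 0 := by
      rw [Ne, FaithfulSMul.algebraMap_eq_zero_iff]
      intro h
      exact hblock 0 (by rw [h]; exact zero_mem p)
    rw [u.algebraMap_det_block] at hdet1
    have hdx0 : (d 0).baseChange K x = 0 := by
      have e : (Set.range fun j => (u.basis 0).baseChange K (Sum.inr j)) = ∅ := by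
        rw [Set.range_eq_empty_iff]
        exact inferInstanceAs (IsEmpty (Fin 0))
      rw [e, Submodule.span_empty] at hdx
      exact hdx
    -- Over `K` the next block is invertible, so `d 1` is injective on the span `U` of `u_2''` and,
    -- by dimension, maps it onto all boundaries. A cycle in the span of `u_1''` is thus the image
    -- of some `y ∈ U`, and the same block forces `y = 0`.
    set U := Submodule.span K (Set.range fun j => (u.basis 2).baseChange K (Sum.inr j)) with hU
    have hUinj : Function.Injective (((d 1).baseChange K).domRestrict U) := by
      refine (injective_iff_map_eq_zero _).mpr ?_
      rintro ⟨y, hy⟩ hy0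
      apply Subtype.ext
      refine eq_zero_of_det_toBlocks₁₂_ne_zero _ _ _ hdet1 hy ?_
      change (d 1).baseChange K y = 0 at hy0
      rw [hy0]
      exact zero_mem _
    have hrange : LinearMap.range (((d 1).baseChange K).domRestrict U) =
        LinearMap.range ((d 1).baseChange K) := by
      refine Submodule.eq_of_le_of_finrank_eq (by rintro _ ⟨y, rfl⟩; exact ⟨y, rfl⟩) ?_
      rw [LinearMap.finrank_range_of_inj hUinj, hU, finrank_span_eq_card, Fintype.card_fin]
      · rfl
      · exact ((u.basis 2).baseChange K).linearIndependent.comp _ Sum.inr_injective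
    obtain ⟨⟨y, hy⟩, hyx⟩ : x ∈ LinearMap.range (((d 1).baseChange K).domRestrict U) := by
      rw [hrange]
      exact (hgen.2 0 x).mp hdx0
    change (d 1).baseChange K y = x at hyx
    have hy0 : y = 0 := eq_zero_of_det_toBlocks₁₂_ne_zero _ _ _ hdet1 hy (by rw [hyx]; exact hx)
    rw [← hyx, hy0, map_zero]
  -- Since `u_0''` is empty, the rows of the first block run through a whole basis of `C_0`. In
  -- these coordinates its reduction maps into the image `W` of `d 0` over `κ`.
  · have hempty : IsEmpty (Fin (u.size 0)) := inferInstanceAs (IsEmpty (Fin 0))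
    set β := ((u.basis 0).baseChange κ).reindex (Equiv.sumEmpty _ (Fin (u.size 0))) with hβ
    set W := (LinearMap.range ((d 0).baseChange κ)).map β.equivFun.toLinearMap with hW
    have key := det_mem_maximalIdeal_pow
      ((u.block d 0).map (algebraMap A (Localization.AtPrime p))) W (fun v => ?_)
    · have e : Module.finrank κ ((Fin (u.size (0 + 1)) → κ) ⧸ W) =
          Module.finrank κ ((κ ⊗[A] C 0) ⧸ LinearMap.range ((d 0).baseChange κ)) :=
        (Submodule.Quotient.equiv _ _ β.equivFun rfl).finrank_eq.symm
      rw [RingHom.map_det, RingHom.mapMatrix_apply]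
      rw [← e]
      exact key
    · have e1 : ((u.block d 0).map (algebraMap A (Localization.AtPrime p))).map
          (IsLocalRing.residue (Localization.AtPrime p)) =
          (u.block d 0).map (algebraMap A κ) := by
        ext i j
        rfl
      set y : κ ⊗[A] C 1 := ∑ j, v j • (u.basis 1).baseChange κ (Sum.inr j) with hy
      have hym : y ∈ Submodule.span κ (Set.range fun j => (u.basis 1).baseChange κ (Sum.inr j)) :=
        sum_mem fun j _ => Submodule.smul_mem _ _ (Submodule.subset_span ⟨j, rfl⟩)
      have hr : (fun j => ((u.basis 1).baseChange κ).repr y (Sum.inr j)) = v := by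
        funext j
        simp [hy, Finsupp.single_apply, -Module.Basis.baseChange_apply]
      have h1 := toBlocks₁₂_mulVec_repr ((u.basis 1).baseChange κ) ((u.basis 0).baseChange κ)
        ((d 0).baseChange κ) hym
      rw [hr] at h1
      rw [e1, u.map_block, h1]
      refine ⟨(d 0).baseChange κ y, ⟨y, rfl⟩, ?_⟩
      funext i
      simp [hβ]

end Adapted


/-! ### Change of coefficients -/

/-- The retraction makes `P` a direct summand, so `k ⊗ P` embeds into the base change of `X`
although `k` need not be flat. This applies to homogeneous components. -/
theorem IsBaseChange.submodule_of_projection {A k : Type*} [CommRing A] [CommRing k] [Algebra A k]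
    {X Y : Type*} [AddCommGroup X] [Module A X] [AddCommGroup Y] [Module A Y] [Module k Y]
    [IsScalarTower A k Y] {j : X →ₗ[A] Y} (hj : IsBaseChange k j) {P : Submodule A X}
    (π : X →ₗ[A] P) (hπ : ∀ x : P, π x = x) {Q : Submodule k Y}
    (hQ : Q = Submodule.span k (j '' P)) (g : P →ₗ[A] Q) (hg : ∀ x, (g x : Y) = j x) :
    IsBaseChange k g := by
  set φ : k ⊗[A] P →ₗ[k] Y := hj.equiv.toLinearMap ∘ₗ P.subtype.baseChange k with hφ
  have hφ1 : ∀ (c : k) (x : P), φ (c ⊗ₜ x) = c • j x := fun c x => by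
    simp [hφ, IsBaseChange.equiv_tmul]
  have hinj : Function.Injective φ := by
    refine hj.equiv.injective.comp ?_
    refine Function.LeftInverse.injective (g := π.baseChange k) fun t => ?_
    rw [← LinearMap.comp_apply, ← LinearMap.baseChange_comp]
    have : π ∘ₗ P.subtype = LinearMap.id := LinearMap.ext hπ
    rw [this, LinearMap.baseChange_id, LinearMap.id_apply]
  have hrange : LinearMap.range φ = Q := by
    rw [hQ]
    apply le_antisymm
    · rintro _ ⟨t, rfl⟩
      induction t using TensorProduct.induction_on with
      | zero => rw [map_zero]; exact zero_mem _
      | tmul c x =>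
        rw [hφ1]
        exact Submodule.smul_mem _ _ (Submodule.subset_span ⟨x, x.2, rfl⟩)
      | add x y hx hy => rw [map_add]; exact add_mem hx hy
    · rw [Submodule.span_le]
      rintro _ ⟨x, hx, rfl⟩
      exact ⟨1 ⊗ₜ ⟨x, hx⟩, by rw [hφ1, one_smul]⟩
  refine IsBaseChange.of_equiv ((LinearEquiv.ofInjective φ hinj).trans
    (LinearEquiv.ofEq _ _ hrange)) fun x => ?_
  apply Subtype.ext
  rw [hg]
  change φ (1 ⊗ₜ x) = j x
  rw [hφ1, one_smul]

/-- Exactness is preserved by isomorphisms of complexes. -/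
theorem exact_of_linearEquiv {R : Type*} [CommRing R] {X Y Z X' Y' Z' : Type*} [AddCommGroup X]
    [Module R X] [AddCommGroup Y] [Module R Y] [AddCommGroup Z] [Module R Z] [AddCommGroup X']
    [Module R X'] [AddCommGroup Y'] [Module R Y'] [AddCommGroup Z'] [Module R Z']
    {f : X →ₗ[R] Y} {g : Y →ₗ[R] Z} {f' : X' →ₗ[R] Y'} {g' : Y' →ₗ[R] Z'}
    (eX : X ≃ₗ[R] X') (eY : Y ≃ₗ[R] Y') (eZ : Z ≃ₗ[R] Z') (hf : ∀ x, f' (eX x) = eY (f x))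
    (hg : ∀ y, g' (eY y) = eZ (g y)) (h : Function.Exact f' g') : Function.Exact f g := by
  intro y
  rw [← eZ.map_eq_zero_iff, ← hg, h (eY y)]
  constructor
  · rintro ⟨x', hx'⟩
    refine ⟨eX.symm x', eY.injective ?_⟩
    rw [← hf, eX.apply_symm_apply, hx']
  · rintro ⟨x, rfl⟩
    exact ⟨eX x, hf x⟩

section CoeffChange

variable {q : ℕ} {n : Fin q → ℕ} {A : Type*} [CommRing A]
  {M : Type*} [AddCommGroup M] [Module A M] [Module (MultiPoly n A) M]
  [IsScalarTower A (MultiPoly n A) M] (k : Type*) [CommRing k] [Algebra A k]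

/-- The map `M → M ⊗_A k`. -/
noncomputable def coeffMap (n : Fin q → ℕ) (A : Type*) [CommRing A] (M : Type*) [AddCommGroup M]
    [Module A M] [Module (MultiPoly n A) M] [IsScalarTower A (MultiPoly n A) M] (k : Type*)
    [CommRing k] [Algebra A k] : M →ₗ[A] CoeffChange n A k M :=
  (TensorProduct.mk (MultiPoly n A) (MultiPoly n k) M 1).restrictScalars A

theorem coeffMap_apply (m : M) :
    coeffMap n A M k m = (1 : MultiPoly n k) ⊗ₜ[MultiPoly n A] m := rfl

theorem isBaseChange_coeffMap : IsBaseChange k (coeffMap n A M k) :=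
  IsBaseChange.of_equiv (Algebra.IsPushout.cancelBaseChange A k (MultiPoly n A) (MultiPoly n k)
    M).symm fun x => by
      rw [Algebra.IsPushout.cancelBaseChange_symm_tmul, map_one]
      rfl

theorem coeffMap_smul (f : MultiPoly n A) (m : M) :
    coeffMap n A M k (f • m) =
      (MvPolynomial.map (algebraMap A k) f : MultiPoly n k) • coeffMap n A M k m := by
  rw [coeffMap_apply, coeffMap_apply, TensorProduct.smul_tmul', ← TensorProduct.smul_tmul,
    smul_eq_mul, mul_one, Algebra.smul_def, mul_one]
  rfl

theorem IsMultihomogeneous.map {f : MultiPoly n A} {d : Fin q → ℕ} (hf : IsMultihomogeneous f d) :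
    IsMultihomogeneous (MvPolynomial.map (algebraMap A k) f : MultiPoly n k) d := by
  intro e he
  refine hf fun h => he ?_
  rw [MvPolynomial.coeff_map, h, map_zero]

variable {gr : (Fin q → ℕ) → Submodule A M}

theorem coeffMap_mem {ν : Fin q → ℕ} {m : M} (hm : m ∈ gr ν) :
    coeffMap n A M k m ∈ coeffChangeGrading n k gr ν :=
  Submodule.subset_span ⟨m, hm, rfl⟩

/-- The change of coefficients of the projection to a component. -/
noncomputable def coeffProj (hgr : IsMultigraded n gr) (ν : Fin q → ℕ) :
    CoeffChange n A k M →ₗ[k] CoeffChange n A k M :=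
  (isBaseChange_coeffMap k).equiv.toLinearMap ∘ₗ (hgr.proj ν).baseChange k ∘ₗ
    (isBaseChange_coeffMap k).equiv.symm.toLinearMap

theorem coeffProj_coeffMap (hgr : IsMultigraded n gr) (ν : Fin q → ℕ) (m : M) :
    coeffProj k hgr ν (coeffMap n A M k m) = coeffMap n A M k (hgr.proj ν m) := by
  simp [coeffProj, IsBaseChange.equiv_symm_apply, IsBaseChange.equiv_tmul]

theorem coeffProj_of_mem (hgr : IsMultigraded n gr) {ν : Fin q → ℕ} {x : CoeffChange n A k M}
    (hx : x ∈ coeffChangeGrading n k gr ν) : coeffProj k hgr ν x = x := by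
  have : coeffChangeGrading n k gr ν ≤ LinearMap.eqLocus (coeffProj k hgr ν) LinearMap.id := by
    refine Submodule.span_le.mpr ?_
    rintro _ ⟨m, hm, rfl⟩
    change coeffProj k hgr ν (coeffMap n A M k m) = coeffMap n A M k m
    rw [coeffProj_coeffMap, hgr.proj_of_mem hm]
  exact this hx

theorem coeffProj_of_mem_ne (hgr : IsMultigraded n gr) {μ ν : Fin q → ℕ} (h : ν ≠ μ)
    {x : CoeffChange n A k M} (hx : x ∈ coeffChangeGrading n k gr μ) : coeffProj k hgr ν x = 0 := by
  have : coeffChangeGrading n k gr μ ≤ LinearMap.ker (coeffProj k hgr ν) := by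
    refine Submodule.span_le.mpr ?_
    rintro _ ⟨m, hm, rfl⟩
    change coeffProj k hgr ν (coeffMap n A M k m) = 0
    rw [coeffProj_coeffMap, hgr.proj_of_mem_ne hm h, map_zero]
  exact this hx

theorem isMultigraded_coeffChangeGrading (hgr : IsMultigraded n gr) :
    IsMultigraded n (coeffChangeGrading n k gr) where
  isInternal := by
    classical
    rw [DirectSum.isInternal_submodule_iff_iSupIndep_and_iSup_eq_top]
    constructor
    · intro ν
      rw [Submodule.disjoint_def]
      intro x hx hx'
      rw [← coeffProj_of_mem k hgr hx]
      have : (⨆ (μ) (_ : μ ≠ ν), coeffChangeGrading n k gr μ) ≤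
          LinearMap.ker (coeffProj k hgr ν) :=
        iSup₂_le fun μ hμ y hy => coeffProj_of_mem_ne k hgr hμ.symm hy
      exact this hx'
    · rw [eq_top_iff]
      intro x _
      refine IsBaseChange.inductionOn (isBaseChange_coeffMap k) x _ (zero_mem _) (fun m => ?_)
        (fun c y hy => Submodule.smul_mem _ c hy) (fun _ _ h1 h2 => add_mem h1 h2)
      refine hgr.induction_on (P := fun m => coeffMap n A M k m ∈ _) m (fun ν m hm => ?_) ?_ ?_
      · exact Submodule.mem_iSup_of_mem ν (coeffMap_mem k hm)
      · rw [map_zero]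
        exact zero_mem _
      · intro x y hx hy
        rw [map_add]
        exact add_mem hx hy
  smul_mem a b f x hf hx := by
    have key : ∀ m ∈ gr b, f • coeffMap n A M k m ∈ coeffChangeGrading n k gr (a + b) := by
      intro m hm
      -- A polynomial over `k` need not come from `A`, but each of its terms is a scalar times the
      -- image of a monomial over `A`.
      rw [MvPolynomial.as_sum f, Finset.sum_smul]
      refine sum_mem fun e he => ?_
      have h1 : (MvPolynomial.monomial e (f.coeff e) : MultiPoly n k) =
          f.coeff e • (MvPolynomial.map (algebraMap A k) (MvPolynomial.monomial e 1) :
            MultiPoly n k) := by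
        rw [MvPolynomial.map_monomial, map_one, MvPolynomial.smul_monomial, smul_eq_mul, mul_one]
      rw [h1, smul_assoc, ← coeffMap_smul]
      refine Submodule.smul_mem _ _ (coeffMap_mem k (hgr.smul_mem _ _ _ _ ?_ hm))
      exact MvPolynomial.isWeightedHomogeneous_monomial _ _ _
        (hf (MvPolynomial.mem_support_iff.mp he))
    have : coeffChangeGrading n k gr b ≤ (coeffChangeGrading n k gr (a + b)).comap
        ((LinearMap.lsmul (MultiPoly n k) (CoeffChange n A k M) f).restrictScalars k) := by
      refine Submodule.span_le.mpr ?_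
      rintro _ ⟨m, hm, rfl⟩
      exact key m hm
    exact this hx

theorem koszulPiece_coeffChangeGrading {s : ℕ} (d : Fin s → (Fin q → ℕ)) (ν : Fin q → ℕ)
    (S : Finset (Fin s)) : koszulPiece (coeffChangeGrading n k gr) d ν S =
      Submodule.span k (coeffMap n A M k '' (koszulPiece gr d ν S : Set M)) := by
  unfold koszulPiece
  split_ifs
  · rfl
  · simp

variable (n) in
/-- The map from a summand of the Koszul complex to its change of coefficients. -/
noncomputable def coeffPiece (gr : (Fin q → ℕ) → Submodule A M) {s : ℕ} (d : Fin s → (Fin q → ℕ))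
    (ν : Fin q → ℕ) (S : Finset (Fin s)) :
    koszulPiece gr d ν S →ₗ[A] koszulPiece (coeffChangeGrading n k gr) d ν S :=
  (coeffMap n A M k ∘ₗ Submodule.subtype _).codRestrict
    ((koszulPiece (coeffChangeGrading n k gr) d ν S).restrictScalars A) fun x => by
      rw [koszulPiece_coeffChangeGrading]
      exact Submodule.subset_span ⟨x, x.2, rfl⟩

theorem isBaseChange_coeffPiece (hgr : IsMultigraded n gr) {s : ℕ} (d : Fin s → (Fin q → ℕ))
    (ν : Fin q → ℕ) (S : Finset (Fin s)) : IsBaseChange k (coeffPiece n k gr d ν S) := by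
  by_cases h : ∑ i ∈ S, d i ≤ ν
  · have e : koszulPiece gr d ν S = gr (ν - ∑ i ∈ S, d i) := if_pos h
    refine (isBaseChange_coeffMap k).submodule_of_projection
      ((hgr.proj (ν - ∑ i ∈ S, d i)).codRestrict _ fun m => e.symm.le (hgr.proj_mem _ m))
      (fun x => Subtype.ext (hgr.proj_of_mem (e.le x.2)))
      (koszulPiece_coeffChangeGrading k d ν S) _ fun _ => rfl
  · have e : koszulPiece gr d ν S = ⊥ := if_neg h
    refine (isBaseChange_coeffMap k).submodule_of_projection 0 (fun x => Subtype.ext ?_)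
      (koszulPiece_coeffChangeGrading k d ν S) _ fun _ => rfl
    exact ((Submodule.mem_bot A).mp (e.le x.2)).symm

variable (n) in
/-- The map from a component of the Koszul complex to its change of coefficients. -/
noncomputable def coeffSlice (gr : (Fin q → ℕ) → Submodule A M) {s : ℕ} (d : Fin s → (Fin q → ℕ))
    (ν : Fin q → ℕ) (p : ℕ) :
    KoszulSlice gr d ν p →ₗ[A] KoszulSlice (coeffChangeGrading n k gr) d ν p :=
  LinearMap.pi fun S => coeffPiece n k gr d ν S.1 ∘ₗ LinearMap.proj S

theorem isBaseChange_coeffSlice (hgr : IsMultigraded n gr) {s : ℕ} (d : Fin s → (Fin q → ℕ))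
    (ν : Fin q → ℕ) (p : ℕ) : IsBaseChange k (coeffSlice n k gr d ν p) :=
  IsBaseChange.pi _ fun S => isBaseChange_coeffPiece k hgr d ν S.1

theorem koszulExtend_coeffSlice {s : ℕ} {d : Fin s → (Fin q → ℕ)} {ν : Fin q → ℕ} {p : ℕ}
    (c : KoszulSlice gr d ν p) (S : Finset (Fin s)) :
    koszulExtend (coeffSlice n k gr d ν p c) S = coeffMap n A M k (koszulExtend c S) := by
  unfold koszulExtend
  split_ifs
  · rfl
  · rw [map_zero]

variable {s : ℕ} {d : Fin s → (Fin q → ℕ)} {f : Fin s → MultiPoly n A}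

theorem koszulDiff_coeffSlice (hgr : IsMultigraded n gr)
    (hf : ∀ i, IsMultihomogeneous (f i) (d i)) (ν : Fin q → ℕ) (p : ℕ)
    (c : KoszulSlice gr d ν (p + 1)) :
    koszulDiff (isMultigraded_coeffChangeGrading k hgr) (fun i => (hf i).map k) ν p
      (coeffSlice n k gr d ν (p + 1) c) = coeffSlice n k gr d ν p (koszulDiff hgr hf ν p c) := by
  funext T
  apply Subtype.ext
  rw [koszulDiff_apply, koszulD_apply]
  change _ = coeffMap n A M k (koszulDiff hgr hf ν p c T : M)
  rw [koszulDiff_apply, koszulD_apply, map_sum]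
  refine Finset.sum_congr rfl fun i _ => ?_
  split_ifs
  · rw [map_zero]
  · rw [koszulExtend_coeffSlice, map_zsmul, coeffMap_smul]

theorem koszulDiff_equiv (hgr : IsMultigraded n gr)
    (hf : ∀ i, IsMultihomogeneous (f i) (d i)) (ν : Fin q → ℕ) (p : ℕ)
    (t : k ⊗[A] KoszulSlice gr d ν (p + 1)) :
    koszulDiff (isMultigraded_coeffChangeGrading k hgr) (fun i => (hf i).map k) ν p
      ((isBaseChange_coeffSlice k hgr d ν (p + 1)).equiv t) =
    (isBaseChange_coeffSlice k hgr d ν p).equiv ((koszulDiff hgr hf ν p).baseChange k t) := by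
  induction t using TensorProduct.induction_on with
  | zero => simp only [map_zero]
  | tmul c x =>
    rw [IsBaseChange.equiv_tmul, LinearMap.baseChange_tmul, IsBaseChange.equiv_tmul, map_smul,
      koszulDiff_coeffSlice]
  | add x y hx hy => simp only [map_add, hx, hy]

theorem exact_baseChange_koszulDiff (hgr : IsMultigraded n gr)
    (hf : ∀ i, IsMultihomogeneous (f i) (d i)) (ν : Fin q → ℕ) (p : ℕ)
    (h : Function.Exact
      (koszulDiff (isMultigraded_coeffChangeGrading k hgr) (fun i => (hf i).map k) ν (p + 1))
      (koszulDiff (isMultigraded_coeffChangeGrading k hgr) (fun i => (hf i).map k) ν p)) :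
    Function.Exact ((koszulDiff hgr hf ν (p + 1)).baseChange k)
      ((koszulDiff hgr hf ν p).baseChange k) :=
  exact_of_linearEquiv (isBaseChange_coeffSlice k hgr d ν (p + 1 + 1)).equiv
    (isBaseChange_coeffSlice k hgr d ν (p + 1)).equiv (isBaseChange_coeffSlice k hgr d ν p).equiv
    (koszulDiff_equiv k hgr hf ν (p + 1)) (koszulDiff_equiv k hgr hf ν p) h

/-- The cokernel of the base change of the last differential of the Koszul complex. -/
noncomputable def quotientRangeKoszulDiffEquiv (hgr : IsMultigraded n gr)
    (hf : ∀ i, IsMultihomogeneous (f i) (d i)) (ν : Fin q → ℕ) :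
    ((k ⊗[A] KoszulSlice gr d ν 0) ⧸ LinearMap.range ((koszulDiff hgr hf ν 0).baseChange k)) ≃ₗ[k]
      KoszulSlice (coeffChangeGrading n k gr) d ν 0 ⧸ LinearMap.range
        (koszulDiff (isMultigraded_coeffChangeGrading k hgr) (fun i => (hf i).map k) ν 0) :=
  Submodule.Quotient.equiv _ _ (isBaseChange_coeffSlice k hgr d ν 0).equiv (by
    ext y
    constructor
    · rintro ⟨_, ⟨t, rfl⟩, rfl⟩
      exact ⟨_, koszulDiff_equiv k hgr hf ν 0 t⟩
    · rintro ⟨x, rfl⟩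
      obtain ⟨t, rfl⟩ := (isBaseChange_coeffSlice k hgr d ν (0 + 1)).equiv.surjective x
      exact ⟨_, ⟨t, rfl⟩, (koszulDiff_equiv k hgr hf ν 0 t).symm⟩)

/-- The components of the change of coefficients. -/
theorem exists_equiv_coeffChangeGrading (hgr : IsMultigraded n gr) (ν : Fin q → ℕ) :
    Nonempty ((k ⊗[A] gr ν) ≃ₗ[k] coeffChangeGrading n k gr ν) := by
  have h := (isBaseChange_coeffMap k).submodule_of_projection
    ((hgr.proj ν).codRestrict (gr ν) fun m => hgr.proj_mem _ m)
    (fun x => Subtype.ext (hgr.proj_of_mem x.2)) (Q := coeffChangeGrading n k gr ν) rfl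
    ((coeffMap n A M k ∘ₗ Submodule.subtype _).codRestrict
      ((coeffChangeGrading n k gr ν).restrictScalars A) fun x => coeffMap_mem k x.2) fun _ => rfl
  exact ⟨h.equiv⟩

end CoeffChange


/-! ### Filter-depth and relevant degrees over a field -/

section RelevantDegree

variable {q : ℕ} {n : Fin q → ℕ}

/-- A finite supremum of natural numbers is attained; the empty sequence covers `r = 0`. -/
theorem exists_isFilterRegularSeq_of_filterDepth {A : Type*} [CommRing A]
    {M : Type*} [AddCommGroup M] [Module A M] [Module (MultiPoly n A) M]
    [IsScalarTower A (MultiPoly n A) M] {gr : (Fin q → ℕ) → Submodule A M}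
    {J : Ideal (MultiPoly n A)} {r : ℕ} (h : filterDepth n gr J = r) :
    ∃ g : Fin r → MultiPoly n A, IsFilterRegularSeq n gr g ∧ ∀ i, g i ∈ J := by
  by_contra hno
  cases r with
  | zero => exact hno ⟨fun i => i.elim0, fun i => i.elim0, fun i => i.elim0⟩
  | succ r =>
    have hle : filterDepth n gr J ≤ r := by
      refine iSup₂_le fun t ht => ?_
      have h1 : (t : ℕ∞) ≤ ((r + 1 : ℕ) : ℕ∞) := by
        rw [← h]
        exact le_iSup₂_of_le t ht le_rfl
      have h2 : t ≤ r + 1 := Nat.cast_le.mp h1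
      have h3 : t ≠ r + 1 := by
        rintro rfl
        exact hno ht
      exact Nat.cast_le.mpr (by omega)
    rw [h] at hle
    have : r + 1 ≤ r := Nat.cast_le.mp hle
    omega

variable {k : Type*} [Field k] {M : Type*} [AddCommGroup M] [Module k M]
  [Module (MultiPoly n k) M] [IsScalarTower k (MultiPoly n k) M]
  {gr : (Fin q → ℕ) → Submodule k M}

/-- If the filter-depth is the relevant dimension, then the Hilbert polynomial of the quotient is
constant. -/
theorem exists_eventually_gradedLength_eq [IsNoetherian (MultiPoly n k) M]
    (hgr : IsMultigraded n gr) (hfin : ∀ ν, Module.Finite k (gr ν)) {r : ℕ}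
    (hdeg : IsDeg (r + 1) fun ν => (Module.finrank k (gr ν) : ℚ)) {s : ℕ}
    {f : Fin s → MultiPoly n k} {d : Fin s → (Fin q → ℕ)}
    (hf : ∀ i, IsMultihomogeneous (f i) (d i)) {g : Fin r → MultiPoly n k}
    (hg : IsFilterRegularSeq n gr g) (hgf : ∀ i, g i ∈ Ideal.span (Set.range f)) :
    ∃ (e : ℕ) (ν₀ : Fin q → ℕ), ∀ ν, ν₀ ≤ ν → gradedLength gr k ⊤ (seqMod M f s) ν = e := by
  have hL : ∀ ν, gradedLength gr k (⊤ : Submodule (MultiPoly n k) M) ⊥ ν =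
    Module.finrank k (gr ν) := gradedLength_top_bot_field (fun _ => inferInstance) hfin k
  have hL' : ∀ ν, gradedLength gr k (⊤ : Submodule (MultiPoly n k) M) ⊥ ν ≠ ⊤ := fun ν => by
    rw [hL]
    exact ENat.natCast_ne_top _
  have hne := gradedLength_ne_top_of_bot k hL'
  choose δ hδ using fun i => (hg i).1
  have h1 : IsDeg 1 fun ν => ((gradedLength gr k ⊤ (seqMod M g r) ν).toNat : ℚ) := by
    refine isDeg_seqMod k hgr hδ hg hL' r le_rfl ?_
    simp only [hL, ENat.toNat_natCast]
    rwa [add_comm]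
  obtain ⟨D, hD⟩ := exists_isDeg_gradedLength k hgr hgr.isHomog_top (isHomog_seqMod hgr hf s)
    ⟨0, fun ν _ => hne _ _ ν⟩
  have hle : seqMod M g r ≤ seqMod M f s := by
    rw [seqMod_self, seqMod_self]
    refine Submodule.smul_mono_left (Ideal.span_le.mpr ?_)
    rintro _ ⟨i, rfl⟩
    exact hgf i
  -- The quotient by `(f)` is a quotient of the one by `(g)`, whose Hilbert function is eventually
  -- constant; being eventually polynomial and bounded by it, its own Hilbert function is eventually
  -- constant too.
  obtain ⟨ν₀, h0⟩ := (hD.of_le h1 ⟨0, fun ν _ => Nat.cast_nonneg _⟩ ⟨0, fun ν _ =>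
    Nat.cast_le.mpr (ENat.toNat_le_toNat (gradedLength_anti_right k hle ν) (hne _ _ ν))⟩
    ).eventually_const
  refine ⟨(gradedLength gr k ⊤ (seqMod M f s) ν₀).toNat, ν₀, fun ν hν => ?_⟩
  rw [← ENat.natCast_toNat (hne ⊤ (seqMod M f s) ν)]
  exact congrArg _ (Nat.cast_injective (h0 ν hν))

theorem gradedLength_eq_finrank_quotientGrading (hfin : ∀ ν, Module.Finite k (gr ν))
    (J : Ideal (MultiPoly n k)) (ν : Fin q → ℕ) :
    gradedLength gr k ⊤ (J • ⊤ : Submodule (MultiPoly n k) M) ν =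
      Module.finrank k (quotientGrading n gr J ν) := by
  have : Module.Finite k (quotientGrading n gr J ν) := by
    have := hfin ν
    unfold quotientGrading
    infer_instance
  have h := flatLength_field (A := k) k (quotientGrading n gr J ν)
  rw [← h]
  unfold gradedLength
  refine relLength_eq_of_surjective k
    (((J • ⊤ : Submodule (MultiPoly n k) M).mkQ.restrictScalars k).restrict
      (p := gradedPiece gr ⊤ ν) (q := quotientGrading n gr J ν)
      fun x hx => Submodule.mem_map_of_mem hx.1) ?_ ?_
  · rintro ⟨_, x, hx, rfl⟩
    exact ⟨⟨x, hx, trivial⟩, rfl⟩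
  · intro x
    rw [← Subtype.coe_inj]
    exact Submodule.Quotient.mk_eq_zero _

theorem hasRelevantDegree_of_gradedLength_eq (hfin : ∀ ν, Module.Finite k (gr ν))
    (J : Ideal (MultiPoly n k)) {e : ℕ}
    (h : ∃ ν₀ : Fin q → ℕ, ∀ ν, ν₀ ≤ ν →
      gradedLength gr k ⊤ (J • ⊤ : Submodule (MultiPoly n k) M) ν = e) :
    HasRelevantDegree (quotientGrading n gr J) e := by
  obtain ⟨ν₀, h0⟩ := h
  refine ⟨ν₀, fun ν hν => ?_⟩
  rw [MvPolynomial.eval_C, Module.finrank_baseChange]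
  have h1 := h0 ν hν
  rw [gradedLength_eq_finrank_quotientGrading hfin] at h1
  exact_mod_cast h1.symm

end RelevantDegree

/-! ### Koszul complexes of componentwise free modules -/

section FreeSlices

variable {q : ℕ} {n : Fin q → ℕ} {A : Type*} [CommRing A]
  {M : Type*} [AddCommGroup M] [Module A M] [Module (MultiPoly n A) M]
  {gr : (Fin q → ℕ) → Submodule A M} {s : ℕ}

theorem free_koszulSlice (hfree : ∀ ν, Module.Free A (gr ν)) (d : Fin s → (Fin q → ℕ))
    (ν : Fin q → ℕ) (p : ℕ) : Module.Free A (KoszulSlice gr d ν p) := by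
  have : ∀ S : {S : Finset (Fin s) // S.card = p}, Module.Free A (koszulPiece gr d ν S.1) := by
    intro S
    by_cases h : ∑ i ∈ S.1, d i ≤ ν
    · rw [show koszulPiece gr d ν S.1 = _ from if_pos h]
      exact hfree _
    · rw [show koszulPiece gr d ν S.1 = _ from if_neg h]
      infer_instance
  infer_instance

theorem finite_koszulSlice (hfin : ∀ ν, Module.Finite A (gr ν)) (d : Fin s → (Fin q → ℕ))
    (ν : Fin q → ℕ) (p : ℕ) : Module.Finite A (KoszulSlice gr d ν p) := by
  have : ∀ S : {S : Finset (Fin s) // S.card = p}, Module.Finite A (koszulPiece gr d ν S.1) := by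
    intro S
    by_cases h : ∑ i ∈ S.1, d i ≤ ν
    · rw [show koszulPiece gr d ν S.1 = _ from if_pos h]
      exact hfin _
    · rw [show koszulPiece gr d ν S.1 = _ from if_neg h]
      infer_instance
  infer_instance

theorem subsingleton_koszulSlice (d : Fin s → (Fin q → ℕ)) (ν : Fin q → ℕ) {p : ℕ} (hp : s < p) :
    Subsingleton (KoszulSlice gr d ν p) := by
  have : IsEmpty {S : Finset (Fin s) // S.card = p} := ⟨fun S => by
    have h1 := Finset.card_le_univ S.1
    rw [S.2, Fintype.card_fin] at h1
    omega⟩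
  infer_instance

variable [IsScalarTower A (MultiPoly n A) M] [IsDomain A] {f : Fin s → MultiPoly n A}
  {d : Fin s → (Fin q → ℕ)}

/-- Flatness of the fraction field preserves exactness, and `H_0` dies because it is torsion. -/
theorem isGenericallyExact_koszulDiff (hgr : IsMultigraded n gr)
    (hf : ∀ i, IsMultihomogeneous (f i) (d i)) {ν : Fin q → ℕ}
    (hex : ∀ p, Function.Exact (koszulDiff hgr hf ν (p + 1)) (koszulDiff hgr hf ν p))
    (htors : ∀ m ∈ gr ν, ∃ a : A, a ≠ 0 ∧ a • m ∈ seqMod M f s) :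
    IsGenericallyExact (koszulDiff hgr hf ν) := by
  constructor
  · intro t
    induction t using TensorProduct.induction_on with
    | zero => exact ⟨0, map_zero _⟩
    | tmul c x =>
      obtain ⟨a, ha, hax⟩ := htors (x ⟨∅, Finset.card_empty⟩)
        (koszulPiece_empty.le (x ⟨∅, Finset.card_empty⟩).2)
      obtain ⟨y, hy⟩ := (mem_range_koszulDiff_zero hgr hf ν (a • x)).mpr hax
      have ha' : algebraMap A (FractionRing A) a ≠ 0 := by
        rwa [Ne, FaithfulSMul.algebraMap_eq_zero_iff]
      refine ⟨(c * (algebraMap A (FractionRing A) a)⁻¹) ⊗ₜ y, ?_⟩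
      rw [LinearMap.baseChange_tmul, hy, ← TensorProduct.smul_tmul, Algebra.smul_def,
        mul_left_comm, mul_inv_cancel₀ ha', mul_one]
    | add x y hx hy =>
      obtain ⟨x', rfl⟩ := hx
      obtain ⟨y', rfl⟩ := hy
      exact ⟨x' + y', map_add _ _ _⟩
  · intro p
    rw [LinearMap.baseChange_eq_ltensor, LinearMap.baseChange_eq_ltensor]
    exact Module.Flat.lTensor_exact _ (hex p)

end FreeSlices

/-! ### Orders of Cayley determinants -/

section CayleyOrder

variable {A : Type*} [CommRing A] [IsDomain A] [UniqueFactorizationMonoid A] [IsNoetherianRing A]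
  {C : ℕ → Type*} [∀ i, AddCommGroup (C i)] [∀ i, Module A (C i)]
  [∀ i, Module.Free A (C i)] [∀ i, Module.Finite A (C i)]

/-- A complex without higher homology, whose reduction at a prime ideal is acyclic in degrees at
least two, has a Cayley determinant whose order is at least the dimension of the cokernel of the
reduction. -/
theorem exists_isCayleyDet_le_primeOrder (d : ∀ i, C (i + 1) →ₗ[A] C i) (s : ℕ) (hs0 : 0 < s)
    (hs : ∀ i, s < i → Subsingleton (C i)) (hgen : IsGenericallyExact d)
    (hex : ∀ i, Function.Exact (d (i + 1)) (d i)) (p : Ideal A) [p.IsPrime]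
    (hexp : ∀ i, Function.Exact ((d (i + 1 + 1)).baseChange p.ResidueField)
      ((d (i + 1)).baseChange p.ResidueField)) :
    ∃ a : A, IsCayleyDet d s (algebraMap A (FractionRing A) a) ∧
      (Module.finrank p.ResidueField ((p.ResidueField ⊗[A] C 0) ⧸
        LinearMap.range ((d 0).baseChange p.ResidueField)) : ℕ∞) ≤ primeOrder p a := by
  obtain ⟨u, hu, hu0, hmem⟩ := exists_partitionedBases d s hs hgen p hexp
  have hne : ∀ i < s, (u.block d i).det ≠ 0 := by
    rintro (_ | i) -
    · exact hu0
    · intro h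
      exact hu i (by rw [h]; exact zero_mem p)
  obtain ⟨a, ha⟩ := u.exists_evenDet_eq hne hex
  refine ⟨a, u.isCayleyDet hne ha, ?_⟩
  unfold primeOrder
  refine le_iSup₂_of_le _ ?_ le_rfl
  -- The first block has index `0`, so the denominator involves only blocks invertible at `p`, while
  -- the numerator is divisible by the first block.
  have hodd : IsUnit (algebraMap A (Localization.AtPrime p) (u.oddDet d s)) := by
    refine IsLocalization.map_units _ (⟨u.oddDet d s, ?_⟩ : p.primeCompl)
    unfold PartitionedBases.oddDet
    refine prod_mem fun i _ => ?_
    split_ifs with h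
    · exact one_mem _
    · cases i with
      | zero => exact absurd Even.zero h
      | succ i => exact hu i
  rw [← Ideal.unit_mul_mem_iff_mem _ hodd, ← map_mul, ← ha]
  have hdvd : (u.block d 0).det ∣ u.evenDet d s := by
    have := Finset.dvd_prod_of_mem (fun i => if Even i then (u.block d i).det else 1)
      (Finset.mem_range.mpr hs0)
    simpa [PartitionedBases.evenDet] using this
  exact Ideal.mem_of_dvd _ (map_dvd _ hdvd) hmem

end CayleyOrder


theorem mainTheorem2 {q : ℕ} (hq : 0 < q) (n : Fin q → ℕ) (hn : ∀ j, 0 < n j)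
    {A : Type*} [CommRing A] [IsDomain A] [IsNoetherianRing A] [UniqueFactorizationMonoid A]
    {M : Type*} [AddCommGroup M] [Module A M] [Module (MultiPoly n A) M]
    [IsScalarTower A (MultiPoly n A) M]
    (gr : (Fin q → ℕ) → Submodule A M) (hM : IsComponentwiseFree n gr)
    (r : ℕ) (hr : HasRelevantDim gr r)
    (d : Fin (r + 1) → (Fin q → ℕ)) (f : Fin (r + 1) → MultiPoly n A)
    (hf : ∀ i, IsMultihomogeneous (f i) (d i)) (hreg : IsFilterRegularSeq n gr f)
    (p : Ideal A) [p.IsPrime]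
    (J : Ideal (MultiPoly n p.ResidueField))
    (hJ : J = Ideal.span (Set.range fun i =>
      MvPolynomial.map (algebraMap A p.ResidueField) (f i)))
    (hdepth : filterDepth n (coeffChangeGrading n p.ResidueField gr) J = (r : ℕ∞)) :
    (∃! R : Associates A, IsMResultant hM.multigraded hf R) ∧
    ∃ e : ℕ,
      HasRelevantDegree
        (quotientGrading n (coeffChangeGrading n p.ResidueField gr) J) e ∧
      ∀ R : Associates A, IsMResultant hM.multigraded hf R →
        (e : ℕ∞) ≤ primeOrderClass p R := by
  have hgr := hM.multigraded
  have hfree := hM.component_free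
  have hfin := hM.component_finite
  have := hM.finite
  have : IsNoetherian (MultiPoly n A) M := isNoetherian_of_isNoetherianRing_of_finite _ _
  have hdeg : IsDeg (r + 1) fun ν => (Module.finrank A (gr ν) : ℚ) := by
    obtain ⟨P, ⟨ν₀, hP⟩, -, hPr⟩ := hr
    have h := IsDeg.eval P
    rw [hPr] at h
    refine h.congr ⟨ν₀, fun ν hν => ?_⟩
    have := hfree ν
    rw [hP ν hν, Module.finrank_baseChange]
  set κ := p.ResidueField
  set gr' := coeffChangeGrading n κ gr with hgr'_def
  have hgr' : IsMultigraded n gr' := isMultigraded_coeffChangeGrading κ hgr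
  have hf' : ∀ i, IsMultihomogeneous
      (MvPolynomial.map (algebraMap A κ) (f i) : MultiPoly n κ) (d i) := fun i => (hf i).map κ
  have hfin' : ∀ ν, Module.Finite κ (gr' ν) := fun ν => by
    obtain ⟨e⟩ := exists_equiv_coeffChangeGrading κ hgr ν
    have := hfin ν
    exact Module.Finite.equiv e
  -- The components are free, so the reduction has the same Hilbert function as `M`.
  have hdeg' : IsDeg (r + 1) fun ν => (Module.finrank κ (gr' ν) : ℚ) := by
    refine hdeg.congr ⟨0, fun ν _ => ?_⟩
    obtain ⟨e⟩ := exists_equiv_coeffChangeGrading κ hgr ν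
    have := hfree ν
    rw [← e.finrank_eq, Module.finrank_baseChange]
  have : IsNoetherian (MultiPoly n κ) (CoeffChange n A κ M) :=
    isNoetherian_of_isNoetherianRing_of_finite _ _
  obtain ⟨g, hg, hgJ⟩ := exists_isFilterRegularSeq_of_filterDepth hdepth
  rw [hJ] at hgJ
  choose δ hδ using fun i => (hg i).1
  obtain ⟨e, ν₁, he⟩ := exists_eventually_gradedLength_eq hgr' hfin' hdeg' hf' hg hgJ
  -- There are `r + 1` elements but only `r` in the sequence `g`: over `κ` exactness may fail at
  -- `K_1`. Over `A` the sequence `f` itself serves and no degree above zero is lost.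
  obtain ⟨ν₂, hexκ⟩ := exact_koszulDiff hgr' hf' hδ hgJ hg.filterRegularMod
  obtain ⟨ν₃, hex⟩ := exact_koszulDiff hgr hf hf (fun i => Ideal.subset_span ⟨i, rfl⟩)
    hreg.filterRegularMod
  obtain ⟨ν₄, htors, hlen⟩ := exists_forall_prime_gradedLength_eq hgr hfree hfin hf hreg hdeg
  set ν₀ := (ν₁ ⊔ ν₂) ⊔ (ν₃ ⊔ ν₄)
  have hν₁ : ν₁ ≤ ν₀ := le_sup_left.trans le_sup_left
  have hν₂ : ν₂ ≤ ν₀ := le_sup_right.trans le_sup_left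
  have hν₃ : ν₃ ≤ ν₀ := le_sup_left.trans le_sup_right
  have hν₄ : ν₄ ≤ ν₀ := le_sup_right.trans le_sup_right
  have hexA : ∀ ν, ν₀ ≤ ν → ∀ i,
      Function.Exact (koszulDiff hgr hf ν (i + 1)) (koszulDiff hgr hf ν i) :=
    fun ν hν i => hex ν (hν₃.trans hν) i (by omega)
  have hgen : ∀ ν, ν₀ ≤ ν → IsGenericallyExact (koszulDiff hgr hf ν) := fun ν hν =>
    isGenericallyExact_koszulDiff hgr hf (hexA ν hν) (htors ν (hν₄.trans hν))
  have hdet : ∀ ν, ν₀ ≤ ν → ∃ a : A,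
      IsCayleyDet (koszulDiff hgr hf ν) (r + 1) (algebraMap A (FractionRing A) a) ∧
        (e : ℕ∞) ≤ primeOrder p a := by
    intro ν hν
    have := free_koszulSlice hfree d ν
    have := finite_koszulSlice hfin d ν
    have := finite_koszulSlice hfin' d ν 0
    obtain ⟨a, ha, hle⟩ := exists_isCayleyDet_le_primeOrder (koszulDiff hgr hf ν) (r + 1)
      (Nat.succ_pos r) (fun i hi => subsingleton_koszulSlice d ν hi) (hgen ν hν) (hexA ν hν) p
      (fun i => exact_baseChange_koszulDiff κ hgr hf ν (i + 1)
        (hexκ ν (hν₂.trans hν) (i + 1) (by omega)))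
    refine ⟨a, ha, le_trans (le_of_eq ?_) hle⟩
    rw [(quotientRangeKoszulDiffEquiv κ hgr hf ν).finrank_eq, ← flatLength_field κ,
      flatLength_quotient_range_koszulDiff]
    exact (he ν (hν₁.trans hν)).symm
  have hassoc : ∀ ν, ν₀ ≤ ν → ∀ ν', ν₀ ≤ ν' → ∀ a a' : A,
      IsCayleyDet (koszulDiff hgr hf ν) (r + 1) (algebraMap A (FractionRing A) a) →
      IsCayleyDet (koszulDiff hgr hf ν') (r + 1) (algebraMap A (FractionRing A) a') →
      Associated a a' := by
    intro ν hν ν' hν' a a' ha ha'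
    refine ha.associated ha' (hexA ν hν) (hexA ν' hν') fun P _ hP => ?_
    rw [flatLength_quotient_range_koszulDiff, flatLength_quotient_range_koszulDiff,
      (hlen P hP ν (hν₄.trans hν)).2, (hlen P hP ν' (hν₄.trans hν')).2]
  obtain ⟨a₀, ha₀, hle₀⟩ := hdet ν₀ le_rfl
  have hRes : IsMResultant hM.multigraded hf (Associates.mk a₀) := by
    refine ⟨ν₀, fun ν hν => ⟨hgen ν hν, ?_⟩⟩
    obtain ⟨a, ha, -⟩ := hdet ν hν
    exact ⟨a, ha, Associates.mk_eq_mk_iff_associated.mpr (hassoc ν hν ν₀ le_rfl a a₀ ha ha₀)⟩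
  -- Any other candidate is compared at a degree beyond both thresholds.
  have hUniq : ∀ R, IsMResultant hM.multigraded hf R → R = Associates.mk a₀ := by
    rintro R ⟨μ, hμ⟩
    obtain ⟨-, a, ha, rfl⟩ := hμ (μ ⊔ ν₀) le_sup_left
    exact Associates.mk_eq_mk_iff_associated.mpr
      (hassoc _ le_sup_right ν₀ le_rfl a a₀ ha ha₀)
  refine ⟨⟨_, hRes, hUniq⟩, e, ?_, fun R hR => ?_⟩
  · refine hasRelevantDegree_of_gradedLength_eq hfin' J ⟨ν₁, fun ν hν => ?_⟩
    rw [hJ, ← seqMod_self]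
    exact he ν hν
  · rw [hUniq R hR]
    exact hle₀
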